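/- **Setting.** For each security parameter $\lambda\in\mathbb N$ a generator samples bilinear groups $(\mathbb G,\mathbb G_T)$ of prime order $p>2^\lambda$ ($p>2$) with a pairing $e:\mathbb G\times\mathbb G\to\mathbb G_T$ satisfying $e(u^a,v^b)=e(u,v)^{ab}$ for all $u,v\in\mathbb G$ and $a,b\in\mathbb Z$, and $e(u,v)\ne 1$ for $u,v\neq 1$. The group description and the group elements are represented by strings of length polynomial in $\lambda$; membership in $\mathbb G$, both group laws and $e$ are computable in polynomial time. Every party knows $\lambda$, $p$ and the group description. All algorithms are uniform, randomized, and may draw uniform integers from a given range $\{0,\dots,n\}$; PPT means strict polynomial time in $\lambda$. For $u$ in $\mathbb G$ or $\mathbb G_T$ and $a\in\mathbb Z_p$, $u^a$ has the usual meaning. **mDBDH assumption.** For every PPT distinguisher $\mathcal B$, the difference $$\bigl|\Pr[\mathcal B(g,g^a,g^b,g^c,e(g,g)^{ab/c})=1]-\Pr[\mathcal B(g,g^a,g^b,g^c,e(g,g)^{z})=1]\bigr|$$ is negligible in $\lambda$, where $g$ is a uniform generator of $\mathbb G$ and $a,b,c,z$ are uniform in $\mathbb Z_p^*$. **Scheme.**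 Identities are elements of $\mathbb Z_p$. - *Setup.* The PKG picks a uniform generator $g$, uniform $h,Y,Z\in\mathbb G$ and $x\in\mathbb Z_p^*$, and publishes $\mathsf{mpk}=(g,X=g^x,Y,Z,h)$; the master key is $x$. - *Keygen for $\mathsf{ID}$.* The user sends a commitment $R\in\mathbb G$ and proves knowledge of $(t_0,\theta)$ with $R=h^{t_0}X^\theta$ by Okamoto's three-move witness indistinguishable protocol: the user sends $V\in\mathbb G$, gets a uniform challenge $c\in\mathbb Z_p$, answers $(z_1,z_2)$, and the PKG accepts if $h^{z_1}X^{z_2}=V R^c$. If it accepts, the PKG picks uniform $r',t_1\in\mathbb Z_p^*$ and returns $\bigl((Y R h^{t_1})^{1/x}(g^{\mathsf{ID}}Z)^{r'},\,X^{r'},\,t_1\bigr)$; otherwise it returns $\bot$. - *Well-formed keys.* A key $d=(d_1,d_2,d_3)\in\mathbb G\times\mathbb G\times\mathbb Z_p$ is well-formed for $\mathsf{ID}$ if $e(d_1,X)=e(Y,g)\,e(h,g)^{d_3}\,e(g^{\mathsf{ID}}Z,d_2)$. - *Encrypt.* To encrypt $m\in\mathbb G_T$ for $\mathsf{ID}$,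 pick a uniform $s\in\mathbb Z_p^*$ and output $\bigl(X^s,(g^{\mathsf{ID}}Z)^s,e(g,h)^s,m\,e(g,Y)^s\bigr)$. **Tracing.** A decryption device $\mathbb D$ is stateless: it answers each query by the same PPT algorithm, run with fresh coins on a fixed description of the device produced by the adversary. It is $\varepsilon$-useful for $\mathsf{ID}$ if it returns $m$ with probability at least $\varepsilon$ on a fresh encryption under $\mathsf{ID}$ of a uniform $m\in\mathbb G_T$. $\mathbf{Trace}^{\mathbb D}(\mathsf{mpk},d,\varepsilon)$ performs $L=\lceil 16\lambda/\varepsilon\rceil$ independent iterations: choose a uniform pair of distinct $s,s'\in\mathbb Z_p^*$ and a uniform $m\in\mathbb G_T$, put $C_1=X^s$, $C_2=(g^{\mathsf{ID}}Z)^s$, $C_3=e(g,h)^{s'}$, $C_4=m\cdot e(C_1,d_1)/\bigl(e(C_2,d_2)\,C_3^{d_3}\bigr)$, and increment a counter if $\mathbb D(C_1,C_2,C_3,C_4)=m$. It incriminates the PKG if the counter is $0$ at the end, and the user otherwise. **Game (selective-ID ComputeNewKey, black-box).** The adversary $\mathcal A$ announces $\mathsf{ID}^\star$ before seeing $\mathsf{mpk}$.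 Then Setup is run and $\mathcal A$ gets $\mathsf{mpk}$. In the role of the user, $\mathcal A$ may run polynomially many, possibly interleaved, executions of Keygen with the PKG, for pairwise distinct identities of its choice, $\mathsf{ID}^\star$ included. Finally it outputs a key $d$ and a stateless decryption device $\mathbb D$. It wins if $d$ is well-formed for $\mathsf{ID}^\star$, $\mathbb D$ is $\varepsilon$-useful for $\mathsf{ID}^\star$, and $\mathbf{Trace}^{\mathbb D}(\mathsf{mpk},d,\varepsilon)$ incriminates the PKG. **Theorem.** Let $\varepsilon=\varepsilon(\lambda)$ be at least the inverse of some polynomial in $\lambda$ for all sufficiently large $\lambda$. Under the mDBDH assumption, every PPT adversary wins the selective-ID ComputeNewKey game with probability negligible in $\lambda$. -/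

import Mathlib

open Filter Topology

noncomputable section

namespace AIBE

/-! ### Machine model: randomized programs with an explicit running time -/

/-- Values handled by programs: binary trees with natural numbers (i.e. bit strings) at the
leaves. -/
inductive Data : Type
  | nat (n : ℕ) : Data
  | pair (a b : Data) : Data

namespace Data

def fst : Data → Data
  | nat _ => nat 0
  | pair a _ => a

def snd : Data → Data
  | nat _ => nat 0
  | pair _ b => b

/-- The number at a leaf; a pair is read as `0`. -/
def toNat : Data → ℕ
  | nat n => n
  | pair _ _ => 0

/-- Length of the binary representation. -/
def size : Data → ℕ
  | nat n => n.size + 1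
  | pair a b => a.size + b.size + 1

end Data

inductive ArithOp : Type
  | add | sub | mul | div | mod

/-- Natural number arithmetic (truncated subtraction, Euclidean quotient and remainder). -/
def ArithOp.eval : ArithOp → ℕ → ℕ → ℕ
  | add, m, n => m + n
  | sub, m, n => m - n
  | mul, m, n => m * n
  | div, m, n => m / n
  | mod, m, n => m % n

/-- Randomized programs. They form a universal model for strict polynomial time: a
probabilistic Turing machine with a polynomial clock is a `loop` over its step function, and
conversely programs are run by a machine that stores trees as pointer structures with sharing. -/
inductive Prog : Type
  | id : Prog
  | const (n : ℕ) : Prog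
  | fst : Prog
  | snd : Prog
  | isPair : Prog
  | arith (op : ArithOp) : Prog
  /-- a uniformly random integer of `{0, …, n}`, where `n` is the argument -/
  | rand : Prog
  | pair (f g : Prog) : Prog
  /-- first `g`, then `f` -/
  | comp (f g : Prog) : Prog
  /-- `f` if the test `c` returns a nonzero number, `g` otherwise -/
  | ite (c f g : Prog) : Prog
  /-- on the argument `(n, x)`: apply `f` to `x`, `n` times in a row -/
  | loop (f : Prog) : Prog

/-- `n`-fold iteration of a randomized step, adding up the running times. -/
def iterate (F : Data → PMF (Data × ℕ)) : ℕ → Data → PMF (Data × ℕ)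
  | 0, x => pure (x, 0)
  | n + 1, x => do
      let y ← F x
      let z ← iterate F n y.1
      pure (z.1, y.2 + z.2 + 1)

/-- The joint distribution of the result and of the running time of a program. Structural
instructions take one step; instructions on numbers take time linear in the bit lengths. -/
def Prog.run : Prog → Data → PMF (Data × ℕ)
  | id, x => pure (x, 1)
  | const n, _ => pure (Data.nat n, 1 + n.size)
  | fst, x => pure (x.fst, 1)
  | snd, x => pure (x.snd, 1)
  | isPair, Data.nat _ => pure (Data.nat 0, 1)
  | isPair, Data.pair _ _ => pure (Data.nat 1, 1)
  | arith op, x =>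
      pure (Data.nat (op.eval x.fst.toNat x.snd.toNat),
        1 + x.fst.toNat.size + x.snd.toNat.size)
  | rand, x => do
      let r ← PMF.uniformOfFintype (Fin (x.toNat + 1))
      pure (Data.nat r.val, 1 + x.toNat.size)
  | pair f g, x => do
      let a ← f.run x
      let b ← g.run x
      pure (Data.pair a.1 b.1, a.2 + b.2 + 1)
  | comp f g, x => do
      let a ← g.run x
      let b ← f.run a.1
      pure (b.1, a.2 + b.2 + 1)
  | ite c f g, x => do
      let t ← c.run x
      let y ← if t.1.toNat = 0 then g.run x else f.run x
      pure (y.1, t.2 + y.2 + 1)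
  | loop f, x => do
      let y ← iterate f.run x.fst.toNat x.snd
      pure (y.1, y.2 + 1)

/-- The distribution of the result of a program. -/
def Prog.out (f : Prog) (x : Data) : PMF Data := (f.run x).map Prod.fst

/-- For all outcomes of its coins, `f` stops on `x` within `T` steps. -/
def Prog.RunsIn (f : Prog) (x : Data) (T : ℕ) : Prop :=
  ∀ r ∈ (f.run x).support, r.2 ≤ T

/-- For all outcomes of its coins, `f` returns `y` on `x`, within `T` steps. -/
def Prog.Computes (f : Prog) (x y : Data) (T : ℕ) : Prop :=
  ∀ r ∈ (f.run x).support, r.1 = y ∧ r.2 ≤ T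

/-! ### Asymptotics -/

/-- Eventually smaller than every inverse polynomial. -/
def Negligible (f : ℕ → ℝ) : Prop :=
  Asymptotics.SuperpolynomialDecay atTop (fun k : ℕ => (k : ℝ)) f

/-- Eventually bounded below by an inverse polynomial. -/
def Noticeable (ε : ℕ → ℝ) : Prop :=
  ∃ P : Polynomial ℕ, ∀ᶠ k in atTop, 1 ≤ ((P.eval k : ℕ) : ℝ) * ε k

/-! ### Bilinear groups -/

/-- Bilinear groups of prime order, with bit string representations of their elements and a
public description `desc` of the groups. -/
structure BilinearGroup : Type 1 where
  p : ℕ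
  prime : p.Prime
  two_lt : 2 < p
  G : Type
  GT : Type
  [commG : CommGroup G]
  [commGT : CommGroup GT]
  [fintypeG : Fintype G]
  [fintypeGT : Fintype GT]
  card_G : Fintype.card G = p
  card_GT : Fintype.card GT = p
  e : G → G → GT
  e_zpow : ∀ (u v : G) (a b : ℤ), e (u ^ a) (v ^ b) = e u v ^ (a * b)
  e_ne_one : ∀ u v : G, u ≠ 1 → v ≠ 1 → e u v ≠ 1
  encG : G → ℕ
  encGT : GT → ℕ
  encG_injective : Function.Injective encG
  encGT_injective : Function.Injective encGT
  desc : Data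

attribute [instance] BilinearGroup.commG BilinearGroup.commGT BilinearGroup.fintypeG
  BilinearGroup.fintypeGT

namespace BilinearGroup

variable (B : BilinearGroup)

instance : Fact B.p.Prime := ⟨B.prime⟩

instance : Nonempty {g : B.G // g ≠ 1} := by
  have h : 1 < Fintype.card B.G := by rw [B.card_G]; exact B.prime.one_lt
  have : Nontrivial B.G := Fintype.one_lt_card_iff_nontrivial.mp h
  obtain ⟨g, hg⟩ := exists_ne (1 : B.G)
  exact ⟨⟨g, hg⟩⟩

instance : Fintype {g : B.G // g ≠ 1} := Fintype.ofFinite _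

instance : Nonempty {s : (ZMod B.p)ˣ × (ZMod B.p)ˣ // s.1 ≠ s.2} := by
  have : Fact (2 < B.p) := ⟨B.two_lt⟩
  refine ⟨⟨(1, -1), fun h => ?_⟩⟩
  have h2 : (1 : ZMod B.p) = -1 := by simpa using congrArg Units.val h
  exact ZMod.neg_one_ne_one h2.symm

instance : Fintype {s : (ZMod B.p)ˣ × (ZMod B.p)ˣ // s.1 ≠ s.2} := Fintype.ofFinite _

variable {B}

/-- `u ^ a` for an exponent `a` modulo the group order `p`. -/
def pw (u : B.G) (a : ZMod B.p) : B.G := u ^ a.val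

/-- `u ^ a` in the target group, for an exponent `a` modulo `p`. -/
def pwT (u : B.GT) (a : ZMod B.p) : B.GT := u ^ a.val

def repG (u : B.G) : Data := Data.nat (B.encG u)

def repGT (u : B.GT) : Data := Data.nat (B.encGT u)

def repZ (a : ZMod B.p) : Data := Data.nat a.val

variable (B)

/-- The number in `d`, read modulo `p`. -/
def readZ (d : Data) : ZMod B.p := (d.toNat : ZMod B.p)

/-- The group element represented by the number in `d`, if there is one. -/
def readG (d : Data) : Option B.G := Function.partialInv B.encG d.toNat

/-- The public data known from the outset: the security parameter, the group order and the
description of the groups. -/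
def pub (k : ℕ) : Data := Data.pair (Data.nat k) (Data.pair (Data.nat B.p) B.desc)

end BilinearGroup

open BilinearGroup

/-- For each security parameter `k`, a random choice of bilinear groups of prime order
`p > 2 ^ k`. -/
structure GroupGen : Type 1 where
  sample : ℕ → PMF BilinearGroup
  order_gt : ∀ k, ∀ B ∈ (sample k).support, 2 ^ k < B.p

/-- The description and the group elements have representations of polynomial length, and membership in `G`, the two
group laws and the pairing are computed by polynomial time programs. -/
def GroupGen.Efficient (gen : GroupGen) : Prop :=
  ∃ (memG mulG mulGT pairing : Prog) (P : Polynomial ℕ),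
    ∀ k, ∀ B ∈ (gen.sample k).support,
      B.desc.size ≤ P.eval k ∧
      (∀ u : B.G, (B.encG u).size ≤ P.eval k) ∧
      (∀ u : B.GT, (B.encGT u).size ≤ P.eval k) ∧
      (∀ u : B.G, memG.Computes (.pair (B.pub k) (repG u)) (.nat 1) (P.eval k)) ∧
      (∀ n : ℕ, n ∉ Set.range B.encG →
        memG.Computes (.pair (B.pub k) (.nat n)) (.nat 0) (P.eval k + P.eval n.size)) ∧
      (∀ u v : B.G, mulG.Computes (.pair (B.pub k) (.pair (repG u) (repG v)))
        (repG (u * v)) (P.eval k)) ∧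
      (∀ u v : B.GT, mulGT.Computes (.pair (B.pub k) (.pair (repGT u) (repGT v)))
        (repGT (u * v)) (P.eval k)) ∧
      (∀ u v : B.G, pairing.Computes (.pair (B.pub k) (.pair (repG u) (repG v)))
        (repGT (B.e u v)) (P.eval k))

/-! ### The modified Decision Bilinear Diffie-Hellman assumption -/

section mDBDH

variable (gen : GroupGen)

/-- The input of a distinguisher. -/
def mdbdhInput (k : ℕ) (B : BilinearGroup) (g Ta Tb Tc : B.G) (T : B.GT) : Data :=
  .pair (B.pub k) (.pair (repG g) (.pair (repG Ta) (.pair (repG Tb) (.pair (repG Tc) (repGT T)))))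

/-- A program whose running time on all problem instances is polynomial in `k`. -/
def IsPPTDistinguisher (D : Prog) : Prop :=
  ∃ P : Polynomial ℕ, ∀ k, ∀ B ∈ (gen.sample k).support, ∀ (g Ta Tb Tc : B.G) (T : B.GT),
    g ≠ 1 → D.RunsIn (mdbdhInput k B g Ta Tb Tc T) (P.eval k)

/-- The distinguisher receives `(g, g^a, g^b, g^c, e(g,g)^(ab/c))`. -/
def mdbdhReal (D : Prog) (k : ℕ) : PMF Data :=
  (gen.sample k).bind fun B => do
    let g ← PMF.uniformOfFintype {g : B.G // g ≠ 1}
    let a ← PMF.uniformOfFintype (ZMod B.p)ˣ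
    let b ← PMF.uniformOfFintype (ZMod B.p)ˣ
    let c ← PMF.uniformOfFintype (ZMod B.p)ˣ
    D.out (mdbdhInput k B g.1 (pw g.1 a) (pw g.1 b) (pw g.1 c)
      (pwT (B.e g.1 g.1) ((a * b / c : (ZMod B.p)ˣ) : ZMod B.p)))

/-- The distinguisher receives `(g, g^a, g^b, g^c, e(g,g)^z)`. -/
def mdbdhRandom (D : Prog) (k : ℕ) : PMF Data :=
  (gen.sample k).bind fun B => do
    let g ← PMF.uniformOfFintype {g : B.G // g ≠ 1}
    let a ← PMF.uniformOfFintype (ZMod B.p)ˣ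
    let b ← PMF.uniformOfFintype (ZMod B.p)ˣ
    let c ← PMF.uniformOfFintype (ZMod B.p)ˣ
    let z ← PMF.uniformOfFintype (ZMod B.p)ˣ
    D.out (mdbdhInput k B g.1 (pw g.1 a) (pw g.1 b) (pw g.1 c) (pwT (B.e g.1 g.1) z))

def mdbdhAdvantage (D : Prog) (k : ℕ) : ℝ :=
  |((mdbdhReal gen D k) (.nat 1)).toReal - ((mdbdhRandom gen D k) (.nat 1)).toReal|

/-- The modified DBDH assumption. -/
def MDBDH : Prop :=
  ∀ D : Prog, IsPPTDistinguisher gen D → Negligible (mdbdhAdvantage gen D)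

end mDBDH

/-! ### The scheme -/

section Scheme

variable (B : BilinearGroup)

structure PublicKey where
  g : B.G
  X : B.G
  Y : B.G
  Z : B.G
  h : B.G

structure UserKey where
  d₁ : B.G
  d₂ : B.G
  d₃ : ZMod B.p

structure Ciphertext where
  C₁ : B.G
  C₂ : B.G
  C₃ : B.GT
  C₄ : B.GT

variable {B}

/-- The identity hash `g^ID · Z`. -/
def PublicKey.hashID (mpk : PublicKey B) (ID : ZMod B.p) : B.G := pw mpk.g ID * mpk.Z

def Ciphertext.rep (C : Ciphertext B) : Data :=
  .pair (repG C.C₁) (.pair (repG C.C₂) (.pair (repGT C.C₃) (repGT C.C₄)))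

variable (B) in
/-- `Setup`, for given groups. -/
def setup : PMF (PublicKey B × (ZMod B.p)ˣ) := do
  let g ← PMF.uniformOfFintype {g : B.G // g ≠ 1}
  let h ← PMF.uniformOfFintype B.G
  let Y ← PMF.uniformOfFintype B.G
  let Z ← PMF.uniformOfFintype B.G
  let x ← PMF.uniformOfFintype (ZMod B.p)ˣ
  pure ({ g := g.1, X := pw g.1 x, Y := Y, Z := Z, h := h }, x)

/-- Encryption of `m` with the exponent `s`. -/
def encryptWith (mpk : PublicKey B) (ID : ZMod B.p) (m : B.GT) (s : ZMod B.p) :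
    Ciphertext B where
  C₁ := pw mpk.X s
  C₂ := pw (mpk.hashID ID) s
  C₃ := pwT (B.e mpk.g mpk.h) s
  C₄ := m * pwT (B.e mpk.g mpk.Y) s

/-- `Encrypt`. -/
def encrypt (mpk : PublicKey B) (ID : ZMod B.p) (m : B.GT) : PMF (Ciphertext B) := do
  let s ← PMF.uniformOfFintype (ZMod B.p)ˣ
  pure (encryptWith mpk ID m s)

/-- The private key `d` is well-formed for the identity `ID`. -/
def UserKey.Valid (mpk : PublicKey B) (ID : ZMod B.p) (d : UserKey B) : Prop :=
  B.e d.d₁ mpk.X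
    = B.e mpk.Y mpk.g * pwT (B.e mpk.h mpk.g) d.d₃ * B.e (mpk.hashID ID) d.d₂

/-- The last move of the PKG in `Keygen`: the blinded private key for a commitment `R`. -/
def issue (mpk : PublicKey B) (x : (ZMod B.p)ˣ) (ID : ZMod B.p) (R : B.G) :
    PMF (UserKey B) := do
  let r ← PMF.uniformOfFintype (ZMod B.p)ˣ
  let t₁ ← PMF.uniformOfFintype (ZMod B.p)ˣ
  pure { d₁ := pw (mpk.Y * R * pw mpk.h t₁) ((x⁻¹ : (ZMod B.p)ˣ) : ZMod B.p)
                * pw (mpk.hashID ID) r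
         d₂ := pw mpk.X r
         d₃ := t₁ }

/-- Verification in Okamoto's three-move witness indistinguishable proof of knowledge of
`(t₀, θ)` with `R = h^t₀ · X^θ`: first message `V`, challenge `c`, response `(z₁, z₂)`. -/
def Accepts (mpk : PublicKey B) (R V : B.G) (c z₁ z₂ : ZMod B.p) : Prop :=
  pw mpk.h z₁ * pw mpk.X z₂ = V * pw R c

end Scheme

/-! ### Key generation oracle -/

section Oracle

variable (B : BilinearGroup)

/-- State of the execution of `Keygen` for one identity. -/
inductive Session : Type
  | fresh : Session
  /-- the user has sent `R` and the first message `V` of the proof, and got the challenge `c` -/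
  | waiting (R V : B.G) (c : ZMod B.p) : Session
  | done : Session

/-- Messages that the game sends to the adversary. -/
inductive Msg : Type
  | mpk (pk : PublicKey B) : Msg
  | challenge (c : ZMod B.p) : Msg
  | key (d : UserKey B) : Msg
  | reject : Msg

variable {B}

def Msg.rep : Msg B → Data
  | mpk pk => .pair (.nat 0)
      (.pair (repG pk.g) (.pair (repG pk.X) (.pair (repG pk.Y) (.pair (repG pk.Z) (repG pk.h)))))
  | challenge c => .pair (.nat 1) (repZ c)
  | key d => .pair (.nat 2) (.pair (repG d.d₁) (.pair (repG d.d₂) (repZ d.d₃)))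
  | reject => .pair (.nat 3) (.nat 0)

open Classical in
/-- First message `(R, V)` of the user for the identity `ID`. An execution is started if there
was none for `ID` so far. -/
def openSession (ID : ZMod B.p) (R V : Option B.G) (S : ZMod B.p → Session B) :
    PMF (Msg B × (ZMod B.p → Session B)) :=
  match R, V, S ID with
  | some R, some V, .fresh => do
      let c ← PMF.uniformOfFintype (ZMod B.p)
      pure (.challenge c, Function.update S ID (.waiting R V c))
  | _, _, _ => pure (.reject, S)

open Classical in
/-- Response `(z₁, z₂)` of the user in the execution for the identity `ID`, which ends it. -/
def closeSession (mpk : PublicKey B) (x : (ZMod B.p)ˣ) (ID z₁ z₂ : ZMod B.p)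
    (S : ZMod B.p → Session B) : PMF (Msg B × (ZMod B.p → Session B)) :=
  match S ID with
  | .waiting R V c =>
      if Accepts mpk R V c z₁ z₂ then do
        let d ← issue mpk x ID R
        pure (.key d, Function.update S ID .done)
      else pure (.reject, Function.update S ID .done)
  | _ => pure (.reject, S)

/-- Reaction of the PKG to a message of the adversary, `(0, ID, R, V)` or `(1, ID, z₁, z₂)`.
Executions for different identities may be interleaved; each identity is served once. -/
def keygenOracle (mpk : PublicKey B) (x : (ZMod B.p)ˣ) (q : Data)
    (S : ZMod B.p → Session B) : PMF (Msg B × (ZMod B.p → Session B)) :=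
  if q.fst.toNat = 0 then
    openSession (B.readZ q.snd.fst) (B.readG q.snd.snd.fst) (B.readG q.snd.snd.snd) S
  else if q.fst.toNat = 1 then
    closeSession mpk x (B.readZ q.snd.fst) (B.readZ q.snd.snd.fst) (B.readZ q.snd.snd.snd) S
  else pure (.reject, S)

end Oracle

/-! ### Adversaries -/

/-- A dishonest user. `choose` maps the public data to `(ID⋆, state)`; `act` is the next-message
function, mapping `(incoming message, state)` to `(outgoing message, new state)`; `rounds`
bounds the number of messages to the PKG; the last outgoing message is the output of the
adversary, namely `((d₁, d₂, d₃), w)`, where `w` describes the decryption device: on a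
ciphertext `C` the device runs `decode` on `(C, w)` with fresh coins. -/
structure Adversary where
  choose : Prog
  act : Prog
  decode : Prog
  rounds : Polynomial ℕ

namespace Adversary

variable (A : Adversary)

/-- `A.Reaches k B n o`: `o` is a possible pair `(outgoing message, state)` of the adversary
after `n` activations of `act`, in an interaction with an arbitrary environment. -/
inductive Reaches (k : ℕ) (B : BilinearGroup) : ℕ → Data → Prop
  | choose {o : Data} : o ∈ (A.choose.out (B.pub k)).support → Reaches k B 0 o
  | act {n : ℕ} {o o' : Data} (m : Msg B) : Reaches k B n o →
      o' ∈ (A.act.out (.pair m.rep o.snd)).support → Reaches k B (n + 1) o'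

/-- All activations of the adversary and all runs of its decryption device take time
polynomial in `k`, whatever (well-formed) messages and ciphertexts they are given. -/
def IsPPT (gen : GroupGen) : Prop :=
  ∃ P : Polynomial ℕ, ∀ k, ∀ B ∈ (gen.sample k).support,
    A.choose.RunsIn (B.pub k) (P.eval k) ∧
    (∀ n ≤ A.rounds.eval k, ∀ o, A.Reaches k B n o → ∀ m : Msg B,
      A.act.RunsIn (.pair m.rep o.snd) (P.eval k)) ∧
    (∀ o, A.Reaches k B (A.rounds.eval k + 1) o → ∀ C : Ciphertext B,
      A.decode.RunsIn (.pair C.rep o.fst.snd) (P.eval k))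

end Adversary

/-! ### Tracing and the game -/

section Game

variable {B : BilinearGroup}

/-- A stateless decryption device: every ciphertext is answered with fresh randomness,
independently of earlier queries. -/
abbrev Device (B : BilinearGroup) : Type := Ciphertext B → PMF Data

open Classical in
/-- Does the device open a fresh encryption of a random message? -/
def opens (mpk : PublicKey B) (ID : ZMod B.p) (D : Device B) : PMF Bool := do
  let m ← PMF.uniformOfFintype B.GT
  let C ← encrypt mpk ID m
  let y ← D C
  pure (decide (y.toNat = B.encGT m))

/-- The device correctly opens a fraction at least `ε` of the ciphertexts for `ID`. -/
def Useful (mpk : PublicKey B) (ID : ZMod B.p) (ε : ℝ) (D : Device B) : Prop :=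
  ε ≤ ((opens mpk ID D) true).toReal

open Classical in
/-- One iteration of the tracing algorithm: is the counter incremented? -/
def probe (mpk : PublicKey B) (ID : ZMod B.p) (d : UserKey B) (D : Device B) : PMF Bool := do
  let s ← PMF.uniformOfFintype {s : (ZMod B.p)ˣ × (ZMod B.p)ˣ // s.1 ≠ s.2}
  let m ← PMF.uniformOfFintype B.GT
  let C₁ := pw mpk.X s.1.1
  let C₂ := pw (mpk.hashID ID) s.1.1
  let C₃ := pwT (B.e mpk.g mpk.h) s.1.2
  let y ← D { C₁ := C₁, C₂ := C₂, C₃ := C₃,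
              C₄ := m * (B.e C₁ d.d₁ / (B.e C₂ d.d₂ * pwT C₃ d.d₃)) }
  pure (decide (y.toNat = B.encGT m))

/-- The value of the counter after `L` independent iterations. -/
def counter (mpk : PublicKey B) (ID : ZMod B.p) (d : UserKey B) (D : Device B) : ℕ → PMF ℕ
  | 0 => pure 0
  | L + 1 => do
      let n ← counter mpk ID d D L
      let b ← probe mpk ID d D
      pure (if b then n + 1 else n)

inductive Verdict : Type
  | pkg | user
  deriving DecidableEq

/-- The tracing algorithm, with `L = ⌈16 k / ε⌉` iterations. -/
def trace (k : ℕ) (ε : ℝ) (mpk : PublicKey B) (ID : ZMod B.p) (d : UserKey B)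
    (D : Device B) : PMF Verdict := do
  let ctr ← counter mpk ID d D ⌈16 * (k : ℝ) / ε⌉₊
  pure (if ctr = 0 then .pkg else .user)

/-- Interaction of the adversary with the PKG: `n` messages to the PKG, then the output. The
arguments `m`, `σ`, `S` are the incoming message and the states of the two parties. -/
def interact (A : Adversary) (mpk : PublicKey B) (x : (ZMod B.p)ˣ) :
    ℕ → Msg B → Data → (ZMod B.p → Session B) → PMF Data
  | 0, m, σ, _ => do
      let o ← A.act.out (.pair m.rep σ)
      pure o.fst
  | n + 1, m, σ, S => do
      let o ← A.act.out (.pair m.rep σ)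
      let a ← keygenOracle mpk x o.fst S
      interact A mpk x n a.1 o.snd a.2

/-- The user key in the adversary's output, if it consists of group elements. -/
def readKey (B : BilinearGroup) (d : Data) : Option (UserKey B) :=
  match B.readG d.fst, B.readG d.snd.fst with
  | some d₁, some d₂ => some { d₁ := d₁, d₂ := d₂, d₃ := B.readZ d.snd.snd }
  | _, _ => none

open Classical in
/-- The end of the game: the adversary wins (`true`) if its key is well-formed for `ID`, its
device is `ε`-useful, and the tracing algorithm incriminates the PKG. -/
def judge (A : Adversary) (k : ℕ) (ε : ℝ) (mpk : PublicKey B) (ID : ZMod B.p) (o : Data) :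
    PMF Bool :=
  let D : Device B := fun C => A.decode.out (.pair C.rep o.snd)
  match readKey B o.fst with
  | none => pure false
  | some d =>
      if d.Valid mpk ID ∧ Useful mpk ID ε D then do
        let v ← trace k ε mpk ID d D
        pure (decide (v = .pkg))
      else pure false

/-- The selective-ID ComputeNewKey game in the black-box setting. -/
def computeNewKey (gen : GroupGen) (A : Adversary) (ε : ℝ) (k : ℕ) : PMF Bool :=
  (gen.sample k).bind fun B => do
    let o ← A.choose.out (B.pub k)
    let keys ← setup B
    let w ← interact A keys.1 keys.2 (A.rounds.eval k) (.mpk keys.1) o.snd (fun _ => .fresh)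
    judge A k ε keys.1 (B.readZ o.fst) w

end Game

/-- The adversary's advantage: its probability of winning. -/
def advantage (gen : GroupGen) (A : Adversary) (ε : ℕ → ℝ) (k : ℕ) : ℝ :=
  ((computeNewKey gen A (ε k) k) true).toReal

end AIBE

end

/-!
Tracing is sound because a device that decrypts ordinary ciphertexts but fails in the tracing
algorithm tells ciphertexts with equal exponents `s = s'` from ciphertexts with independent ones,
and this is the mDBDH problem.

*The gap of the device.* Once a key `d` and a device have been output, let `u` be the probability
that the device opens a ciphertext whose first three components use the same exponent, and `v` the
probability for independent exponents; the fourth component is always the one that `d` decrypts to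
the message. If `d` is well-formed, `u` is the probability in the definition of usefulness
(`opens_true`), and `v` is, up to `2 ^ (-k)`, the probability that the counter is incremented in
one iteration (`indepProb_le`). The device is useful and passes `⌈16 k / ε⌉` iterations unnoticed
with probability about `2 ^ (-k)`, unless `u - v ≥ ε / 2` (`pow_le_gap`). So the adversary wins
with probability at most `4 Q² E[(u - v)²] + 2 ^ (-k)` if `ε ≥ 1 / Q` (`computeNewKey_le`), where
the expectation `realScore` is over the game, with `(u - v)²` replaced by `0` if the key is not
well-formed.

*The distinguisher.* On `(g, g ^ a, g ^ b, g ^ c, T)` the distinguisher simulates the game with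
`X = g ^ c` and `h = g ^ b`, and uses `(g ^ a, T)` as first and third component of a ciphertext
for the device: with `s = a / c`, these are `X ^ s` and `e(g, h) ^ s` if `T = e(g, g) ^ (a b / c)`.
It does not know the sign of `u - v`. It makes one query with equal and one with independent
exponents of its own, and decides by comparing the three answers; the difference of its acceptance
probabilities is exactly `(u - v)²` (`decision_gap`, `ev_test`). Hence its advantage is the
expectation `simScore` of the squared gap in the simulation (`mdbdhAdvantage_eq`). A squared gap
needs neither a sign estimate nor Chernoff bounds.

*The simulated authority.* The parameter `Z = g ^ (-ID⋆) X ^ ω` lets the simulation issue keys for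
`ID ≠ ID⋆` with exactly the right distribution (`simIssue_eq`, `keygenOracle_eq`). With
`Y = X ^ γ h ^ (-τ)`, a key for `ID⋆` can be computed for the value `t₁ = τ - t₀` once a
representation `R = h ^ t₀ X ^ θ` is known, and `τ` is hidden by `Y`, so `t₁` looks uniform
(`ev_issue_le`). The representation comes from two accepting transcripts with different challenges
(`starKey_eq`). To get the second one, the simulation forks when the session for `ID⋆` is opened:
it first runs the adversary with an independent challenge until the proof is completed, and then
proceeds with the main run.

*The loss of rewinding.* When the session for `ID⋆` is opened, split the expectation in the real
game into the part `N` of runs without an accepted proof for `ID⋆` and the part `Φ` of the other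
runs. The simulation achieves `N + Φ²` up to collisions of challenges, because looking ahead
succeeds with probability at least `Φ`. From `2 s (N + Φ) ≤ N + Φ² + s²`, which is linear in the
real expectation and hence survives averaging over everything that happened before, one gets
`2 s * realScore ≤ simScore + s² + 3 * 2 ^ (-k)` for all `s ≤ 1 / 2` (`realVal_le_simVal`,
`realScore_le`), and `s = realScore / 2` shows that `realScore²` is negligible
(`sq_realScore_le`).

*Running time.* The distinguisher has to be a program. The predicate `PolySample` says that one
program samples from a whole family of distributions in polynomial time, and its closure
properties (`bind`, `cases`, `loop`) turn the experiment into such a program step by step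
(`polySample_experiment`). Only the lengths of the numbers in the data have to be controlled, not
the sizes of the trees, since structural instructions take a single step.
-/

open Filter Topology

noncomputable section

namespace AIBE

/-! ### Outputs and running times of programs -/

theorem pmf_pure_eq {α : Type*} (a : α) : (pure a : PMF α) = PMF.pure a := rfl

theorem pmf_bind_eq {α β : Type _} (μ : PMF α) (f : α → PMF β) : (μ >>= f) = μ.bind f := rfl

theorem bind_congr_support {α β : Type*} (μ : PMF α) {f g : α → PMF β}
    (h : ∀ a ∈ μ.support, f a = g a) : μ.bind f = μ.bind g := by
  ext b
  rw [PMF.bind_apply, PMF.bind_apply]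
  refine tsum_congr fun a => ?_
  by_cases ha : a ∈ μ.support
  · rw [h a ha]
  · rw [(PMF.apply_eq_zero_iff μ a).2 ha, zero_mul, zero_mul]

/-- `n` rounds of the random transition `F`. -/
def iterP {α : Type*} (F : α → PMF α) : ℕ → α → PMF α
  | 0, a => PMF.pure a
  | n + 1, a => (F a).bind (iterP F n)

theorem iterP_pure {α : Type*} (F : α → α) (n : ℕ) (a : α) :
    iterP (fun a => PMF.pure (F a)) n a = PMF.pure (F^[n] a) := by
  induction n generalizing a with
  | zero => rfl
  | succ n ih => simp [iterP, PMF.pure_bind, ih]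

theorem iterate_map_fst (f : Prog) (n : ℕ) (x : Data) :
    (iterate f.run n x).map Prod.fst = iterP f.out n x := by
  induction n generalizing x with
  | zero => simp [iterate, iterP, pmf_pure_eq, PMF.pure_map]
  | succ n ih =>
    simp only [iterate, iterP, pmf_bind_eq, pmf_pure_eq, PMF.map_bind,
      PMF.pure_map, Prog.out, PMF.bind_map]
    congr 1; funext y
    have := ih y.1
    simp only [Function.comp]
    rw [← this, ← PMF.bind_pure_comp]
    rfl

namespace Prog

theorem out_id (x : Data) : Prog.id.out x = PMF.pure x := by
  simp [out, run, pmf_pure_eq, PMF.pure_map]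

theorem out_const (n : ℕ) (x : Data) : (const n).out x = PMF.pure (.nat n) := by
  simp [out, run, pmf_pure_eq, PMF.pure_map]

theorem out_fst (x : Data) : fst.out x = PMF.pure x.fst := by
  simp [out, run, pmf_pure_eq, PMF.pure_map]

theorem out_snd (x : Data) : snd.out x = PMF.pure x.snd := by
  simp [out, run, pmf_pure_eq, PMF.pure_map]

theorem out_arith (op : ArithOp) (x : Data) :
    (arith op).out x = PMF.pure (.nat (op.eval x.fst.toNat x.snd.toNat)) := by
  simp [out, run, pmf_pure_eq, PMF.pure_map]

theorem out_rand (x : Data) :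
    rand.out x = (PMF.uniformOfFintype (Fin (x.toNat + 1))).map fun r => .nat r.val := by
  simp only [out, run, pmf_bind_eq, pmf_pure_eq, PMF.map_bind,
    PMF.pure_map]
  rw [← PMF.bind_pure_comp]; rfl

theorem out_pair (f g : Prog) (x : Data) :
    (pair f g).out x = (f.out x).bind fun a => (g.out x).map fun b => .pair a b := by
  simp only [out, run, pmf_bind_eq, pmf_pure_eq, PMF.map_bind,
    PMF.pure_map, PMF.bind_map]
  congr 1; funext y
  simp only [Function.comp, PMF.map_comp]
  rw [← PMF.bind_pure_comp]; rfl

theorem out_comp (f g : Prog) (x : Data) :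
    (comp f g).out x = (g.out x).bind f.out := by
  simp only [out, run, pmf_bind_eq, pmf_pure_eq, PMF.map_bind, PMF.pure_map, PMF.bind_map]
  congr 1

theorem run_ite (c f g : Prog) (x : Data) :
    (ite c f g).run x = (c.run x).bind fun t =>
      (if t.1.toNat = 0 then g.run x else f.run x).bind fun y =>
        PMF.pure (y.1, t.2 + y.2 + 1) := by
  simp only [run, pmf_bind_eq, pmf_pure_eq]
  congr 1; funext t
  split_ifs <;> rfl

theorem out_ite (c f g : Prog) (x : Data) :
    (ite c f g).out x
      = (c.out x).bind fun t => if t.toNat = 0 then g.out x else f.out x := by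
  simp only [out, run_ite, PMF.map_bind, PMF.pure_map, PMF.bind_map]
  congr 1; funext y
  simp only [Function.comp]
  split_ifs <;> (rw [← PMF.bind_pure_comp]; rfl)

theorem out_loop (f : Prog) (x : Data) :
    (loop f).out x = iterP f.out x.fst.toNat x.snd := by
  rw [← iterate_map_fst]
  simp only [out, run, pmf_bind_eq, pmf_pure_eq, PMF.map_bind,
    PMF.pure_map]
  rw [← PMF.bind_pure_comp]; rfl

theorem mem_support_out {f : Prog} {x y : Data} :
    y ∈ (f.out x).support ↔ ∃ r ∈ (f.run x).support, r.1 = y := by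
  simp [out, PMF.support_map]

theorem RunsIn.mono {f : Prog} {x : Data} {S T : ℕ} (h : f.RunsIn x S) (hST : S ≤ T) :
    f.RunsIn x T := fun r hr => (h r hr).trans hST

theorem runsIn_pair {f g : Prog} {x : Data} {S T : ℕ} (hf : f.RunsIn x S) (hg : g.RunsIn x T) :
    (pair f g).RunsIn x (S + T + 1) := by
  intro r hr
  simp only [run, pmf_bind_eq, pmf_pure_eq, PMF.mem_support_bind_iff,
    PMF.mem_support_pure_iff] at hr
  obtain ⟨a, ha, b, hb, rfl⟩ := hr
  have := hf a ha
  have := hg b hb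
  simp only; omega

theorem runsIn_comp {f g : Prog} {x : Data} {S T : ℕ} (hg : g.RunsIn x S)
    (hf : ∀ y ∈ (g.out x).support, f.RunsIn y T) : (comp f g).RunsIn x (S + T + 1) := by
  intro r hr
  simp only [run, pmf_bind_eq, pmf_pure_eq, PMF.mem_support_bind_iff,
    PMF.mem_support_pure_iff] at hr
  obtain ⟨a, ha, b, hb, rfl⟩ := hr
  have := hg a ha
  have := hf a.1 (mem_support_out.2 ⟨a, ha, rfl⟩) b hb
  simp only; omega

theorem runsIn_ite {c f g : Prog} {x : Data} {S T : ℕ} (hc : c.RunsIn x S)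
    (hf : ∀ y ∈ (c.out x).support, (if y.toNat = 0 then g else f).RunsIn x T) :
    (ite c f g).RunsIn x (S + T + 1) := by
  intro r hr
  simp only [run_ite, PMF.mem_support_bind_iff, PMF.mem_support_pure_iff] at hr
  obtain ⟨a, ha, b, hb, rfl⟩ := hr
  have := hc a ha
  have h2 := hf a.1 (mem_support_out.2 ⟨a, ha, rfl⟩)
  have : b.2 ≤ T := by
    split_ifs at hb h2 <;> exact h2 b hb
  simp only; omega

theorem iterate_time {f : Prog} {I : Data → Prop} {T : ℕ} (hI : ∀ y, I y → f.RunsIn y T)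
    (hs : ∀ y, I y → ∀ z ∈ (f.out y).support, I z) (n : ℕ) (x : Data) (hx : I x) :
    ∀ r ∈ (iterate f.run n x).support, r.2 ≤ n * (T + 1) := by
  induction n generalizing x with
  | zero => intro r hr; simp [iterate, pmf_pure_eq] at hr; simp [hr]
  | succ n ih =>
    intro r hr
    simp only [iterate, pmf_bind_eq, pmf_pure_eq,
      PMF.mem_support_bind_iff, PMF.mem_support_pure_iff] at hr
    obtain ⟨a, ha, b, hb, rfl⟩ := hr
    have h1 := hI x hx a ha
    have h2 := ih a.1 (hs x hx a.1 (mem_support_out.2 ⟨a, ha, rfl⟩)) b hb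
    simp only; nlinarith

theorem runsIn_loop {f : Prog} {x : Data} {I : Data → Prop} {T : ℕ}
    (hI : ∀ y, I y → f.RunsIn y T) (hs : ∀ y, I y → ∀ z ∈ (f.out y).support, I z)
    (hx : I x.snd) : (loop f).RunsIn x (x.fst.toNat * (T + 1) + 1) := by
  intro r hr
  simp only [run, pmf_bind_eq, pmf_pure_eq, PMF.mem_support_bind_iff,
    PMF.mem_support_pure_iff] at hr
  obtain ⟨a, ha, rfl⟩ := hr
  have := iterate_time hI hs _ _ hx a ha
  simp only; omega

end Prog

/-- The largest bit length of a number in a tree. The number of nodes may grow exponentially in the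
running time of a program, by repeated pairing of a tree with itself; this quantity may not, see
`Prog.leaf_out`. -/
def Data.leaf : Data → ℕ
  | .nat n => n.size
  | .pair a b => max a.leaf b.leaf

theorem Data.leaf_fst (x : Data) : x.fst.leaf ≤ x.leaf := by
  cases x <;> simp [Data.fst, Data.leaf]

theorem Data.leaf_snd (x : Data) : x.snd.leaf ≤ x.leaf := by
  cases x <;> simp [Data.snd, Data.leaf]

theorem Data.size_toNat (x : Data) : x.toNat.size ≤ x.leaf := by
  cases x <;> simp [Data.toNat, Data.leaf]

theorem Data.leaf_le_size (x : Data) : x.leaf ≤ x.size := by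
  induction x with
  | nat n => simp [Data.leaf, Data.size]
  | pair a b ha hb => simp only [Data.leaf, Data.size]; omega

theorem size_add_le (m n : ℕ) : (m + n).size ≤ m.size + n.size + 1 := by
  rw [Nat.size_le]
  have h1 := Nat.lt_size_self m
  have h2 := Nat.lt_size_self n
  have h3 : 2 ^ m.size ≤ 2 ^ (m.size + n.size) := Nat.pow_le_pow_right (by norm_num) (by omega)
  have h4 : 2 ^ n.size ≤ 2 ^ (m.size + n.size) := Nat.pow_le_pow_right (by norm_num) (by omega)
  rw [pow_succ]; omega

theorem ArithOp.size_eval (op : ArithOp) (m n : ℕ) :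
    (op.eval m n).size ≤ 1 + m.size + n.size := by
  cases op with
  | add => have := size_add_le m n; simp only [ArithOp.eval]; omega
  | sub =>
    have := Nat.size_le_size (Nat.sub_le m n)
    simp only [ArithOp.eval]; omega
  | mul =>
    have : (m * n).size ≤ m.size + n.size := by
      rw [Nat.size_le, pow_add]
      exact Nat.mul_lt_mul'' (Nat.lt_size_self m) (Nat.lt_size_self n)
    simp only [ArithOp.eval]; omega
  | div =>
    have := Nat.size_le_size (Nat.div_le_self m n)
    simp only [ArithOp.eval]; omega
  | mod =>
    have := Nat.size_le_size (Nat.mod_le m n)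
    simp only [ArithOp.eval]; omega

theorem leaf_iterate {F : Data → PMF (Data × ℕ)}
    (h : ∀ x, ∀ r ∈ (F x).support, r.1.leaf ≤ max x.leaf r.2) (n : ℕ) (x : Data) :
    ∀ r ∈ (iterate F n x).support, r.1.leaf ≤ max x.leaf r.2 := by
  induction n generalizing x with
  | zero => intro r hr; simp [iterate, pmf_pure_eq] at hr; simp [hr]
  | succ n ih =>
    intro r hr
    simp only [iterate, pmf_bind_eq, pmf_pure_eq,
      PMF.mem_support_bind_iff, PMF.mem_support_pure_iff] at hr
    obtain ⟨a, ha, b, hb, rfl⟩ := hr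
    have h1 := h x a ha
    have h2 := ih a.1 b hb
    simp only; omega

theorem Prog.leaf_run (f : Prog) (x : Data) :
    ∀ r ∈ (f.run x).support, r.1.leaf ≤ max x.leaf r.2 := by
  induction f generalizing x with
  | id => intro r hr; simp [run, pmf_pure_eq] at hr; simp [hr]
  | const n => intro r hr; simp [run, pmf_pure_eq] at hr; subst hr; simp only [Data.leaf]; omega
  | fst => intro r hr; simp [run, pmf_pure_eq] at hr; subst hr; have := x.leaf_fst; simp only; omega
  | snd => intro r hr; simp [run, pmf_pure_eq] at hr; subst hr; have := x.leaf_snd; simp only; omega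
  | isPair =>
    intro r hr
    cases x <;> simp [run, pmf_pure_eq] at hr <;> subst hr <;> simp [Data.leaf]
  | arith op =>
    intro r hr; simp [run, pmf_pure_eq] at hr; subst hr
    have := op.size_eval x.fst.toNat x.snd.toNat
    simp only [Data.leaf]; omega
  | rand =>
    intro r hr; simp [run, pmf_pure_eq, pmf_bind_eq] at hr
    obtain ⟨a, rfl⟩ := hr
    have := Nat.size_le_size (Nat.le_of_lt_succ a.2)
    simp only [Data.leaf]; omega
  | pair f g hf hg =>
    intro r hr
    simp only [run, pmf_bind_eq, pmf_pure_eq, PMF.mem_support_bind_iff,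
      PMF.mem_support_pure_iff] at hr
    obtain ⟨a, ha, b, hb, rfl⟩ := hr
    have h1 := hf x a ha
    have h2 := hg x b hb
    simp only [Data.leaf]; omega
  | comp f g hf hg =>
    intro r hr
    simp only [run, pmf_bind_eq, pmf_pure_eq, PMF.mem_support_bind_iff,
      PMF.mem_support_pure_iff] at hr
    obtain ⟨a, ha, b, hb, rfl⟩ := hr
    have h1 := hg x a ha
    have h2 := hf a.1 b hb
    simp only; omega
  | ite c f g hc hf hg =>
    intro r hr
    simp only [run_ite, PMF.mem_support_bind_iff, PMF.mem_support_pure_iff] at hr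
    obtain ⟨a, ha, b, hb, rfl⟩ := hr
    have h1 := hc x a ha
    split_ifs at hb
    · have h2 := hg x b hb
      simp only; omega
    · have h2 := hf x b hb
      simp only; omega
  | loop f hf =>
    intro r hr
    simp only [run, pmf_bind_eq, pmf_pure_eq, PMF.mem_support_bind_iff,
      PMF.mem_support_pure_iff] at hr
    obtain ⟨a, ha, rfl⟩ := hr
    have h1 := leaf_iterate hf _ _ a ha
    have h2 := x.leaf_snd
    simp only; omega

theorem Prog.leaf_out {f : Prog} {x y : Data} {T : ℕ} (hT : f.RunsIn x T)
    (hy : y ∈ (f.out x).support) : y.leaf ≤ max x.leaf T := by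
  obtain ⟨r, hr, rfl⟩ := Prog.mem_support_out.1 hy
  have h1 := f.leaf_run x r hr
  have h2 := hT r hr
  omega

theorem Prog.Computes.out_eq {f : Prog} {x y : Data} {T : ℕ} (h : f.Computes x y T) :
    f.out x = PMF.pure y := by
  have hs : ∀ z ∈ (f.out x).support, z = y := by
    intro z hz
    obtain ⟨r, hr, rfl⟩ := Prog.mem_support_out.1 hz
    exact (h r hr).1
  have : f.out x = (f.out x).bind PMF.pure := (PMF.bind_pure _).symm
  rw [this, bind_congr_support _ (g := fun _ => PMF.pure y) (fun a ha => by rw [hs a ha]),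
    PMF.bind_const]

theorem Prog.Computes.runsIn {f : Prog} {x y : Data} {T : ℕ} (h : f.Computes x y T) :
    f.RunsIn x T := fun r hr => (h r hr).2

/-! ### A calculus of polynomial time sampling -/

universe u v

section Calculus

variable {ι : Type u} {ι' : Type v}

/-- `n` is bounded by a polynomial in the size parameter `κ`. -/
def PolyB (κ n : ι → ℕ) : Prop := ∃ P : Polynomial ℕ, ∀ i, n i ≤ P.eval (κ i)

/-- The numbers in the trees `x i` have polynomial length. -/
def PolyLeaf (κ : ι → ℕ) (x : ι → Data) : Prop := PolyB κ fun i => (x i).leaf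

/-- One program samples from `μ i` on the input `x i`, for all `i`, in time polynomial in
`κ i`; moreover the numbers in the inputs have polynomial length. -/
def PolySample (κ : ι → ℕ) (x : ι → Data) (μ : ι → PMF Data) : Prop :=
  PolyLeaf κ x ∧ ∃ f : Prog, (∀ i, f.out (x i) = μ i) ∧
    ∃ T : ι → ℕ, PolyB κ T ∧ ∀ i, f.RunsIn (x i) (T i)

/-- One program computes `y i` from `x i`, for all `i`, in time polynomial in `κ i`. -/
def PolyComp (κ : ι → ℕ) (x y : ι → Data) : Prop :=
  PolySample κ x fun i => PMF.pure (y i)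

theorem eval_mono_nat (P : Polynomial ℕ) : Monotone fun k : ℕ => P.eval k := by
  intro a b hab
  simp only [Polynomial.eval_eq_sum_range]
  exact Finset.sum_le_sum fun i _ => Nat.mul_le_mul_left _ (Nat.pow_le_pow_left hab i)

namespace PolyB

variable {κ m n : ι → ℕ}

theorem mono (hn : PolyB κ n) (h : ∀ i, m i ≤ n i) : PolyB κ m :=
  let ⟨P, hP⟩ := hn; ⟨P, fun i => (h i).trans (hP i)⟩

theorem const (c : ℕ) : PolyB κ fun _ => c := ⟨Polynomial.C c, fun i => by simp⟩

theorem add (hm : PolyB κ m) (hn : PolyB κ n) : PolyB κ fun i => m i + n i := by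
  obtain ⟨P, hP⟩ := hm
  obtain ⟨Q, hQ⟩ := hn
  exact ⟨P + Q, fun i => by rw [Polynomial.eval_add]; exact add_le_add (hP i) (hQ i)⟩

theorem mul (hm : PolyB κ m) (hn : PolyB κ n) : PolyB κ fun i => m i * n i := by
  obtain ⟨P, hP⟩ := hm
  obtain ⟨Q, hQ⟩ := hn
  exact ⟨P * Q, fun i => by rw [Polynomial.eval_mul]; exact Nat.mul_le_mul (hP i) (hQ i)⟩

theorem max (hm : PolyB κ m) (hn : PolyB κ n) : PolyB κ fun i => Max.max (m i) (n i) :=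
  (hm.add hn).mono fun i => by omega

theorem eval (P : Polynomial ℕ) (hn : PolyB κ n) : PolyB κ fun i => P.eval (n i) := by
  obtain ⟨Q, hQ⟩ := hn
  refine ⟨P.comp Q, fun i => ?_⟩
  rw [Polynomial.eval_comp]
  exact eval_mono_nat P (hQ i)

theorem self : PolyB κ κ := ⟨Polynomial.X, fun i => by simp⟩

theorem comap (φ : ι' → ι) (hn : PolyB κ n) : PolyB (fun j => κ (φ j)) fun j => n (φ j) :=
  let ⟨P, hP⟩ := hn; ⟨P, fun j => hP (φ j)⟩

end PolyB

theorem PolyLeaf.comap {κ : ι → ℕ} {x : ι → Data} (φ : ι' → ι) (h : PolyLeaf κ x) :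
    PolyLeaf (fun j => κ (φ j)) fun j => x (φ j) :=
  PolyB.comap φ h

theorem PolyLeaf.mono {κ : ι → ℕ} {x y : ι → Data} (h : PolyLeaf κ x)
    (hy : ∀ i, (y i).leaf ≤ (x i).leaf) : PolyLeaf κ y := PolyB.mono h hy

theorem PolyLeaf.pair {κ : ι → ℕ} {x y : ι → Data} (hx : PolyLeaf κ x) (hy : PolyLeaf κ y) :
    PolyLeaf κ fun i => .pair (x i) (y i) := PolyB.max hx hy

variable {κ : ι → ℕ} {x y z : ι → Data} {μ ν : ι → PMF Data}

theorem PolySample.congr (h : PolySample κ x μ) (hμ : ∀ i, μ i = ν i) : PolySample κ x ν := by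
  obtain rfl : μ = ν := funext hμ
  exact h

theorem PolyComp.congr (h : PolyComp κ x y) (hy : ∀ i, y i = z i) : PolyComp κ x z := by
  obtain rfl : y = z := funext hy
  exact h

theorem PolySample.comap (φ : ι' → ι) (h : PolySample κ x μ) :
    PolySample (fun j => κ (φ j)) (fun j => x (φ j)) fun j => μ (φ j) := by
  obtain ⟨hx, f, hf, T, hT, hr⟩ := h
  exact ⟨hx.comap φ, f, fun j => hf _, fun j => T (φ j), hT.comap φ, fun j => hr _⟩

theorem PolyComp.comap (φ : ι' → ι) (h : PolyComp κ x y) :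
    PolyComp (fun j => κ (φ j)) (fun j => x (φ j)) fun j => y (φ j) :=
  PolySample.comap φ h

/-- The random bits of a polynomial time sampler do not make the numbers long. -/
theorem PolySample.leaf_bound (h : PolySample κ x μ) :
    ∃ P : Polynomial ℕ, ∀ i, ∀ y ∈ (μ i).support, y.leaf ≤ P.eval (κ i) := by
  obtain ⟨hx, f, hf, T, hT, hr⟩ := h
  obtain ⟨P, hP⟩ := PolyB.max hx hT
  refine ⟨P, fun i y hy => (Prog.leaf_out (hr i) ?_).trans (hP i)⟩
  rwa [hf i]

theorem PolyComp.leaf (h : PolyComp κ x y) : PolyLeaf κ y := by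
  obtain ⟨P, hP⟩ := PolySample.leaf_bound h
  exact ⟨P, fun i => hP i _ (by simp)⟩

theorem PolyComp.trans_sample (h : PolyComp κ x y) (h' : PolySample κ y μ) :
    PolySample κ x μ := by
  obtain ⟨hx, f, hf, S, hS, hr⟩ := h
  obtain ⟨-, g, hg, T, hT, hr'⟩ := h'
  refine ⟨hx, .comp g f, fun i => ?_, fun i => S i + T i + 1, (hS.add hT).add (.const 1),
    fun i => Prog.runsIn_comp (hr i) ?_⟩
  · rw [Prog.out_comp, hf, PMF.pure_bind, hg]
  · intro y hy
    rw [hf, PMF.mem_support_pure_iff] at hy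
    exact hy ▸ hr' i

theorem PolyComp.trans (h : PolyComp κ x y) (h' : PolyComp κ y z) : PolyComp κ x z :=
  h.trans_sample h'

namespace PolyComp

theorem refl (hx : PolyLeaf κ x) : PolyComp κ x x :=
  ⟨hx, .id, fun i => Prog.out_id _, fun _ => 1, .const 1, fun i r hr => by
    simp [Prog.run, pmf_pure_eq] at hr; simp [hr]⟩

theorem const (hx : PolyLeaf κ x) (n : ℕ) : PolyComp κ x fun _ => .nat n :=
  ⟨hx, .const n, fun i => Prog.out_const _ _, fun _ => 1 + n.size, .const _, fun i r hr => by
    simp [Prog.run, pmf_pure_eq] at hr; simp [hr]⟩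

theorem fst (h : PolyComp κ x y) : PolyComp κ x fun i => (y i).fst :=
  h.trans ⟨h.leaf, .fst, fun i => Prog.out_fst _, fun _ => 1, .const 1, fun i r hr => by
    simp [Prog.run, pmf_pure_eq] at hr; simp [hr]⟩

theorem snd (h : PolyComp κ x y) : PolyComp κ x fun i => (y i).snd :=
  h.trans ⟨h.leaf, .snd, fun i => Prog.out_snd _, fun _ => 1, .const 1, fun i r hr => by
    simp [Prog.run, pmf_pure_eq] at hr; simp [hr]⟩

theorem pair (h : PolyComp κ x y) (h' : PolyComp κ x z) :
    PolyComp κ x fun i => .pair (y i) (z i) := by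
  obtain ⟨hx, f, hf, S, hS, hr⟩ := h
  obtain ⟨-, g, hg, T, hT, hr'⟩ := h'
  refine ⟨hx, .pair f g, fun i => ?_, fun i => S i + T i + 1, (hS.add hT).add (.const 1),
    fun i => Prog.runsIn_pair (hr i) (hr' i)⟩
  rw [Prog.out_pair, hf, PMF.pure_bind, hg, PMF.pure_map]

theorem arith (op : ArithOp) {m n : ι → Data} (hm : PolyComp κ x m) (hn : PolyComp κ x n) :
    PolyComp κ x fun i => .nat (op.eval (m i).toNat (n i).toNat) := by
  refine (hm.pair hn).trans ⟨(hm.pair hn).leaf, .arith op, fun i => Prog.out_arith _ _,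
    fun i => 1 + (m i).leaf + (n i).leaf, ((PolyB.const 1).add hm.leaf).add hn.leaf,
    fun i r hr => ?_⟩
  simp [Prog.run, pmf_pure_eq] at hr
  have h1 := (m i).size_toNat
  have h2 := (n i).size_toNat
  simp only [hr, Data.fst, Data.snd]
  omega

variable {m n : ι → ℕ}

theorem add (hm : PolyComp κ x fun i => .nat (m i)) (hn : PolyComp κ x fun i => .nat (n i)) :
    PolyComp κ x fun i => .nat (m i + n i) := arith .add hm hn

theorem sub (hm : PolyComp κ x fun i => .nat (m i)) (hn : PolyComp κ x fun i => .nat (n i)) :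
    PolyComp κ x fun i => .nat (m i - n i) := arith .sub hm hn

theorem mul (hm : PolyComp κ x fun i => .nat (m i)) (hn : PolyComp κ x fun i => .nat (n i)) :
    PolyComp κ x fun i => .nat (m i * n i) := arith .mul hm hn

theorem div (hm : PolyComp κ x fun i => .nat (m i)) (hn : PolyComp κ x fun i => .nat (n i)) :
    PolyComp κ x fun i => .nat (m i / n i) := arith .div hm hn

theorem mod (hm : PolyComp κ x fun i => .nat (m i)) (hn : PolyComp κ x fun i => .nat (n i)) :
    PolyComp κ x fun i => .nat (m i % n i) := arith .mod hm hn

theorem toNat (h : PolyComp κ x y) : PolyComp κ x fun i => .nat (y i).toNat :=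
  arith .add h (const h.1 0)

theorem eq (hm : PolyComp κ x fun i => .nat (m i)) (hn : PolyComp κ x fun i => .nat (n i)) :
    PolyComp κ x fun i => .nat (if m i = n i then 1 else 0) :=
  ((const hm.1 1).sub ((hm.sub hn).add (hn.sub hm))).congr fun i => by
    split_ifs with h
    · simp [h]
    · congr 1; omega

theorem isPair (h : PolyComp κ x y) {c : ι → Prop} [∀ i, Decidable (c i)]
    (hc : ∀ i, c i ↔ ∃ a b, y i = .pair a b) :
    PolyComp κ x fun i => .nat (if c i then 1 else 0) := by
  have key : ∀ i, Prog.isPair.run (y i) = PMF.pure (.nat (if c i then 1 else 0), 1) := by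
    intro i
    cases hy : y i with
    | nat n =>
      have : ¬ c i := by rw [hc, hy]; simp
      simp [Prog.run, pmf_pure_eq, this]
    | pair a b =>
      have : c i := by rw [hc, hy]; simp
      simp [Prog.run, pmf_pure_eq, this]
  refine h.trans ⟨h.leaf, .isPair, fun i => ?_, fun _ => 1, .const 1, fun i r hr => ?_⟩
  · rw [Prog.out, key, PMF.pure_map]
  · rw [key, PMF.mem_support_pure_iff] at hr; simp [hr]

/-- Polynomials with natural coefficients can be evaluated. -/
theorem eval (P : Polynomial ℕ) (hn : PolyComp κ x fun i => .nat (n i)) :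
    PolyComp κ x fun i => .nat (P.eval (n i)) := by
  induction P using Polynomial.induction_on with
  | C a => exact (const hn.1 a).congr fun i => by simp
  | add P Q hP hQ => exact (hP.add hQ).congr fun i => by simp
  | monomial d a h => exact (h.mul hn).congr fun i => by simp [pow_succ, mul_assoc]

end PolyComp

namespace PolySample

theorem map_fst_pair {α : Type*} (p : PMF α) (enc : α → Data) (b : Data) :
    (p.map enc).bind (fun a => (PMF.pure b).map fun b => Data.pair a b)
      = p.map fun a => .pair (enc a) b := by
  simp only [PMF.pure_map, PMF.bind_map]
  rfl

/-- Sampling with a first sampler, then continuing with the sampled value prepended to the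
input. -/
theorem bind {α : ι → Type*} {M : ∀ i, PMF (α i)} {enc : ∀ i, α i → Data}
    {ν : ∀ i, α i → PMF Data} (h : PolySample κ x fun i => (M i).map (enc i))
    (h' : PolyLeaf (fun j : Σ i, {a : α i // a ∈ (M i).support} => κ j.1)
        (fun j => .pair (enc j.1 j.2.1) (x j.1)) →
      PolySample (fun j : Σ i, {a : α i // a ∈ (M i).support} => κ j.1)
        (fun j => .pair (enc j.1 j.2.1) (x j.1)) fun j => ν j.1 j.2.1) :
    PolySample κ x fun i => (M i).bind (ν i) := by
  have hpb : PolyLeaf (fun j : Σ i, {a : α i // a ∈ (M i).support} => κ j.1)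
      (fun j => .pair (enc j.1 j.2.1) (x j.1)) := by
    obtain ⟨P, hP⟩ := h.leaf_bound
    refine PolyLeaf.pair ⟨P, fun j => hP j.1 _ ?_⟩ (h.1.comap _)
    rw [PMF.support_map]
    exact ⟨_, j.2.2, rfl⟩
  obtain ⟨-, g, hg, T, ⟨Q, hQ⟩, hr'⟩ := h' hpb
  obtain ⟨hx, f, hf, S, hS, hr⟩ := h
  have hout : ∀ i, (Prog.pair f .id).out (x i) = (M i).map fun a => .pair (enc i a) (x i) := by
    intro i
    rw [Prog.out_pair, hf, ← map_fst_pair (M i) (enc i), Prog.out_id]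
  refine ⟨hx, .comp g (.pair f .id), fun i => ?_, fun i => (S i + 1 + 1) + Q.eval (κ i) + 1,
    ((hS.add (.const 1)).add (.const 1)).add (PolyB.eval Q .self) |>.add (.const 1),
    fun i => Prog.runsIn_comp (Prog.runsIn_pair (hr i) ?_) ?_⟩
  · rw [Prog.out_comp, hout, PMF.bind_map]
    exact bind_congr_support _ fun a ha => hg ⟨i, a, ha⟩
  · intro r hr
    simp [Prog.run, pmf_pure_eq] at hr; simp [hr]
  · intro y hy
    rw [hout, PMF.support_map] at hy
    obtain ⟨a, ha, rfl⟩ := hy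
    exact (hr' ⟨i, a, ha⟩).mono (hQ ⟨i, a, ha⟩)

/-- `bind` for a sampler whose values are data. -/
theorem map_data {α : ι → Type*} {M : ∀ i, PMF (α i)} {enc : ∀ i, α i → Data}
    {g : ∀ i, α i → Data} (h : PolySample κ x fun i => (M i).map (enc i))
    (h' : PolyLeaf (fun j : Σ i, {a : α i // a ∈ (M i).support} => κ j.1)
        (fun j => .pair (enc j.1 j.2.1) (x j.1)) →
      PolyComp (fun j : Σ i, {a : α i // a ∈ (M i).support} => κ j.1)
        (fun j => .pair (enc j.1 j.2.1) (x j.1)) fun j => g j.1 j.2.1) :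
    PolySample κ x fun i => (M i).map (g i) :=
  (h.bind (ν := fun i a => PMF.pure (g i a)) h').congr fun _ => PMF.bind_pure_comp _ _

/-- Case distinction by a computable test. -/
theorem cases {c : ι → Prop} [∀ i, Decidable (c i)]
    (hc : PolyComp κ x fun i => .nat (if c i then 1 else 0))
    (h1 : PolySample (fun j : {i // c i} => κ j.1) (fun j => x j.1) fun j => μ j.1)
    (h2 : PolySample (fun j : {i // ¬ c i} => κ j.1) (fun j => x j.1) fun j => μ j.1) :
    PolySample κ x μ := by
  obtain ⟨hx, t, ht, S, hS, hrt⟩ := hc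
  obtain ⟨-, f, hf, T₁, ⟨P₁, hP₁⟩, hrf⟩ := h1
  obtain ⟨-, g, hg, T₂, ⟨P₂, hP₂⟩, hrg⟩ := h2
  refine ⟨hx, .ite t f g, fun i => ?_, fun i => S i + (P₁.eval (κ i) + P₂.eval (κ i)) + 1,
    (hS.add ((PolyB.eval P₁ .self).add (PolyB.eval P₂ .self))).add (.const 1),
    fun i => Prog.runsIn_ite (hrt i) ?_⟩
  · rw [Prog.out_ite, ht, PMF.pure_bind]
    by_cases h : c i
    · simpa [h, Data.toNat] using hf ⟨i, h⟩
    · simpa [h, Data.toNat] using hg ⟨i, h⟩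
  · intro y hy
    rw [ht, PMF.mem_support_pure_iff] at hy
    by_cases h : c i
    · simp only [hy, h, Data.toNat, if_true, one_ne_zero, if_false]
      exact (hrf ⟨i, h⟩).mono ((hP₁ ⟨i, h⟩).trans (by simp))
    · simp only [hy, h, Data.toNat, if_true, if_false]
      exact (hrg ⟨i, h⟩).mono ((hP₂ ⟨i, h⟩).trans (by simp))

/-- Polynomially many rounds of a random transition. The invariant `Inv` keeps the numbers in
the states short and the transitions fast. -/
theorem loop {α : ι → Type*} {enc : ∀ i, α i → Data} {step : ∀ i, α i → PMF (α i)}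
    (Inv : ∀ i, α i → Prop) {a₀ : ∀ i, α i} {n : ι → ℕ} (hn : PolyB κ n)
    (hnc : PolyComp κ x fun i => .nat (n i)) (ha : PolyComp κ x fun i => enc i (a₀ i))
    (h0 : ∀ i, Inv i (a₀ i)) (hinv : ∀ i a, Inv i a → ∀ b ∈ (step i a).support, Inv i b)
    (hleaf : PolyLeaf (fun j : Σ i, {a : α i // Inv i a} => κ j.1) fun j => enc j.1 j.2.1)
    (hstep : PolyLeaf (fun j : Σ i, {a : α i // Inv i a} => κ j.1)
        (fun j => .pair (enc j.1 j.2.1) (x j.1)) →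
      PolySample (fun j : Σ i, {a : α i // Inv i a} => κ j.1)
        (fun j => .pair (enc j.1 j.2.1) (x j.1)) fun j => (step j.1 j.2.1).map (enc j.1)) :
    PolySample κ x fun i => (iterP (step i) (n i) (a₀ i)).map (enc i) := by
  have hx := hnc.1
  obtain ⟨-, f, hf, T, ⟨Q, hQ⟩, hr⟩ := hstep (hleaf.pair (hx.comap _))
  set g : Prog := .pair f .snd
  have hg : ∀ i a, Inv i a →
      g.out (.pair (enc i a) (x i)) = (step i a).map fun b => .pair (enc i b) (x i) := by
    intro i a hia
    rw [Prog.out_pair, hf ⟨i, a, hia⟩, ← map_fst_pair (step i a) (enc i), Prog.out_snd]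
    rfl
  have hit : ∀ i n a, Inv i a → iterP g.out n (.pair (enc i a) (x i))
      = (iterP (step i) n a).map fun b => .pair (enc i b) (x i) := by
    intro i n
    induction n with
    | zero => intro a _; simp [iterP, PMF.pure_map]
    | succ n ih =>
      intro a hia
      rw [iterP, hg i a hia, PMF.bind_map, iterP, PMF.map_bind]
      exact bind_congr_support _ fun b hb => ih b (hinv i a hia b hb)
  have h1 := hnc.pair (ha.pair (.refl hx))
  refine h1.trans_sample ⟨h1.leaf, .comp .fst (.loop g), fun i => ?_,
    fun i => (n i * ((Q.eval (κ i) + 1 + 1) + 1) + 1) + 1 + 1, ?_,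
    fun i => Prog.runsIn_comp (Prog.runsIn_loop
      (I := fun y => ∃ a, Inv i a ∧ y = .pair (enc i a) (x i)) ?_ ?_ ?_) ?_⟩
  · rw [Prog.out_comp, Prog.out_loop]
    simp only [Data.fst, Data.snd, Data.toNat]
    rw [hit i _ _ (h0 i), PMF.bind_map, ← PMF.bind_pure_comp]
    congr 1
    funext b
    simp [Prog.out_fst, Data.fst]
  · have := PolyB.eval Q (PolyB.self (κ := κ))
    exact ((hn.mul (((this.add (.const 1)).add (.const 1)).add (.const 1))).add
      (.const 1)).add (.const 1) |>.add (.const 1)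
  · rintro _ ⟨a, hia, rfl⟩
    refine Prog.runsIn_pair ((hr ⟨i, a, hia⟩).mono (hQ ⟨i, a, hia⟩)) (fun r hr => ?_)
    simp [Prog.run, pmf_pure_eq] at hr; simp [hr]
  · rintro _ ⟨a, hia, rfl⟩ z hz
    rw [hg i a hia, PMF.support_map] at hz
    obtain ⟨b, hb, rfl⟩ := hz
    exact ⟨b, hinv i a hia b hb, rfl⟩
  · exact ⟨a₀ i, h0 i, rfl⟩
  · intro y _ r hr
    simp [Prog.run, pmf_pure_eq] at hr; simp [hr]

theorem rand {n : ι → ℕ} (hn : PolyComp κ x fun i => .nat (n i)) :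
    PolySample κ x fun i => (PMF.uniformOfFintype (Fin (n i + 1))).map fun r => .nat r.val := by
  refine hn.trans_sample ⟨hn.leaf, .rand, fun i => Prog.out_rand _,
    fun i => 1 + (n i).size, (PolyB.const 1).add hn.leaf, fun i r hr => ?_⟩
  simp [Prog.run, pmf_pure_eq, pmf_bind_eq] at hr
  obtain ⟨a, rfl⟩ := hr
  simp [Data.toNat]

end PolySample

/-- Polynomially many steps of a deterministic transition. -/
theorem PolyComp.loop {α : ι → Type*} {enc : ∀ i, α i → Data} {step : ∀ i, α i → α i}
    (Inv : ∀ i, α i → Prop) {a₀ : ∀ i, α i} {n : ι → ℕ} (hn : PolyB κ n)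
    (hnc : PolyComp κ x fun i => .nat (n i)) (ha : PolyComp κ x fun i => enc i (a₀ i))
    (h0 : ∀ i, Inv i (a₀ i)) (hinv : ∀ i a, Inv i a → Inv i (step i a))
    (hleaf : PolyLeaf (fun j : Σ i, {a : α i // Inv i a} => κ j.1) fun j => enc j.1 j.2.1)
    (hstep : PolyLeaf (fun j : Σ i, {a : α i // Inv i a} => κ j.1)
        (fun j => .pair (enc j.1 j.2.1) (x j.1)) →
      PolyComp (fun j : Σ i, {a : α i // Inv i a} => κ j.1)
        (fun j => .pair (enc j.1 j.2.1) (x j.1)) fun j => enc j.1 (step j.1 j.2.1)) :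
    PolyComp κ x fun i => enc i ((step i)^[n i] (a₀ i)) := by
  refine (PolySample.loop (step := fun i a => PMF.pure (step i a)) Inv hn hnc ha h0 ?_ hleaf
    ?_).congr fun i => ?_
  · intro i a hia b hb
    rw [PMF.mem_support_pure_iff] at hb
    exact hb ▸ hinv i a hia
  · intro hl
    exact PolySample.congr (hstep hl) fun j => by rw [PMF.pure_map]
  · rw [iterP_pure, PMF.pure_map]

/-- Case distinction by a computable test, for a deterministic result. -/
theorem PolyComp.cases {c : ι → Prop} [∀ i, Decidable (c i)]
    (hc : PolyComp κ x fun i => .nat (if c i then 1 else 0))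
    (h1 : PolyComp (fun j : {i // c i} => κ j.1) (fun j => x j.1) fun j => y j.1)
    (h2 : PolyComp (fun j : {i // ¬ c i} => κ j.1) (fun j => x j.1) fun j => y j.1) :
    PolyComp κ x y := PolySample.cases hc h1 h2

end Calculus

/-! ### Exponents modulo the group order -/

section PrimePow

variable {p : ℕ} [Fact p.Prime] {H : Type*} [CommGroup H] [Fintype H]

omit [Fact p.Prime] in
theorem pow_order (hH : Fintype.card H = p) (u : H) : u ^ p = 1 := hH ▸ pow_card_eq_one

theorem pow_val_natCast (hH : Fintype.card H = p) (u : H) (n : ℕ) :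
    u ^ ((n : ZMod p)).val = u ^ n := by
  rw [ZMod.val_natCast]
  conv_rhs => rw [← Nat.mod_add_div n p, pow_add, pow_mul, pow_order hH, one_pow, mul_one]

theorem pow_val_add (hH : Fintype.card H = p) (u : H) (a b : ZMod p) :
    u ^ (a + b).val = u ^ a.val * u ^ b.val := by
  rw [← pow_add, ← pow_val_natCast hH u (a.val + b.val)]
  simp

theorem pow_val_mul (hH : Fintype.card H = p) (u : H) (a b : ZMod p) :
    u ^ (a * b).val = (u ^ a.val) ^ b.val := by
  rw [← pow_mul, ← pow_val_natCast hH u (a.val * b.val)]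
  simp

theorem pow_val_bijective (hH : Fintype.card H = p) {u : H} (hu : u ≠ 1) :
    Function.Bijective fun a : ZMod p => u ^ a.val := by
  refine (Fintype.bijective_iff_injective_and_card _).2 ⟨fun a b hab => ?_, by
    rw [ZMod.card, hH]⟩
  have hord : orderOf u = p := orderOf_eq_prime (pow_order hH u) hu
  have := pow_injOn_Iio_orderOf (x := u) (by simp [hord, ZMod.val_lt]) (by
    simp [hord, ZMod.val_lt]) hab
  exact ZMod.val_injective p this

end PrimePow

namespace BilinearGroup

variable {B : BilinearGroup}

theorem pow_eq_pw (u : B.G) (n : ℕ) : u ^ n = pw u (n : ZMod B.p) :=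
  (pow_val_natCast B.card_G u n).symm

theorem pow_eq_pwT (u : B.GT) (n : ℕ) : u ^ n = pwT u (n : ZMod B.p) :=
  (pow_val_natCast B.card_GT u n).symm

theorem pw_add (u : B.G) (a b : ZMod B.p) : pw u (a + b) = pw u a * pw u b :=
  pow_val_add B.card_G u a b

theorem pw_mul (u : B.G) (a b : ZMod B.p) : pw u (a * b) = pw (pw u a) b :=
  pow_val_mul B.card_G u a b

theorem pwT_mul (u : B.GT) (a b : ZMod B.p) : pwT u (a * b) = pwT (pwT u a) b :=
  pow_val_mul B.card_GT u a b

theorem pw_zero (u : B.G) : pw u 0 = 1 := by simp [pw]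

theorem pw_one (u : B.G) : pw u 1 = u := by
  have := pow_eq_pw u 1
  simpa using this.symm

theorem mul_pwT (u v : B.GT) (a : ZMod B.p) : pwT (u * v) a = pwT u a * pwT v a :=
  mul_pow _ _ _

theorem pw_neg (u : B.G) (a : ZMod B.p) : pw u (-a) = (pw u a)⁻¹ := by
  rw [eq_inv_iff_mul_eq_one, ← pw_add, neg_add_cancel, pw_zero]

/-- Discrete exponentiation with a generator as base. -/
def pwEquiv {g : B.G} (hg : g ≠ 1) : ZMod B.p ≃ B.G :=
  Equiv.ofBijective (pw g) (pow_val_bijective B.card_G hg)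

/-- Discrete exponentiation in the target group. -/
def pwTEquiv {g : B.GT} (hg : g ≠ 1) : ZMod B.p ≃ B.GT :=
  Equiv.ofBijective (pwT g) (pow_val_bijective B.card_GT hg)

theorem exists_pw {g : B.G} (hg : g ≠ 1) (u : B.G) : ∃ a : ZMod B.p, pw g a = u :=
  (pwEquiv hg).surjective u

theorem pw_injective {g : B.G} (hg : g ≠ 1) : Function.Injective (pw g) :=
  (pwEquiv hg).injective

theorem pw_ne_one {g : B.G} (hg : g ≠ 1) {a : ZMod B.p} (ha : a ≠ 0) : pw g a ≠ 1 := by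
  rw [← pw_zero g]
  exact fun h => ha (pw_injective hg h)

theorem e_pw (u v : B.G) (a b : ZMod B.p) : B.e (pw u a) (pw v b) = pwT (B.e u v) (a * b) := by
  have := B.e_zpow u v (a.val : ℤ) (b.val : ℤ)
  rw [zpow_natCast, zpow_natCast, ← Nat.cast_mul, zpow_natCast, pow_eq_pwT] at this
  rw [pw, pw, this]
  simp

theorem e_pw_left (u v : B.G) (a : ZMod B.p) : B.e (pw u a) v = pwT (B.e u v) a := by
  have := e_pw u v a 1
  rwa [pw_one, mul_one] at this

theorem e_pw_right (u v : B.G) (b : ZMod B.p) : B.e u (pw v b) = pwT (B.e u v) b := by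
  have := e_pw u v 1 b
  rwa [pw_one, one_mul] at this

theorem exists_ne_one : ∃ g : B.G, g ≠ 1 :=
  ⟨_, (Classical.arbitrary {g : B.G // g ≠ 1}).2⟩

theorem e_symm (u v : B.G) : B.e u v = B.e v u := by
  obtain ⟨g, hg⟩ := B.exists_ne_one
  obtain ⟨a, rfl⟩ := exists_pw hg u
  obtain ⟨b, rfl⟩ := exists_pw hg v
  rw [e_pw, e_pw, mul_comm]

theorem inv_eq_pow (a : ZMod B.p) : a⁻¹ = a ^ (B.p - 2) := by
  by_cases ha : a = 0
  · subst ha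
    rw [inv_zero, zero_pow]
    have := B.two_lt
    omega
  · have h1 := ZMod.pow_card_sub_one_eq_one ha
    have h2 : B.p - 1 = (B.p - 2) + 1 := by have := B.two_lt; omega
    rw [h2, pow_succ] at h1
    exact (eq_inv_of_mul_eq_one_left h1).symm

end BilinearGroup

/-! ### Expectations -/

open scoped ENNReal

section Expectation

variable {α β : Type*}

/-- The expectation of `f`. -/
def ev (μ : PMF α) (f : α → ℝ≥0∞) : ℝ≥0∞ := ∑' a, μ a * f a

variable {μ : PMF α} {f g : α → ℝ≥0∞}

theorem ev_pure (a : α) (f : α → ℝ≥0∞) : ev (PMF.pure a) f = f a := by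
  classical
  rw [ev, tsum_eq_single a]
  · simp
  · intro b hb; simp [hb]

theorem ev_bind (μ : PMF α) (ν : α → PMF β) (f : β → ℝ≥0∞) :
    ev (μ.bind ν) f = ev μ fun a => ev (ν a) f := by
  simp only [ev, PMF.bind_apply, ← ENNReal.tsum_mul_left, ← ENNReal.tsum_mul_right]
  rw [ENNReal.tsum_comm]
  simp only [mul_assoc]

theorem ev_map (μ : PMF α) (h : α → β) (f : β → ℝ≥0∞) :
    ev (μ.map h) f = ev μ fun a => f (h a) := by
  rw [← PMF.bind_pure_comp, ev_bind]
  simp [ev_pure]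

theorem ev_mono_support (h : ∀ a ∈ μ.support, f a ≤ g a) : ev μ f ≤ ev μ g := by
  refine ENNReal.tsum_le_tsum fun a => ?_
  by_cases ha : a ∈ μ.support
  · exact mul_le_mul_right (h a ha) _
  · rw [(PMF.apply_eq_zero_iff μ a).2 ha, zero_mul, zero_mul]

theorem ev_mono (h : ∀ a, f a ≤ g a) : ev μ f ≤ ev μ g := ev_mono_support fun a _ => h a

theorem ev_congr_support (h : ∀ a ∈ μ.support, f a = g a) : ev μ f = ev μ g :=
  le_antisymm (ev_mono_support fun a ha => (h a ha).le) (ev_mono_support fun a ha => (h a ha).ge)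

theorem ev_add (μ : PMF α) (f g : α → ℝ≥0∞) : ev μ (fun a => f a + g a) = ev μ f + ev μ g := by
  simp only [ev, mul_add, ENNReal.tsum_add]

theorem ev_mul_left (μ : PMF α) (c : ℝ≥0∞) (f : α → ℝ≥0∞) :
    ev μ (fun a => c * f a) = c * ev μ f := by
  simp only [ev, mul_left_comm, ENNReal.tsum_mul_left]

theorem ev_mul_right (μ : PMF α) (c : ℝ≥0∞) (f : α → ℝ≥0∞) :
    ev μ (fun a => f a * c) = ev μ f * c := by
  simp only [mul_comm _ c, ev_mul_left]

theorem ev_const (μ : PMF α) (c : ℝ≥0∞) : ev μ (fun _ => c) = c := by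
  simp only [ev, ENNReal.tsum_mul_right, PMF.tsum_coe, one_mul]

theorem ev_le_one (h : ∀ a, f a ≤ 1) : ev μ f ≤ 1 :=
  (ev_mono h).trans (ev_const μ 1).le

theorem ev_comm (μ : PMF α) (ν : PMF β) (f : α → β → ℝ≥0∞) :
    ev μ (fun a => ev ν fun b => f a b) = ev ν fun b => ev μ fun a => f a b := by
  simp only [ev, ← ENNReal.tsum_mul_left]
  rw [ENNReal.tsum_comm]
  simp only [mul_left_comm]

open Classical in
theorem apply_eq_ev (μ : PMF α) (a : α) : μ a = ev μ fun b => if b = a then 1 else 0 := by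
  rw [ev, tsum_eq_single a]
  · simp
  · intro b hb; simp [hb]

theorem ev_uniform [Fintype α] [Nonempty α] (f : α → ℝ≥0∞) :
    ev (PMF.uniformOfFintype α) f = (Fintype.card α : ℝ≥0∞)⁻¹ * ∑ a, f a := by
  simp [ev, tsum_fintype, Finset.mul_sum]

theorem ev_uniform_equiv [Fintype α] [Nonempty α] [Fintype β] [Nonempty β] (φ : α ≃ β)
    (f : β → ℝ≥0∞) :
    ev (PMF.uniformOfFintype α) (fun a => f (φ a)) = ev (PMF.uniformOfFintype β) f := by
  rw [ev_uniform, ev_uniform, Fintype.card_congr φ, Equiv.sum_comp φ]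

theorem map_uniform_equiv [Fintype α] [Nonempty α] [Fintype β] [Nonempty β] (φ : α ≃ β) :
    (PMF.uniformOfFintype α).map φ = PMF.uniformOfFintype β := by
  ext b
  rw [apply_eq_ev, apply_eq_ev, ev_map, ← ev_uniform_equiv φ]

theorem ev_uniform_prod [Fintype α] [Nonempty α] [Fintype β] [Nonempty β]
    (f : α → β → ℝ≥0∞) :
    ev (PMF.uniformOfFintype α) (fun a => ev (PMF.uniformOfFintype β) fun b => f a b)
      = ev (PMF.uniformOfFintype (α × β)) fun x => f x.1 x.2 := by
  simp only [ev_uniform, Fintype.card_prod, Nat.cast_mul, Fintype.sum_prod_type,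
    Finset.mul_sum, ← mul_assoc]
  rw [ENNReal.mul_inv (by simp) (by simp)]

end Expectation

/-! ### Programs for exponentiation and modular arithmetic -/

open BilinearGroup

section PowLoop

variable {ι : Type u} {κ : ι → ℕ} {x : ι → Data}

theorem PolyComp.of_computes {y z : ι → Data} (h : PolyComp κ x y) (f : Prog) {T : ι → ℕ}
    (hT : PolyB κ T) (hf : ∀ i, f.Computes (y i) (z i) (T i)) : PolyComp κ x z :=
  h.trans ⟨h.leaf, f, fun i => (hf i).out_eq, T, hT, fun i => (hf i).runsIn⟩

/-- One step of square-and-multiply on a triple (accumulator, base, exponent). -/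
def sqMul {M : Type*} [Monoid M] (a : M × M × ℕ) : M × M × ℕ :=
  (if a.2.2 % 2 = 1 then a.1 * a.2.1 else a.1, a.2.1 * a.2.1, a.2.2 / 2)

theorem sqMul_iterate {M : Type*} [Monoid M] (N : ℕ) (a b : M) (n : ℕ) (hn : n < 2 ^ N) :
    (sqMul^[N] (a, b, n)).1 = a * b ^ n := by
  induction N generalizing a b n with
  | zero =>
    have : n = 0 := by simpa using hn
    simp [this]
  | succ N ih =>
    rw [Function.iterate_succ_apply, sqMul, ih _ _ _ (by rw [pow_succ] at hn; simp only; omega)]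
    simp only
    have h2 := Nat.div_add_mod n 2
    have hb : (b * b) ^ (n / 2) = b ^ (2 * (n / 2)) := by rw [← pow_two, pow_mul]
    split_ifs with h
    · rw [hb, mul_assoc, ← pow_succ']
      congr 2; omega
    · rw [hb]
      congr 2; omega

/-- Square-and-multiply is polynomial time in every family of monoids whose elements have short
representations and whose multiplication is polynomial time. Exponents are shifted by one, since
the neutral element need not be at hand. -/
theorem PolyComp.pow_succ {M : ι → Type} [∀ i, Monoid (M i)] (rep : ∀ i, M i → Data)
    (hrep : PolyLeaf (fun j : Σ i, M i => κ j.1) fun j => rep j.1 j.2)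
    (hmul : ∀ (ι' : Type u) (φ : ι' → ι) (x' : ι' → Data) (a b : ∀ j, M (φ j)),
      PolyComp (fun j => κ (φ j)) x' (fun j => x (φ j)) →
      PolyComp (fun j => κ (φ j)) x' (fun j => rep (φ j) (a j)) →
      PolyComp (fun j => κ (φ j)) x' (fun j => rep (φ j) (b j)) →
      PolyComp (fun j => κ (φ j)) x' fun j => rep (φ j) (a j * b j))
    (hk : PolyComp κ x fun i => .nat (κ i)) {a : ∀ i, M i} {n : ι → ℕ}
    (ha : PolyComp κ x fun i => rep i (a i)) (hn : PolyComp κ x fun i => .nat (n i)) :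
    PolyComp κ x fun i => rep i (a i ^ (n i + 1)) := by
  obtain ⟨P, hP⟩ := hn.leaf
  let enc : ∀ i, M i × M i × ℕ → Data := fun i s =>
    .pair (rep i s.1) (.pair (rep i s.2.1) (.nat s.2.2))
  have key : PolyComp κ x fun i => enc i (sqMul^[P.eval (κ i)] (a i, a i, n i)) := by
    refine PolyComp.loop (step := fun i s => sqMul s) (fun i s => s.2.2 ≤ n i)
      (PolyB.eval P .self) (.eval P hk) (ha.pair (ha.pair hn)) (fun i => le_rfl) ?_ ?_ ?_
    · intro i s hs
      exact (Nat.div_le_self _ _).trans hs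
    · let J := Σ i, {s : M i × M i × ℕ // s.2.2 ≤ n i}
      refine PolyLeaf.pair (hrep.comap fun j : J => ⟨j.1, j.2.1.1⟩)
        (PolyLeaf.pair (hrep.comap fun j : J => ⟨j.1, j.2.1.2.1⟩)
          ((hn.leaf.comap fun j : J => j.1).mono fun j => ?_))
      exact Nat.size_le_size j.2.2
    · intro hl
      have h0 := PolyComp.refl hl
      have hx := h0.snd
      have h1 : PolyComp _ _ fun j : Σ i, {s : M i × M i × ℕ // s.2.2 ≤ n i} =>
        rep j.1 j.2.1.1 := h0.fst.fst
      have h2 : PolyComp _ _ fun j : Σ i, {s : M i × M i × ℕ // s.2.2 ≤ n i} =>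
        rep j.1 j.2.1.2.1 := h0.fst.snd.fst
      have h3 : PolyComp _ _ fun j : Σ i, {s : M i × M i × ℕ // s.2.2 ≤ n i} =>
        .nat j.2.1.2.2 := h0.fst.snd.snd
      refine .pair (.cases
        (c := fun j : Σ i, {s : M i × M i × ℕ // s.2.2 ≤ n i} => j.2.1.2.2 % 2 = 1)
        ((h3.mod (.const h3.1 2)).eq (.const h3.1 1)) ?_ ?_)
        (.pair (hmul _ Sigma.fst _ _ _ hx h2 h2) (h3.div (.const h3.1 2)))
      · refine (hmul _ (fun j => Sigma.fst (Subtype.val j)) _ _ _ (hx.comap _) (h1.comap _)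
          (h2.comap _)).congr fun j => ?_
        rw [sqMul, if_pos j.2]
      · refine (h1.comap _).congr fun j => ?_
        rw [sqMul, if_neg j.2]
  refine key.fst.congr fun i => ?_
  have : n i < 2 ^ P.eval (κ i) := by
    rw [← Nat.size_le]; exact hP i
  simp only [enc, Data.fst]
  rw [sqMul_iterate _ _ _ _ this, pow_succ']

end PowLoop

/-- The input `x` gives access to the public data of the groups `B`, which are among those that
`gen` samples. -/
structure HasPub {ι : Type u} (gen : GroupGen) (κ : ι → ℕ) (x : ι → Data)
    (B : ι → BilinearGroup) : Prop where
  eff : gen.Efficient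
  mem : ∀ i, B i ∈ (gen.sample (κ i)).support
  pub : PolyComp κ x fun i => (B i).pub (κ i)

namespace HasPub

variable {ι : Type u} {gen : GroupGen} {κ : ι → ℕ} {x : ι → Data} {B : ι → BilinearGroup}

theorem lift (H : HasPub gen κ x B) {ι' : Type u} (φ : ι' → ι) {x' : ι' → Data}
    (h : PolyComp (fun j => κ (φ j)) x' fun j => x (φ j)) :
    HasPub gen (fun j => κ (φ j)) x' fun j => B (φ j) :=
  ⟨H.eff, fun j => H.mem (φ j), h.trans (H.pub.comap φ)⟩

theorem k (H : HasPub gen κ x B) : PolyComp κ x fun i => .nat (κ i) := H.pub.fst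

theorem order (H : HasPub gen κ x B) : PolyComp κ x fun i => .nat (B i).p := H.pub.snd.fst

theorem leafG (H : HasPub gen κ x B) :
    PolyLeaf (fun j : Σ i, (B i).G => κ j.1) fun j => repG j.2 := by
  obtain ⟨_, _, _, _, P, hP⟩ := H.eff
  exact ⟨P, fun j => (hP _ _ (H.mem j.1)).2.1 j.2⟩

theorem leafGT (H : HasPub gen κ x B) :
    PolyLeaf (fun j : Σ i, (B i).GT => κ j.1) fun j => repGT j.2 := by
  obtain ⟨_, _, _, _, P, hP⟩ := H.eff
  exact ⟨P, fun j => (hP _ _ (H.mem j.1)).2.2.1 j.2⟩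

theorem leafZ (H : HasPub gen κ x B) :
    PolyLeaf (fun j : Σ i, ZMod (B i).p => κ j.1) fun j => repZ j.2 :=
  (H.order.leaf.comap fun j : Σ i, ZMod (B i).p => j.1).mono fun j =>
    Nat.size_le_size (ZMod.val_lt j.2).le

theorem mulG (H : HasPub gen κ x B) {u v : ∀ i, (B i).G}
    (hu : PolyComp κ x fun i => repG (u i)) (hv : PolyComp κ x fun i => repG (v i)) :
    PolyComp κ x fun i => repG (u i * v i) := by
  obtain ⟨_, f, _, _, P, hP⟩ := H.eff
  exact (H.pub.pair (hu.pair hv)).of_computes f (.eval P .self) fun i =>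
    (hP _ _ (H.mem i)).2.2.2.2.2.1 _ _

theorem mulGT (H : HasPub gen κ x B) {u v : ∀ i, (B i).GT}
    (hu : PolyComp κ x fun i => repGT (u i)) (hv : PolyComp κ x fun i => repGT (v i)) :
    PolyComp κ x fun i => repGT (u i * v i) := by
  obtain ⟨_, _, f, _, P, hP⟩ := H.eff
  exact (H.pub.pair (hu.pair hv)).of_computes f (.eval P .self) fun i =>
    (hP _ _ (H.mem i)).2.2.2.2.2.2.1 _ _

theorem pairing (H : HasPub gen κ x B) {u v : ∀ i, (B i).G}
    (hu : PolyComp κ x fun i => repG (u i)) (hv : PolyComp κ x fun i => repG (v i)) :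
    PolyComp κ x fun i => repGT ((B i).e (u i) (v i)) := by
  obtain ⟨_, _, _, f, P, hP⟩ := H.eff
  exact (H.pub.pair (hu.pair hv)).of_computes f (.eval P .self) fun i =>
    (hP _ _ (H.mem i)).2.2.2.2.2.2.2 _ _

theorem memG (H : HasPub gen κ x B) {n : ι → ℕ} (hn : PolyComp κ x fun i => .nat (n i))
    [∀ i, Decidable (n i ∈ Set.range (B i).encG)] :
    PolyComp κ x fun i => .nat (if n i ∈ Set.range (B i).encG then 1 else 0) := by
  obtain ⟨f, _, _, _, P, hP⟩ := H.eff
  refine (H.pub.pair hn).of_computes f (T := fun i => P.eval (κ i) + P.eval (n i).size)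
    ((PolyB.eval P .self).add (.eval P hn.leaf)) fun i => ?_
  split_ifs with h
  · obtain ⟨u, hu⟩ := h
    rw [← hu]
    intro r hr
    have := (hP _ _ (H.mem i)).2.2.2.1 u r hr
    exact ⟨this.1, this.2.trans (Nat.le_add_right _ _)⟩
  · exact (hP _ _ (H.mem i)).2.2.2.2.1 _ h

theorem eqG (_ : HasPub gen κ x B) {u v : ∀ i, (B i).G}
    (hu : PolyComp κ x fun i => repG (u i)) (hv : PolyComp κ x fun i => repG (v i))
    [∀ i, Decidable (u i = v i)] :
    PolyComp κ x fun i => .nat (if u i = v i then 1 else 0) :=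
  (PolyComp.eq hu hv).congr fun i => by simp [(B i).encG_injective.eq_iff]

theorem eqGT (_ : HasPub gen κ x B) {u v : ∀ i, (B i).GT}
    (hu : PolyComp κ x fun i => repGT (u i)) (hv : PolyComp κ x fun i => repGT (v i))
    [∀ i, Decidable (u i = v i)] :
    PolyComp κ x fun i => .nat (if u i = v i then 1 else 0) :=
  (PolyComp.eq hu hv).congr fun i => by simp [(B i).encGT_injective.eq_iff]

theorem eqZ (_ : HasPub gen κ x B) {a b : ∀ i, ZMod (B i).p}
    (ha : PolyComp κ x fun i => repZ (a i)) (hb : PolyComp κ x fun i => repZ (b i))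
    [∀ i, Decidable (a i = b i)] :
    PolyComp κ x fun i => .nat (if a i = b i then 1 else 0) :=
  (PolyComp.eq ha hb).congr fun i => by simp [(ZMod.val_injective (B i).p).eq_iff]

theorem powG (H : HasPub gen κ x B) {u : ∀ i, (B i).G} {n : ι → ℕ}
    (hu : PolyComp κ x fun i => repG (u i)) (hn : PolyComp κ x fun i => .nat (n i)) :
    PolyComp κ x fun i => repG (u i ^ n i) := by
  refine (PolyComp.pow_succ (fun i u => repG u) H.leafG
    (fun ι' φ x' a b hx ha hb => (H.lift φ hx).mulG ha hb) H.k hu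
    (hn.add (H.order.sub (.const hn.1 1)))).congr fun i => ?_
  have h1 : n i + ((B i).p - 1) + 1 = n i + (B i).p := by
    have := (B i).prime.pos; omega
  rw [h1, pow_add, pow_order (B i).card_G, mul_one]

theorem powGT (H : HasPub gen κ x B) {u : ∀ i, (B i).GT} {n : ι → ℕ}
    (hu : PolyComp κ x fun i => repGT (u i)) (hn : PolyComp κ x fun i => .nat (n i)) :
    PolyComp κ x fun i => repGT (u i ^ n i) := by
  refine (PolyComp.pow_succ (fun i u => repGT u) H.leafGT
    (fun ι' φ x' a b hx ha hb => (H.lift φ hx).mulGT ha hb) H.k hu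
    (hn.add (H.order.sub (.const hn.1 1)))).congr fun i => ?_
  have h1 : n i + ((B i).p - 1) + 1 = n i + (B i).p := by
    have := (B i).prime.pos; omega
  rw [h1, pow_add, pow_order (B i).card_GT, mul_one]

theorem pw (H : HasPub gen κ x B) {u : ∀ i, (B i).G} {a : ∀ i, ZMod (B i).p}
    (hu : PolyComp κ x fun i => repG (u i)) (ha : PolyComp κ x fun i => repZ (a i)) :
    PolyComp κ x fun i => repG (pw (u i) (a i)) := H.powG hu ha

theorem pwT (H : HasPub gen κ x B) {u : ∀ i, (B i).GT} {a : ∀ i, ZMod (B i).p}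
    (hu : PolyComp κ x fun i => repGT (u i)) (ha : PolyComp κ x fun i => repZ (a i)) :
    PolyComp κ x fun i => repGT (pwT (u i) (a i)) := H.powGT hu ha

theorem divGT (H : HasPub gen κ x B) {u v : ∀ i, (B i).GT}
    (hu : PolyComp κ x fun i => repGT (u i)) (hv : PolyComp κ x fun i => repGT (v i)) :
    PolyComp κ x fun i => repGT (u i / v i) := by
  refine (H.mulGT hu (H.powGT hv (H.order.sub (.const hu.1 1)))).congr fun i => ?_
  rw [div_eq_mul_inv]
  congr 2
  rw [eq_inv_iff_mul_eq_one, ← _root_.pow_succ, Nat.sub_add_cancel (B i).prime.pos,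
    pow_order (B i).card_GT]

theorem castZ (H : HasPub gen κ x B) {n : ι → ℕ} (hn : PolyComp κ x fun i => .nat (n i)) :
    PolyComp κ x fun i => repZ ((n i : ZMod (B i).p)) :=
  (hn.mod H.order).congr fun i => by rw [repZ, ZMod.val_natCast]

theorem readZ (H : HasPub gen κ x B) {y : ι → Data} (hy : PolyComp κ x y) :
    PolyComp κ x fun i => repZ ((B i).readZ (y i)) := H.castZ hy.toNat

theorem addZ (H : HasPub gen κ x B) {a b : ∀ i, ZMod (B i).p}
    (ha : PolyComp κ x fun i => repZ (a i)) (hb : PolyComp κ x fun i => repZ (b i)) :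
    PolyComp κ x fun i => repZ (a i + b i) :=
  (H.castZ (ha.add hb)).congr fun i => by simp

theorem mulZ (H : HasPub gen κ x B) {a b : ∀ i, ZMod (B i).p}
    (ha : PolyComp κ x fun i => repZ (a i)) (hb : PolyComp κ x fun i => repZ (b i)) :
    PolyComp κ x fun i => repZ (a i * b i) :=
  (H.castZ (ha.mul hb)).congr fun i => by simp

theorem negZ (H : HasPub gen κ x B) {a : ∀ i, ZMod (B i).p}
    (ha : PolyComp κ x fun i => repZ (a i)) : PolyComp κ x fun i => repZ (-a i) :=
  (H.castZ (H.order.sub ha)).congr fun i => by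
    rw [Nat.cast_sub (ZMod.val_lt (a i)).le]; simp

theorem subZ (H : HasPub gen κ x B) {a b : ∀ i, ZMod (B i).p}
    (ha : PolyComp κ x fun i => repZ (a i)) (hb : PolyComp κ x fun i => repZ (b i)) :
    PolyComp κ x fun i => repZ (a i - b i) :=
  (H.addZ ha (H.negZ hb)).congr fun i => by rw [sub_eq_add_neg]

theorem invZ (H : HasPub gen κ x B) {a : ∀ i, ZMod (B i).p}
    (ha : PolyComp κ x fun i => repZ (a i)) : PolyComp κ x fun i => repZ (a i)⁻¹ := by
  refine (PolyComp.pow_succ (fun i u => repZ u) H.leafZ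
    (fun ι' φ x' a b hx ha hb => (H.lift φ hx).mulZ ha hb) H.k ha
    (H.order.sub (.const ha.1 3))).congr fun i => ?_
  have h1 : (B i).p - 3 + 1 = (B i).p - 2 := by
    have := (B i).two_lt; omega
  rw [h1, inv_eq_pow]

theorem constZ (H : HasPub gen κ x B) (n : ℕ) :
    PolyComp κ x fun i => repZ ((n : ZMod (B i).p)) := H.castZ (.const H.pub.1 n)

theorem uniformZ (H : HasPub gen κ x B) :
    PolySample κ x fun i => (PMF.uniformOfFintype (ZMod (B i).p)).map repZ := by
  refine (PolySample.rand (H.order.sub (.const H.pub.1 1))).congr fun i => ?_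
  have hp := (B i).prime.pos
  have hval : ∀ r : Fin ((B i).p - 1 + 1), ((r.val : ZMod (B i).p)).val = r.val := fun r => by
    rw [ZMod.val_natCast, Nat.mod_eq_of_lt]; have := r.2; omega
  have hinj : Function.Injective fun r : Fin ((B i).p - 1 + 1) => (r.val : ZMod (B i).p) := by
    intro r s hrs
    have := congrArg ZMod.val hrs
    simp only [hval] at this
    exact Fin.ext this
  have hbij := (Fintype.bijective_iff_injective_and_card _).2 ⟨hinj, by
    rw [Fintype.card_fin, ZMod.card]; omega⟩
  rw [← map_uniform_equiv (Equiv.ofBijective _ hbij), PMF.map_comp]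
  congr 1
  funext r
  simp [repZ, hval]

theorem uniformUnits (H : HasPub gen κ x B) :
    PolySample κ x fun i => (PMF.uniformOfFintype (ZMod (B i).p)ˣ).map
      fun a : (ZMod (B i).p)ˣ => repZ (a : ZMod (B i).p) := by
  have h := PolySample.map_data
    (g := fun i (r : Fin ((B i).p - 2 + 1)) => .nat (r.val + 1))
    (PolySample.rand (H.order.sub (.const H.pub.1 2)))
    fun hl => PolyComp.add (m := fun j => j.2.1.val) (PolyComp.refl hl).fst (.const hl 1)
  refine h.congr fun i => ?_
  have hp := (B i).two_lt
  have hval : ∀ r : Fin ((B i).p - 2 + 1),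
      (((r.val + 1 : ℕ) : ZMod (B i).p)).val = r.val + 1 := fun r => by
    rw [ZMod.val_natCast, Nat.mod_eq_of_lt]; have := r.2; omega
  have hne : ∀ r : Fin ((B i).p - 2 + 1), ((r.val + 1 : ℕ) : ZMod (B i).p) ≠ 0 := by
    intro r h0
    have := hval r
    rw [h0, ZMod.val_zero] at this
    omega
  have hinj : Function.Injective fun r : Fin ((B i).p - 2 + 1) => Units.mk0 _ (hne r) := by
    intro r s hrs
    have := congrArg (fun a : (ZMod (B i).p)ˣ => (a : ZMod (B i).p).val) hrs
    simp only [Units.val_mk0, hval] at this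
    exact Fin.ext (by omega)
  have hbij := (Fintype.bijective_iff_injective_and_card _).2 ⟨hinj, by
    rw [Fintype.card_fin, ZMod.card_units]; omega⟩
  rw [← map_uniform_equiv (Equiv.ofBijective _ hbij), PMF.map_comp]
  congr 1
  funext r
  simp only [Function.comp, repZ, Equiv.ofBijective_apply, Units.val_mk0]
  rw [hval]

end HasPub

/-! ### The simulated key generation authority -/

section Simulation

/-- The finitely many sessions that are not fresh, the most recent state first. -/
abbrev Sessions (B : BilinearGroup) : Type := List (ZMod B.p × Session B)

/-- The state of the session for `ID`. -/
def Sessions.get {B : BilinearGroup} : Sessions B → ZMod B.p → Session B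
  | [], _ => .fresh
  | (J, s) :: l, ID => if J = ID then s else Sessions.get l ID

/-- How the simulated authority treats a message: either there is an ordinary answer, with a flag
telling whether the session for the target identity has just been opened, or the message
completes the proof of knowledge of the commitment `R` in that session, with challenge `c` and
response `z₁`, `z₂`. -/
inductive Reply (B : BilinearGroup) : Type
  | cont (opened : Bool) (m : Msg B) (l : Sessions B) : Reply B
  | claim (R : B.G) (c z₁ z₂ : ZMod B.p) (l : Sessions B) : Reply B

variable {B : BilinearGroup}

/-- A key for `ID ≠ ID⋆`, computed without the master key from `g ^ ID⋆ * Z = X ^ ω`, for the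
coins `r` and `t`. With `W = Y * R * h ^ t`, the element `W ^ (1 / (ID - ID⋆))` is a power of `X`
with unknown exponent `r₀`, and the key is the one for the exponent `r - r₀` (or `-r₀`, if
`r = r₀`, so that the exponent is never `0`). -/
def simKey (mpk : PublicKey B) (IDs ω ID : ZMod B.p) (R : B.G) (r t : ZMod B.p) : UserKey B :=
  open Classical in
  let W := mpk.Y * R * pw mpk.h t
  let r' := if pw mpk.X r = pw W (ID - IDs)⁻¹ then 0 else r
  { d₁ := pw (mpk.hashID ID) r' * pw W (-(ω * (ID - IDs)⁻¹))
    d₂ := pw mpk.X r' * pw W (-(ID - IDs)⁻¹)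
    d₃ := t }

/-- A simulated key for `ID ≠ ID⋆`, with fresh coins. -/
def simIssue (mpk : PublicKey B) (IDs ω ID : ZMod B.p) (R : B.G) : PMF (UserKey B) :=
  (PMF.uniformOfFintype (ZMod B.p)ˣ).bind fun r : (ZMod B.p)ˣ =>
    (PMF.uniformOfFintype (ZMod B.p)ˣ).map fun t : (ZMod B.p)ˣ => simKey mpk IDs ω ID R r t

open Classical in
/-- Reaction to the first message of a session. -/
def answerOpen (IDs ID : ZMod B.p) (R V : Option B.G) (l : Sessions B) : PMF (Reply B) :=
  match R, V, l.get ID with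
  | some R, some V, .fresh => (PMF.uniformOfFintype (ZMod B.p)).map fun c =>
      .cont (decide (ID = IDs)) (.challenge c) ((ID, .waiting R V c) :: l)
  | _, _, _ => PMF.pure (.cont false .reject l)

open Classical in
/-- Reaction to the response in a session. -/
def answerClose (mpk : PublicKey B) (IDs ω ID z₁ z₂ : ZMod B.p) (l : Sessions B) :
    PMF (Reply B) :=
  match l.get ID with
  | .waiting R V c =>
      if Accepts mpk R V c z₁ z₂ then
        if ID = IDs then PMF.pure (.claim R c z₁ z₂ ((ID, .done) :: l))
        else (simIssue mpk IDs ω ID R).map fun d => .cont false (.key d) ((ID, .done) :: l)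
      else PMF.pure (.cont false .reject ((ID, .done) :: l))
  | _ => PMF.pure (.cont false .reject l)

/-- Reaction to a message of the adversary. -/
def answer (mpk : PublicKey B) (IDs ω : ZMod B.p) (q : Data) (l : Sessions B) : PMF (Reply B) :=
  if q.fst.toNat = 0 then
    answerOpen IDs (B.readZ q.snd.fst) (B.readG q.snd.snd.fst) (B.readG q.snd.snd.snd) l
  else if q.fst.toNat = 1 then
    answerClose mpk IDs ω (B.readZ q.snd.fst) (B.readZ q.snd.snd.fst)
      (B.readZ q.snd.snd.snd) l
  else PMF.pure (.cont false .reject l)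

/-- A transcript `(c, z₁, z₂)` of the proof of knowledge, without its first message. -/
abbrev Transcript (B : BilinearGroup) : Type := ZMod B.p × ZMod B.p × ZMod B.p

/-- The key for `ID⋆` that is issued for the coins `r` when `u` and `v` are transcripts with the
same first message. If both are accepting and their challenges differ, they determine `t₀` and
`θ` with `R = h ^ t₀ * X ^ θ`, and `t₁ = τ - t₀` is the value for which the key can be computed
from `Y * h ^ τ = X ^ γ` without the master key. Otherwise the key is meaningless. -/
def starKey (mpk : PublicKey B) (ω γ τ : ZMod B.p) (u v : Transcript B) (r : ZMod B.p) :
    UserKey B where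
  d₁ := pw mpk.g (γ + (u.2.2 - v.2.2) * (u.1 - v.1)⁻¹) * pw (pw mpk.X ω) r
  d₂ := pw mpk.X r
  d₃ := τ - (u.2.1 - v.2.1) * (u.1 - v.1)⁻¹

/-- A simulated key for `ID⋆`, with fresh coins. -/
def starIssue (mpk : PublicKey B) (ω γ τ : ZMod B.p) (u v : Transcript B) : PMF (UserKey B) :=
  (PMF.uniformOfFintype (ZMod B.p)ˣ).map fun r : (ZMod B.p)ˣ => starKey mpk ω γ τ u v r

/-- A state of the simulated interaction: the number of remaining messages to the authority, the
message to the adversary, the state of the adversary, the sessions, and the transcript that has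
been obtained by looking ahead. -/
structure SimState (B : BilinearGroup) : Type where
  n : ℕ
  msg : Msg B
  adv : Data
  sess : Sessions B
  tr : Transcript B

/-- The state that follows an answer in a simulation run that stops as soon as the proof of
knowledge for the target identity is completed. -/
def lookNext (s : SimState B) (adv : Data) : Reply B → SimState B
  | .cont _ m l => ⟨s.n - 1, m, adv, l, s.tr⟩
  | .claim _ c z₁ z₂ l => ⟨0, .reject, adv, l, (c, z₁, z₂)⟩

/-- One activation of the adversary when looking ahead. -/
def lookStep (A : Adversary) (mpk : PublicKey B) (IDs ω : ZMod B.p) (s : SimState B) :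
    PMF (SimState B) :=
  if s.n = 0 then PMF.pure s else
    (A.act.out (.pair s.msg.rep s.adv)).bind fun o =>
      (answer mpk IDs ω o.fst s.sess).map (lookNext s o.snd)

/-- Runs the adversary until the proof of knowledge for the target identity is completed. -/
def look (A : Adversary) (mpk : PublicKey B) (IDs ω : ZMod B.p) (s : SimState B) :
    PMF (SimState B) :=
  iterP (lookStep A mpk IDs ω) s.n s

/-- The state that follows an answer in the simulation. When the session for the target identity
is opened, the message is answered a second time with an independent challenge, and a run of the
adversary from there provides a second transcript for the same commitment. -/
def mainNext (A : Adversary) (mpk : PublicKey B) (IDs ω γ τ : ZMod B.p) (s : SimState B)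
    (o : Data) : Reply B → PMF (SimState B)
  | .cont opened m l =>
      if opened then
        (answer mpk IDs ω o.fst s.sess).bind fun a =>
          (look A mpk IDs ω (lookNext s o.snd a)).map fun s' => ⟨s.n - 1, m, o.snd, l, s'.tr⟩
      else PMF.pure ⟨s.n - 1, m, o.snd, l, s.tr⟩
  | .claim _ c z₁ z₂ l =>
      (starIssue mpk ω γ τ (c, z₁, z₂) s.tr).map fun d => ⟨s.n - 1, .key d, o.snd, l, s.tr⟩

/-- One activation of the adversary in the main run of the simulation. -/
def mainStep (A : Adversary) (mpk : PublicKey B) (IDs ω γ τ : ZMod B.p) (s : SimState B) :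
    PMF (SimState B) :=
  if s.n = 0 then PMF.pure s else
    (A.act.out (.pair s.msg.rep s.adv)).bind fun o =>
      (answer mpk IDs ω o.fst s.sess).bind (mainNext A mpk IDs ω γ τ s o)

/-- The output of the adversary after the simulated interaction. -/
def simRun (A : Adversary) (mpk : PublicKey B) (IDs ω γ τ : ZMod B.p) (s : SimState B) :
    PMF Data :=
  (iterP (mainStep A mpk IDs ω γ τ) s.n s).bind fun s' =>
    (A.act.out (.pair s'.msg.rep s'.adv)).map Data.fst

end Simulation

/-! ### Exactness of the simulated answers -/

section Answers

variable {B : BilinearGroup}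

theorem Sessions.get_cons (l : Sessions B) (ID : ZMod B.p) (s : Session B) :
    Sessions.get ((ID, s) :: l) = fun J => if J = ID then s else l.get J := by
  funext J
  simp only [Sessions.get, eq_comm]

/-- Shifting by `r₀` permutes the residues, and sending `r₀` to `-r₀` makes it a permutation of
the nonzero ones. -/
theorem exists_shift_equiv (r₀ : ZMod B.p) : ∃ φ : (ZMod B.p)ˣ ≃ (ZMod B.p)ˣ,
    ∀ r : (ZMod B.p)ˣ, (φ r : ZMod B.p)
      = (if (r : ZMod B.p) = r₀ then 0 else (r : ZMod B.p)) - r₀ := by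
  classical
  have hne : ∀ r : (ZMod B.p)ˣ,
      (if (r : ZMod B.p) = r₀ then 0 else (r : ZMod B.p)) - r₀ ≠ 0 := by
    intro r
    split_ifs with h
    · rw [zero_sub, neg_ne_zero, ← h]; exact r.ne_zero
    · exact sub_ne_zero.2 h
  let φ : (ZMod B.p)ˣ → (ZMod B.p)ˣ := fun r => Units.mk0 _ (hne r)
  have hφ : Function.Injective φ := by
    intro r s hrs
    have h := congrArg (fun a : (ZMod B.p)ˣ => (a : ZMod B.p)) hrs
    simp only [φ, Units.val_mk0, sub_left_inj] at h
    have hr := r.ne_zero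
    have hs := s.ne_zero
    apply Units.ext
    split_ifs at h with h1 h2 h2
    · rw [h1, h2]
    · exact absurd h.symm hs
    · exact absurd h hr
    · exact h
  exact ⟨Equiv.ofBijective φ (Finite.injective_iff_bijective.1 hφ), fun r => rfl⟩

theorem issue_eq (mpk : PublicKey B) (x : (ZMod B.p)ˣ) (ID : ZMod B.p) (R : B.G) :
    issue mpk x ID R = (PMF.uniformOfFintype (ZMod B.p)ˣ).bind fun r : (ZMod B.p)ˣ =>
      (PMF.uniformOfFintype (ZMod B.p)ˣ).map fun t : (ZMod B.p)ˣ =>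
        { d₁ := pw (mpk.Y * R * pw mpk.h t) ((x⁻¹ : (ZMod B.p)ˣ) : ZMod B.p)
            * pw (mpk.hashID ID) r
          d₂ := pw mpk.X r
          d₃ := t } := by
  simp only [issue, pmf_bind_eq, pmf_pure_eq]
  congr 1

theorem hashID_eq {mpk : PublicKey B} {IDs ω : ZMod B.p} (hZ : mpk.hashID IDs = pw mpk.X ω)
    (ID : ZMod B.p) : mpk.hashID ID = pw mpk.g (ID - IDs) * pw mpk.X ω := by
  rw [← hZ, PublicKey.hashID, PublicKey.hashID, ← mul_assoc, ← pw_add, sub_add_cancel]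

theorem simKey_eq {mpk : PublicKey B} {x : (ZMod B.p)ˣ} {IDs ω ID : ZMod B.p}
    (hg : mpk.g ≠ 1) (hX : mpk.X = pw mpk.g x) (hZ : mpk.hashID IDs = pw mpk.X ω)
    (hID : ID ≠ IDs) {R : B.G} {t r₀ : ZMod B.p}
    (hr₀ : pw mpk.X r₀ = pw (mpk.Y * R * pw mpk.h t) (ID - IDs)⁻¹) (r : ZMod B.p) :
    simKey mpk IDs ω ID R r t =
      { d₁ := pw (mpk.Y * R * pw mpk.h t) ((x⁻¹ : (ZMod B.p)ˣ) : ZMod B.p)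
          * pw (mpk.hashID ID) ((if r = r₀ then 0 else r) - r₀)
        d₂ := pw mpk.X ((if r = r₀ then 0 else r) - r₀)
        d₃ := t } := by
  have hx : (x : ZMod B.p) ≠ 0 := x.ne_zero
  have hX1 : mpk.X ≠ 1 := hX ▸ pw_ne_one hg hx
  have hΔ : ID - IDs ≠ 0 := sub_ne_zero.2 hID
  obtain ⟨w, hw⟩ := exists_pw hg (mpk.Y * R * pw mpk.h t)
  have hiff : pw mpk.X r = pw (mpk.Y * R * pw mpk.h t) (ID - IDs)⁻¹ ↔ r = r₀ := by
    rw [← hr₀]; exact (pw_injective hX1).eq_iff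
  have hr : x * r₀ = w * (ID - IDs)⁻¹ := by
    rw [← hw, hX, ← pw_mul, ← pw_mul] at hr₀
    exact pw_injective hg hr₀
  have hr' : r₀ = (x : ZMod B.p)⁻¹ * (w * (ID - IDs)⁻¹) := by
    rw [← hr, inv_mul_cancel_left₀ hx]
  simp only [simKey, hiff]
  generalize (if r = r₀ then 0 else r) = r'
  congr 1
  · rw [hashID_eq hZ ID, ← hw, hX, ← pw_mul, ← pw_add, ← pw_mul, ← pw_mul, ← pw_mul, ← pw_mul,
      ← pw_add, ← pw_add]
    congr 1
    rw [hr', Units.val_inv_eq_inv_val]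
    field_simp
    ring
  · rw [sub_eq_add_neg r' r₀, pw_add, pw_neg, pw_neg, hr₀]

/-- For identities other than the target, the keys are distributed exactly as real ones. -/
theorem simIssue_eq {mpk : PublicKey B} {x : (ZMod B.p)ˣ} {IDs ω ID : ZMod B.p}
    (hg : mpk.g ≠ 1) (hX : mpk.X = pw mpk.g x) (hZ : mpk.hashID IDs = pw mpk.X ω)
    (hID : ID ≠ IDs) (R : B.G) : simIssue mpk IDs ω ID R = issue mpk x ID R := by
  have hX1 : mpk.X ≠ 1 := hX ▸ pw_ne_one hg x.ne_zero
  simp only [issue_eq, simIssue, ← PMF.bind_pure_comp]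
  rw [PMF.bind_comm]
  conv_rhs => rw [PMF.bind_comm]
  congr 1
  funext t
  obtain ⟨r₀, hr₀⟩ := exists_pw hX1 (pw (mpk.Y * R * pw mpk.h t) (ID - IDs)⁻¹)
  obtain ⟨φ, hφ⟩ := exists_shift_equiv r₀
  conv_rhs => rw [← map_uniform_equiv φ, PMF.bind_map]
  congr 1
  funext r
  simp only [Function.comp]
  rw [simKey_eq hg hX hZ hID hr₀, hφ]

/-- The real authority differs from the simulated one only in the treatment of a completed proof
of knowledge for the target identity. -/
theorem keygenOracle_eq {mpk : PublicKey B} {x : (ZMod B.p)ˣ} {IDs ω : ZMod B.p}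
    (hg : mpk.g ≠ 1) (hX : mpk.X = pw mpk.g x) (hZ : mpk.hashID IDs = pw mpk.X ω)
    (q : Data) (l : Sessions B) :
    keygenOracle mpk x q l.get = (answer mpk IDs ω q l).bind fun a =>
      match a with
      | .cont _ m l' => PMF.pure (m, l'.get)
      | .claim R _ _ _ l' => (issue mpk x IDs R).map fun d => (.key d, l'.get) := by
  have hupd : ∀ (ID : ZMod B.p) (s : Session B) (inst : DecidableEq (ZMod B.p)),
      @Function.update _ (fun _ => Session B) inst l.get ID s = Sessions.get ((ID, s) :: l) := by
    intro ID s inst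
    rw [Sessions.get_cons]
    funext J
    rw [Function.update_apply]
    congr
  unfold keygenOracle answer
  split_ifs with h0 h1
  · unfold openSession answerOpen
    generalize B.readG q.snd.snd.fst = R
    generalize B.readG q.snd.snd.snd = V
    generalize B.readZ q.snd.fst = ID
    rcases R with _ | R <;> rcases V with _ | V <;> rcases hs : l.get ID with _ | ⟨R', V', c⟩ | _ <;>
      simp only [pmf_bind_eq, pmf_pure_eq, PMF.pure_bind]
    rw [PMF.bind_map]
    congr 1
    funext c
    simp only [Function.comp, hupd]
  · unfold closeSession answerClose
    generalize B.readZ q.snd.snd.fst = z₁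
    generalize B.readZ q.snd.snd.snd = z₂
    generalize B.readZ q.snd.fst = ID
    rcases hs : l.get ID with _ | ⟨R, V, c⟩ | _ <;>
      simp only [pmf_bind_eq, pmf_pure_eq, PMF.pure_bind]
    by_cases hacc : Accepts mpk R V c z₁ z₂
    · by_cases hID : ID = IDs
      · simp only [hacc, hID, if_true, PMF.pure_bind, ← PMF.bind_pure_comp]
        subst hID
        congr 1
        funext d
        simp only [Function.comp, hupd]
      · simp only [hacc, hID, if_true, if_false, PMF.bind_map]
        rw [simIssue_eq hg hX hZ hID]
        congr 1
        funext d
        simp only [Function.comp, hupd]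
    · simp only [hacc, if_false, PMF.pure_bind, hupd]
  · simp only [pmf_pure_eq, PMF.pure_bind]

/-- Once the session for the target identity has been opened, its commitment does not change any
more, and only a response accepted for it is claimed. -/
theorem answer_waiting {mpk : PublicKey B} {IDs ω : ZMod B.p} {q : Data} {l : Sessions B}
    {R V : B.G} {c : ZMod B.p} (hl : l.get IDs = .waiting R V c ∨ l.get IDs = .done) :
    ∀ a ∈ (answer mpk IDs ω q l).support, match a with
      | .cont o _ l' => o = false ∧ (l'.get IDs = .waiting R V c ∨ l'.get IDs = .done) ∧
          (l.get IDs = .done → l'.get IDs = .done)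
      | .claim R' c' z₁ z₂ l' => l.get IDs = .waiting R V c ∧ R' = R ∧ c' = c ∧
          Accepts mpk R V c z₁ z₂ ∧ l'.get IDs = .done := by
  intro a ha
  have hcons : ∀ {ID : ZMod B.p} {s : Session B}, ID ≠ IDs →
      Sessions.get ((ID, s) :: l) IDs = l.get IDs := by
    intro ID s h
    simp [Sessions.get, h]
  unfold answer at ha
  split_ifs at ha with h0 h1
  · unfold answerOpen at ha
    generalize B.readG q.snd.snd.fst = R₁ at ha
    generalize B.readG q.snd.snd.snd = V₁ at ha
    generalize B.readZ q.snd.fst = ID at ha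
    rcases R₁ with _ | R₁ <;> rcases V₁ with _ | V₁ <;>
      rcases hs : l.get ID with _ | ⟨R', V', c'⟩ | _ <;>
      simp only [hs, PMF.mem_support_pure_iff, PMF.support_map] at ha <;>
      first
      | (subst ha; exact ⟨rfl, hl, fun h => h⟩)
      | skip
    obtain ⟨c₁, -, rfl⟩ := ha
    have hne : ID ≠ IDs := by
      rintro rfl
      rw [hs] at hl
      rcases hl with h | h <;> cases h
    exact ⟨by simp [hne], by rwa [hcons hne], fun h => by rwa [hcons hne]⟩
  · unfold answerClose at ha
    generalize B.readZ q.snd.snd.fst = z₁ at ha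
    generalize B.readZ q.snd.snd.snd = z₂ at ha
    generalize B.readZ q.snd.fst = ID at ha
    rcases hs : l.get ID with _ | ⟨R', V', c'⟩ | _ <;> simp only [hs] at ha
    · rw [PMF.mem_support_pure_iff] at ha
      subst ha; exact ⟨rfl, hl, fun h => h⟩
    · have hdone : ∀ {ID : ZMod B.p}, (Sessions.get ((ID, .done) :: l) IDs = .waiting R V c ∨
          Sessions.get ((ID, .done) :: l) IDs = .done) ∧
          (l.get IDs = .done → Sessions.get ((ID, .done) :: l) IDs = .done) := by
        intro ID
        by_cases h : ID = IDs
        · simp [Sessions.get, h]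
        · rw [hcons h]; exact ⟨hl, id⟩
      split_ifs at ha with hacc hID
      · rw [PMF.mem_support_pure_iff] at ha
        subst ha hID
        rw [hs] at hl
        rcases hl with h | h
        · cases h
          exact ⟨hs, rfl, rfl, hacc, by simp [Sessions.get]⟩
        · cases h
      · rw [PMF.support_map] at ha
        obtain ⟨d, -, rfl⟩ := ha
        exact ⟨rfl, hdone⟩
      · rw [PMF.mem_support_pure_iff] at ha
        subst ha
        exact ⟨rfl, hdone⟩
    · rw [PMF.mem_support_pure_iff] at ha
      subst ha; exact ⟨rfl, hl, fun h => h⟩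
  · rw [PMF.mem_support_pure_iff] at ha
    subst ha; exact ⟨rfl, hl, fun h => h⟩

/-- Before the session for the target identity is opened, a message either opens it, or leaves it
fresh. -/
theorem answer_fresh {mpk : PublicKey B} {IDs ω : ZMod B.p} {q : Data} {l : Sessions B}
    (hl : l.get IDs = .fresh) :
    (∃ R V, answer mpk IDs ω q l = (PMF.uniformOfFintype (ZMod B.p)).map fun c =>
      .cont true (.challenge c) ((IDs, .waiting R V c) :: l)) ∨
    ∀ a ∈ (answer mpk IDs ω q l).support,
      ∃ m l', a = .cont false m l' ∧ l'.get IDs = .fresh := by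
  have hcons : ∀ {ID : ZMod B.p} {s : Session B}, ID ≠ IDs →
      Sessions.get ((ID, s) :: l) IDs = .fresh := by
    intro ID s h
    simp [Sessions.get, h, hl]
  unfold answer
  split_ifs with h0 h1
  · unfold answerOpen
    generalize B.readG q.snd.snd.fst = R
    generalize B.readG q.snd.snd.snd = V
    generalize B.readZ q.snd.fst = ID
    rcases R with _ | R <;> rcases V with _ | V <;>
      rcases hs : l.get ID with _ | ⟨R', V', c'⟩ | _ <;>
      first
      | exact Or.inr fun a ha => ⟨_, _, by simpa using ha, hl⟩
      | skip
    by_cases hID : ID = IDs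
    · subst hID
      exact Or.inl ⟨R, V, by simp⟩
    · refine Or.inr fun a ha => ?_
      simp only [PMF.support_map] at ha
      obtain ⟨c, -, rfl⟩ := ha
      exact ⟨_, _, by simp [hID]; exact ⟨rfl, rfl⟩, hcons hID⟩
  · refine Or.inr ?_
    unfold answerClose
    generalize B.readZ q.snd.snd.fst = z₁
    generalize B.readZ q.snd.snd.snd = z₂
    generalize B.readZ q.snd.fst = ID
    rcases hs : l.get ID with _ | ⟨R', V', c'⟩ | _ <;>
      first
      | exact fun a ha => ⟨_, _, by simpa using ha, hl⟩
      | skip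
    have hne : ID ≠ IDs := by
      rintro rfl
      rw [hs] at hl; cases hl
    intro a ha
    simp only [hne, if_false] at ha
    split_ifs at ha with hacc
    · rw [PMF.support_map] at ha
      obtain ⟨d, -, rfl⟩ := ha
      exact ⟨_, _, rfl, hcons hne⟩
    · rw [PMF.mem_support_pure_iff] at ha
      exact ⟨_, _, ha, hcons hne⟩
  · exact Or.inr fun a ha => ⟨_, _, by simpa using ha, hl⟩

end Answers

/-! ### Extraction from two transcripts -/

section Extraction

variable {B : BilinearGroup}

/-- Admitting the residue `0` changes an expectation by at most `1 / p`. -/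
theorem ev_units_le (F : ZMod B.p → ℝ≥0∞) (hF : ∀ a, F a ≤ 1) :
    ev (PMF.uniformOfFintype (ZMod B.p)ˣ) (fun a => F a)
      ≤ ev (PMF.uniformOfFintype (ZMod B.p)) F + (B.p : ℝ≥0∞)⁻¹ := by
  rw [ev_uniform, ev_uniform, ZMod.card_units, ZMod.card]
  have hp := B.two_lt
  obtain ⟨m, hm⟩ : ∃ m, B.p = m + 1 := ⟨B.p - 1, by omega⟩
  have hsum : ∑ a : (ZMod B.p)ˣ, F a ≤ ∑ a, F a := by
    have h := Finset.sum_map (Finset.univ : Finset (ZMod B.p)ˣ)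
      ⟨fun a : (ZMod B.p)ˣ => (a : ZMod B.p), Units.val_injective⟩ F
    simp only [Function.Embedding.coeFn_mk] at h
    rw [← h]
    exact Finset.sum_le_sum_of_subset (Finset.subset_univ _)
  have hS : ∑ a : (ZMod B.p)ˣ, F a ≤ m := by
    refine (Finset.sum_le_sum fun (a : (ZMod B.p)ˣ) _ => hF (a : ZMod B.p)).trans ?_
    rw [Finset.sum_const, Finset.card_univ, ZMod.card_units]
    simp [hm]
  set S := ∑ a : (ZMod B.p)ˣ, F a
  have hm0 : (m : ℝ≥0∞) ≠ 0 := by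
    have : m ≠ 0 := by omega
    exact_mod_cast this
  have hm1 : (m : ℝ≥0∞) ≠ ⊤ := ENNReal.natCast_ne_top m
  have hp0 : (B.p : ℝ≥0∞) ≠ 0 := by exact_mod_cast B.prime.ne_zero
  have hp1 : (B.p : ℝ≥0∞) ≠ ⊤ := ENNReal.natCast_ne_top _
  have e1 : B.p - 1 = m := by omega
  rw [e1]
  have ha : (m : ℝ≥0∞)⁻¹ * S ≤ 1 := by
    calc (m : ℝ≥0∞)⁻¹ * S ≤ (m : ℝ≥0∞)⁻¹ * m := by gcongr
      _ = 1 := ENNReal.inv_mul_cancel hm0 hm1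
  calc (m : ℝ≥0∞)⁻¹ * S = (B.p : ℝ≥0∞)⁻¹ * (B.p * ((m : ℝ≥0∞)⁻¹ * S)) := by
        rw [← mul_assoc, ENNReal.inv_mul_cancel hp0 hp1, one_mul]
    _ = (B.p : ℝ≥0∞)⁻¹ * (S + (m : ℝ≥0∞)⁻¹ * S) := by
        congr 1
        rw [hm, Nat.cast_add, Nat.cast_one, add_mul, one_mul, ← mul_assoc,
          ENNReal.mul_inv_cancel hm0 hm1, one_mul]
    _ ≤ (B.p : ℝ≥0∞)⁻¹ * (∑ a, F a + 1) := by gcongr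
    _ = _ := by rw [mul_add, mul_one]

variable {mpk : PublicKey B} {x : (ZMod B.p)ˣ} {IDs ω : ZMod B.p}

/-- Two accepting transcripts with different challenges yield a correct key. -/
theorem starKey_eq (hg : mpk.g ≠ 1) (hX : mpk.X = pw mpk.g x) (hZ : mpk.hashID IDs = pw mpk.X ω)
    {γ τ : ZMod B.p} (hγ : mpk.Y * pw mpk.h τ = pw mpk.X γ) {R V : B.G} {u v : Transcript B}
    (hu : Accepts mpk R V u.1 u.2.1 u.2.2) (hv : Accepts mpk R V v.1 v.2.1 v.2.2)
    (huv : v.1 ≠ u.1) (r : ZMod B.p) :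
    starKey mpk ω γ τ u v r =
      { d₁ := pw (mpk.Y * R * pw mpk.h (τ - (u.2.1 - v.2.1) * (u.1 - v.1)⁻¹))
            ((x⁻¹ : (ZMod B.p)ˣ) : ZMod B.p) * pw (mpk.hashID IDs) r
        d₂ := pw mpk.X r
        d₃ := τ - (u.2.1 - v.2.1) * (u.1 - v.1)⁻¹ } := by
  have hx : (x : ZMod B.p) ≠ 0 := x.ne_zero
  have hc : u.1 - v.1 ≠ 0 := sub_ne_zero.2 huv.symm
  rw [starKey, hZ]
  congr 2
  obtain ⟨ρ, hρ⟩ := exists_pw hg R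
  obtain ⟨η, hη⟩ := exists_pw hg V
  obtain ⟨b, hb⟩ := exists_pw hg mpk.h
  obtain ⟨y, hy⟩ := exists_pw hg mpk.Y
  have hinj := pw_injective hg
  rw [Accepts, hX, ← hρ, ← hη, ← hb, ← pw_mul, ← pw_mul, ← pw_mul, ← pw_add, ← pw_add] at hu hv
  rw [hX, ← hb, ← hy, ← pw_mul, ← pw_mul, ← pw_add] at hγ
  rw [← hρ, ← hb, ← hy, ← pw_mul, ← pw_add, ← pw_add, ← pw_mul]
  congr 1
  have h1 := hinj hu
  have h2 := hinj hv
  have h3 := hinj hγ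
  rw [Units.val_inv_eq_inv_val]
  field_simp
  linear_combination -(u.1 - v.1) * h3 + h1 - h2

/-- For uniform `τ`, with which `Y` is blinded, the key extracted from two transcripts is
distributed almost as a real key. -/
theorem ev_issue_le (hg : mpk.g ≠ 1) (hX : mpk.X = pw mpk.g x)
    (hZ : mpk.hashID IDs = pw mpk.X ω) {γ : ZMod B.p → ZMod B.p}
    (hγ : ∀ τ, mpk.Y * pw mpk.h τ = pw mpk.X (γ τ)) {R V : B.G} {u v : Transcript B}
    (hu : Accepts mpk R V u.1 u.2.1 u.2.2) (hv : Accepts mpk R V v.1 v.2.1 v.2.2)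
    (huv : v.1 ≠ u.1) (F : UserKey B → ℝ≥0∞) (hF : ∀ d, F d ≤ 1) :
    ev (issue mpk x IDs R) F ≤ ev (PMF.uniformOfFintype (ZMod B.p))
      (fun τ => ev (starIssue mpk ω (γ τ) τ u v) F) + (B.p : ℝ≥0∞)⁻¹ := by
  simp only [starIssue, ev_map]
  rw [ev_comm, issue_eq, ev_bind]
  refine (ev_mono fun r => ?_).trans ((ev_add _ _ fun _ => (B.p : ℝ≥0∞)⁻¹).le.trans
    (add_le_add_right (ev_const _ _).le _))
  rw [ev_map]
  refine (ev_units_le (B := B) (fun t => F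
    { d₁ := pw (mpk.Y * R * pw mpk.h t) ((x⁻¹ : (ZMod B.p)ˣ) : ZMod B.p)
        * pw (mpk.hashID IDs) r
      d₂ := pw mpk.X r
      d₃ := t }) fun _ => hF _).trans (add_le_add_left (le_of_eq ?_) _)
  rw [← ev_uniform_equiv (Equiv.subRight ((u.2.1 - v.2.1) * (u.1 - v.1)⁻¹))]
  congr 1
  funext τ
  rw [starKey_eq hg hX hZ (hγ τ) hu hv huv]
  rfl

end Extraction

/-! ### The rewinding argument -/

section Rewinding

variable {B : BilinearGroup} (A : Adversary) (mpk : PublicKey B) (x : (ZMod B.p)ˣ)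
  (IDs ω : ZMod B.p) (f : Data → ℝ≥0∞)

/-- The expectation of `f` on the adversary's output in the real game. -/
def realVal (n : ℕ) (m : Msg B) (σ : Data) (l : Sessions B) : ℝ≥0∞ :=
  ev (interact A mpk x n m σ l.get) f

/-- The part of `realVal` from runs without an accepted proof for the target identity. -/
def nuVal : ℕ → Msg B → Data → Sessions B → ℝ≥0∞
  | 0, m, σ, _ => ev (A.act.out (.pair m.rep σ)) fun o => f o.fst
  | n + 1, m, σ, l => ev (A.act.out (.pair m.rep σ)) fun o =>
      ev (answer mpk IDs ω o.fst l) fun a =>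
        match a with
        | .cont _ m' l' => nuVal n m' o.snd l'
        | .claim _ _ _ _ _ => 0

/-- The part of `realVal` from runs with an accepted proof for the target identity. -/
def phiVal : ℕ → Msg B → Data → Sessions B → ℝ≥0∞
  | 0, _, _, _ => 0
  | n + 1, m, σ, l => ev (A.act.out (.pair m.rep σ)) fun o =>
      ev (answer mpk IDs ω o.fst l) fun a =>
        match a with
        | .cont _ m' l' => phiVal n m' o.snd l'
        | .claim R _ _ _ l' => ev (issue mpk x IDs R) fun d =>
            realVal A mpk x f n (.key d) o.snd l'

variable {A mpk x IDs ω f}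

theorem realVal_zero (m : Msg B) (σ : Data) (l : Sessions B) :
    realVal A mpk x f 0 m σ l = ev (A.act.out (.pair m.rep σ)) fun o => f o.fst := by
  simp only [realVal, interact, pmf_bind_eq, pmf_pure_eq, ev_bind, ev_pure]

theorem realVal_le_one (hf : ∀ d, f d ≤ 1) (n : ℕ) (m : Msg B) (σ : Data) (l : Sessions B) :
    realVal A mpk x f n m σ l ≤ 1 := ev_le_one hf

section

variable (hg : mpk.g ≠ 1) (hX : mpk.X = pw mpk.g x) (hZ : mpk.hashID IDs = pw mpk.X ω)

include hg hX hZ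

theorem interact_succ (n : ℕ) (m : Msg B) (σ : Data) (l : Sessions B) :
    interact A mpk x (n + 1) m σ l.get = (A.act.out (.pair m.rep σ)).bind fun o =>
      (answer mpk IDs ω o.fst l).bind fun a =>
        match a with
        | .cont _ m' l' => interact A mpk x n m' o.snd l'.get
        | .claim R _ _ _ l' => (issue mpk x IDs R).bind fun d =>
            interact A mpk x n (.key d) o.snd l'.get := by
  simp only [interact, pmf_bind_eq]
  congr 1
  funext o
  rw [keygenOracle_eq hg hX hZ, PMF.bind_bind]
  congr 1
  funext a
  cases a with
  | cont b m' l' => simp only [PMF.pure_bind]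
  | claim R c z₁ z₂ l' => simp only [PMF.bind_map]; rfl

theorem realVal_succ (n : ℕ) (m : Msg B) (σ : Data) (l : Sessions B) :
    realVal A mpk x f (n + 1) m σ l = ev (A.act.out (.pair m.rep σ)) fun o =>
      ev (answer mpk IDs ω o.fst l) fun a =>
        match a with
        | .cont _ m' l' => realVal A mpk x f n m' o.snd l'
        | .claim R _ _ _ l' => ev (issue mpk x IDs R) fun d =>
            realVal A mpk x f n (.key d) o.snd l' := by
  rw [realVal, interact_succ hg hX hZ, ev_bind]
  congr 1
  funext o
  rw [ev_bind]
  congr 1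
  funext a
  cases a with
  | cont b m' l' => rfl
  | claim R c z₁ z₂ l' => simp only [ev_bind]; rfl

/-- A run either contains no accepted proof for the target identity, or a first one. -/
theorem realVal_eq (n : ℕ) (m : Msg B) (σ : Data) (l : Sessions B) :
    realVal A mpk x f n m σ l = nuVal A mpk IDs ω f n m σ l + phiVal A mpk x IDs ω f n m σ l := by
  induction n generalizing m σ l with
  | zero => rw [realVal_zero, nuVal, phiVal, add_zero]
  | succ n ih =>
    rw [realVal_succ hg hX hZ, nuVal, phiVal, ← ev_add]
    congr 1
    funext o
    rw [← ev_add]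
    congr 1
    funext a
    cases a with
    | cont b m' l' => exact ih _ _ _
    | claim R c z₁ z₂ l' => simp only [zero_add]

end

theorem look_succ (n : ℕ) (m : Msg B) (σ : Data) (l : Sessions B) (t : Transcript B) :
    look A mpk IDs ω ⟨n + 1, m, σ, l, t⟩ = (A.act.out (.pair m.rep σ)).bind fun o =>
      (answer mpk IDs ω o.fst l).bind fun a =>
        look A mpk IDs ω (lookNext ⟨n + 1, m, σ, l, t⟩ o.snd a) := by
  have hidle : ∀ (n : ℕ) (s : SimState B), s.n = 0 →
      iterP (lookStep A mpk IDs ω) n s = PMF.pure s := by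
    intro n s hs
    induction n with
    | zero => rfl
    | succ n ih => rw [iterP, lookStep, if_pos hs, PMF.pure_bind, ih]
  rw [look, iterP, lookStep, if_neg (Nat.succ_ne_zero n), PMF.bind_bind]
  congr 1
  funext o
  rw [PMF.bind_map]
  congr 1
  funext a
  cases a with
  | cont b m' l' => rfl
  | claim R c z₁ z₂ l' => exact hidle _ _ rfl

theorem look_zero (s : SimState B) (h : s.n = 0) : look A mpk IDs ω s = PMF.pure s := by
  rw [look, h, iterP]

theorem simRun_zero (γ τ : ZMod B.p) (m : Msg B) (σ : Data) (l : Sessions B)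
    (t : Transcript B) : simRun A mpk IDs ω γ τ ⟨0, m, σ, l, t⟩
      = (A.act.out (.pair m.rep σ)).map Data.fst := by
  rw [simRun, iterP, PMF.pure_bind]

theorem simRun_succ (γ τ : ZMod B.p) (n : ℕ) (m : Msg B) (σ : Data) (l : Sessions B)
    (t : Transcript B) : simRun A mpk IDs ω γ τ ⟨n + 1, m, σ, l, t⟩
      = (A.act.out (.pair m.rep σ)).bind fun o => (answer mpk IDs ω o.fst l).bind fun a =>
        (mainNext A mpk IDs ω γ τ ⟨n + 1, m, σ, l, t⟩ o a).bind (simRun A mpk IDs ω γ τ) := by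
  rw [simRun, iterP, mainStep, if_neg (Nat.succ_ne_zero n)]
  simp only [PMF.bind_bind]
  congr 1
  funext o
  congr 1
  funext a
  refine bind_congr_support _ fun s hs => ?_
  have hn : s.n = n := by
    cases a with
    | cont b m' l' =>
      cases b with
      | true =>
        simp only [mainNext, if_true, PMF.mem_support_bind_iff, PMF.support_map] at hs
        obtain ⟨_, -, _, -, rfl⟩ := hs
        rfl
      | false =>
        simp only [mainNext, PMF.mem_support_pure_iff, Bool.false_eq_true, if_false] at hs
        rw [hs]; rfl
    | claim R c z₁ z₂ l' =>
      simp only [mainNext, PMF.support_map] at hs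
      obtain ⟨_, -, rfl⟩ := hs
      rfl
  rw [simRun, hn]

open Classical in
/-- An adversary whose proof is accepted provides a transcript when looking ahead. -/
theorem phiVal_le (hf : ∀ d, f d ≤ 1) {R V : B.G} {c : ZMod B.p} (n : ℕ) (m : Msg B) (σ : Data)
    (l : Sessions B) (t : Transcript B) (hl : l.get IDs = .waiting R V c ∨ l.get IDs = .done) :
    phiVal A mpk x IDs ω f n m σ l ≤ ev (look A mpk IDs ω ⟨n, m, σ, l, t⟩) fun s =>
      if Accepts mpk R V s.tr.1 s.tr.2.1 s.tr.2.2 ∧ s.tr.1 = c then 1 else 0 := by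
  induction n generalizing m σ l with
  | zero => exact zero_le
  | succ n ih =>
    rw [phiVal, look_succ, ev_bind]
    refine ev_mono fun o => ?_
    rw [ev_bind]
    refine ev_mono_support fun a ha => ?_
    have := answer_waiting hl a ha
    cases a with
    | cont b m' l' => exact ih _ _ _ this.2.1
    | claim R' c' z₁ z₂ l' =>
      obtain ⟨-, rfl, rfl, hacc, -⟩ := this
      rw [lookNext, look_zero _ rfl, ev_pure, if_pos ⟨hacc, rfl⟩]
      exact ev_le_one fun d => realVal_le_one hf _ _ _ _

/-- The expectation of `f` on the adversary's output in the simulation, for uniform `τ`. -/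
def simVal (A : Adversary) (mpk : PublicKey B) (IDs ω : ZMod B.p) (f : Data → ℝ≥0∞)
    (γ : ZMod B.p → ZMod B.p) (s : SimState B) : ℝ≥0∞ :=
  ev (PMF.uniformOfFintype (ZMod B.p)) fun τ => ev (simRun A mpk IDs ω (γ τ) τ s) f

section

variable (hg : mpk.g ≠ 1) (hX : mpk.X = pw mpk.g x) (hZ : mpk.hashID IDs = pw mpk.X ω)

include hg hX hZ

/-- After the session for the target identity has ended, the simulation is perfect. -/
theorem simRun_done (γ τ : ZMod B.p) (n : ℕ) (m : Msg B) (σ : Data) (l : Sessions B)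
    (t : Transcript B) (hl : l.get IDs = .done) :
    simRun A mpk IDs ω γ τ ⟨n, m, σ, l, t⟩ = interact A mpk x n m σ l.get := by
  induction n generalizing m σ l with
  | zero =>
    rw [simRun_zero, ← PMF.bind_pure_comp]
    rfl
  | succ n ih =>
    rw [simRun_succ, interact_succ hg hX hZ]
    congr 1
    funext o
    refine bind_congr_support _ fun a ha => ?_
    have := answer_waiting (R := 1) (V := 1) (c := 0) (Or.inr hl) a ha
    cases a with
    | cont b m' l' =>
      obtain ⟨rfl, -, h3⟩ := this
      simp only [mainNext, Bool.false_eq_true, if_false, PMF.pure_bind]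
      exact ih _ _ _ (h3 hl)
    | claim R c z₁ z₂ l' => rw [hl] at this; cases this.1

open Classical in
/-- The simulation after the session for the target identity has been opened: it is faithful as
long as no proof is accepted, and in any case if a second transcript is at hand. -/
theorem le_simVal_waiting (hf : ∀ d, f d ≤ 1) {γ : ZMod B.p → ZMod B.p}
    (hγ : ∀ τ, mpk.Y * pw mpk.h τ = pw mpk.X (γ τ)) {R V : B.G} {c : ZMod B.p} (n : ℕ)
    (m : Msg B) (σ : Data) (l : Sessions B) (t : Transcript B)
    (hl : l.get IDs = .waiting R V c ∨ l.get IDs = .done) :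
    nuVal A mpk IDs ω f n m σ l + phiVal A mpk x IDs ω f n m σ l *
        (if Accepts mpk R V t.1 t.2.1 t.2.2 ∧ t.1 ≠ c then 1 else 0)
      ≤ simVal A mpk IDs ω f γ ⟨n, m, σ, l, t⟩ + (B.p : ℝ≥0∞)⁻¹ := by
  set b : ℝ≥0∞ := if Accepts mpk R V t.1 t.2.1 t.2.2 ∧ t.1 ≠ c then 1 else 0 with hb
  induction n generalizing m σ l with
  | zero =>
    simp only [simVal, nuVal, phiVal, simRun_zero, ev_map, ev_const, zero_mul, add_zero]
    exact le_self_add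
  | succ n ih =>
    simp only [simVal, simRun_succ, ev_bind]
    rw [ev_comm, nuVal, phiVal, ← ev_mul_right, ← ev_add]
    refine (ev_mono fun o => ?_).trans ((ev_add _ _ fun _ => (B.p : ℝ≥0∞)⁻¹).le.trans
      (add_le_add_right (ev_const _ _).le _))
    rw [ev_comm, ← ev_mul_right, ← ev_add]
    refine (ev_mono_support fun a ha => ?_).trans ((ev_add _ _ fun _ => (B.p : ℝ≥0∞)⁻¹).le.trans
      (add_le_add_right (ev_const _ _).le _))
    have hw := answer_waiting hl a ha
    cases a with
    | cont o' m' l' =>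
      obtain ⟨rfl, h2, -⟩ := hw
      simp only [mainNext, Bool.false_eq_true, if_false, ev_pure]
      exact ih _ _ _ h2
    | claim R' c' z₁ z₂ l' =>
      obtain ⟨-, rfl, rfl, hacc, hdone⟩ := hw
      simp only [mainNext, ev_map, zero_add]
      by_cases hgood : Accepts mpk R' V t.1 t.2.1 t.2.2 ∧ t.1 ≠ c'
      · rw [hb, if_pos hgood, mul_one]
        refine (ev_issue_le hg hX hZ hγ (u := (c', z₁, z₂)) hacc hgood.1 hgood.2
          (fun d => realVal A mpk x f n (.key d) o.snd l')
          fun d => realVal_le_one hf _ _ _ _).trans (le_of_eq ?_)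
        congr 2
        funext τ
        congr 1
        funext d
        rw [simRun_done hg hX hZ _ _ _ _ _ _ _ hdone]
        rfl
      · rw [hb, if_neg hgood, mul_zero]
        exact zero_le

end

end Rewinding

section Rewinding

variable {B : BilinearGroup} {A : Adversary} {mpk : PublicKey B} {x : (ZMod B.p)ˣ}
  {IDs ω : ZMod B.p} {f : Data → ℝ≥0∞}

open Classical in
theorem ev_uniform_single (c : ZMod B.p) :
    ev (PMF.uniformOfFintype (ZMod B.p)) (fun a => if a = c then 1 else 0)
      = (B.p : ℝ≥0∞)⁻¹ := by
  have h := apply_eq_ev (PMF.uniformOfFintype (ZMod B.p)) c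
  rw [PMF.uniformOfFintype_apply, ZMod.card] at h
  convert h.symm

/-- The inequality `2 s Φ ≤ Φ² + s²` between the arithmetic and the geometric mean, with an
additional summand `N` to which no loss applies. -/
theorem two_mul_le_of_le_one {s N Φ : ℝ≥0∞} (hs : 2 * s ≤ 1) :
    2 * s * (N + Φ) ≤ N + Φ * Φ + s * s := by
  have h1 : 2 * s * Φ ≤ Φ * Φ + s * s := by
    rcases le_total s Φ with h | h <;> obtain ⟨d, rfl⟩ := exists_add_of_le h
    · calc 2 * s * (s + d) ≤ 2 * s * (s + d) + d * d := le_self_add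
        _ = _ := by ring
    · calc 2 * (Φ + d) * Φ ≤ 2 * (Φ + d) * Φ + d * d := le_self_add
        _ = _ := by ring
  calc 2 * s * (N + Φ) = 2 * s * N + 2 * s * Φ := by ring
    _ ≤ 1 * N + (Φ * Φ + s * s) := by gcongr
    _ = _ := by ring

/-- The quadratic loss of rewinding, in the linear form that is stable under averaging: with `s`
chosen as half of the left-hand expectation it says that the simulation retains about three
quarters of the square of what happens in the real game. When the session for the target identity
is opened, the parts `N` and `Φ` of the real expectation (no accepted proof, accepted proof)
compare with `N + Φ * Φ`, since looking ahead yields a second transcript with probability at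
least `Φ`, up to collisions of challenges. -/
theorem realVal_le_simVal (hg : mpk.g ≠ 1) (hX : mpk.X = pw mpk.g x)
    (hZ : mpk.hashID IDs = pw mpk.X ω) (hf : ∀ d, f d ≤ 1) {γ : ZMod B.p → ZMod B.p}
    (hγ : ∀ τ, mpk.Y * pw mpk.h τ = pw mpk.X (γ τ)) {s : ℝ≥0∞} (hs : 2 * s ≤ 1) (n : ℕ)
    (m : Msg B) (σ : Data) (l : Sessions B) (t : Transcript B) (hl : l.get IDs = .fresh) :
    2 * s * realVal A mpk x f n m σ l
      ≤ simVal A mpk IDs ω f γ ⟨n, m, σ, l, t⟩ + (s * s + 2 * (B.p : ℝ≥0∞)⁻¹) := by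
  classical
  set E : ℝ≥0∞ := s * s + 2 * (B.p : ℝ≥0∞)⁻¹ with hE
  induction n generalizing m σ l t with
  | zero =>
    simp only [simVal, realVal_zero, simRun_zero, ev_map, ev_const]
    exact (mul_le_of_le_one_left zero_le hs).trans le_self_add
  | succ n ih =>
    simp only [simVal, simRun_succ, ev_bind]
    rw [ev_comm, realVal_succ hg hX hZ, ← ev_mul_left]
    refine (ev_mono fun o => ?_).trans ((ev_add _ _ fun _ => E).le.trans
      (add_le_add_right (ev_const _ _).le _))
    rw [ev_comm]
    rcases answer_fresh (mpk := mpk) (IDs := IDs) (ω := ω) (q := o.fst) hl with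
      ⟨R, V, hopen⟩ | hcont
    · set l' : ZMod B.p → Sessions B := fun c => (IDs, .waiting R V c) :: l with hl'
      have hw : ∀ c, (l' c).get IDs = .waiting R V c ∨ (l' c).get IDs = .done := fun c =>
        Or.inl (by simp [hl', Sessions.get])
      -- the distribution of the transcript obtained by looking ahead
      set Lk : PMF (SimState B) := (PMF.uniformOfFintype (ZMod B.p)).bind fun c =>
        look A mpk IDs ω ⟨n, .challenge c, o.snd, l' c, t⟩ with hLk
      set ν : ZMod B.p → ℝ≥0∞ := fun c =>
        nuVal A mpk IDs ω f n (.challenge c) o.snd (l' c) with hν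
      set φ : ZMod B.p → ℝ≥0∞ := fun c =>
        phiVal A mpk x IDs ω f n (.challenge c) o.snd (l' c) with hφ
      set good : ZMod B.p → Transcript B → ℝ≥0∞ := fun c u =>
        if Accepts mpk R V u.1 u.2.1 u.2.2 ∧ u.1 ≠ c then 1 else 0 with hgood
      set N := ev (PMF.uniformOfFintype (ZMod B.p)) ν
      set Φ := ev (PMF.uniformOfFintype (ZMod B.p)) φ
      have hΦ1 : Φ ≤ 1 := ev_le_one fun c => by
        refine le_trans ?_ (realVal_le_one (A := A) (mpk := mpk) (x := x) hf n (.challenge c)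
          o.snd (l' c))
        rw [realVal_eq hg hX hZ]
        exact le_add_self
      have hΦ : ∀ c, Φ ≤ ev Lk (fun s' => good c s'.tr) + (B.p : ℝ≥0∞)⁻¹ := by
        intro c
        rw [hLk, ev_bind, ← ev_uniform_single c, ← ev_add]
        refine ev_mono fun c₂ => (phiVal_le hf n _ _ _ t (hw c₂)).trans ?_
        rw [← ev_const (look A mpk IDs ω ⟨n, .challenge c₂, o.snd, l' c₂, t⟩)
          (if c₂ = c then 1 else 0), ← ev_add]
        refine ev_mono fun s' => ?_
        by_cases h1 : Accepts mpk R V s'.tr.1 s'.tr.2.1 s'.tr.2.2 ∧ s'.tr.1 = c₂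
        · by_cases h2 : c₂ = c
          · rw [if_pos h1, if_pos h2]; exact le_add_self
          · rw [if_pos h1, if_neg h2, hgood, add_zero]
            simp only
            rw [if_pos ⟨h1.1, by rw [h1.2]; exact h2⟩]
        · rw [if_neg h1]; exact zero_le
      have hsim : ev (PMF.uniformOfFintype (ZMod B.p)) (fun c =>
            ν c + φ c * ev Lk fun s' => good c s'.tr)
          ≤ ev (answer mpk IDs ω o.fst l) (fun a => ev (PMF.uniformOfFintype (ZMod B.p))
            fun τ => ev (mainNext A mpk IDs ω (γ τ) τ ⟨n + 1, m, σ, l, t⟩ o a)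
              fun s' => ev (simRun A mpk IDs ω (γ τ) τ s') f) + (B.p : ℝ≥0∞)⁻¹ := by
        rw [hopen, ev_map]
        refine (ev_mono fun c => ?_).trans ((ev_add _ _ fun _ => (B.p : ℝ≥0∞)⁻¹).le.trans
          (add_le_add_right (ev_const _ _).le _))
        have hL : (answer mpk IDs ω o.fst l).bind (fun a =>
            (look A mpk IDs ω (lookNext ⟨n + 1, m, σ, l, t⟩ o.snd a)).map fun s' : SimState B =>
              (⟨n, .challenge c, o.snd, l' c, s'.tr⟩ : SimState B))
            = Lk.map fun s' : SimState B => ⟨n, .challenge c, o.snd, l' c, s'.tr⟩ := by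
          rw [hopen, PMF.bind_map, hLk, PMF.map_bind]
          rfl
        simp only [mainNext, if_true, Nat.add_sub_cancel]
        rw [hL]
        simp only [ev_map]
        rw [ev_comm, ← ev_mul_left, ← ev_const Lk (ν c), ← ev_add,
          ← ev_const Lk (B.p : ℝ≥0∞)⁻¹, ← ev_add]
        exact ev_mono fun s' => le_simVal_waiting hg hX hZ hf hγ n _ _ _ s'.tr (hw c)
      have hreal : (ev (answer mpk IDs ω o.fst l) fun a =>
          match a with
          | .cont _ m' l' => realVal A mpk x f n m' o.snd l'
          | .claim R _ _ _ l' => ev (issue mpk x IDs R) fun d =>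
              realVal A mpk x f n (.key d) o.snd l') = N + Φ := by
        rw [hopen, ev_map, ← ev_add]
        congr 1
        funext c
        exact realVal_eq hg hX hZ _ _ _ _
      refine (mul_le_mul_right hreal.le _).trans ?_
      have hN : N + Φ * Φ ≤ ev (PMF.uniformOfFintype (ZMod B.p)) (fun c =>
          ν c + φ c * ev Lk fun s' => good c s'.tr) + (B.p : ℝ≥0∞)⁻¹ := by
        have h1 : Φ * Φ ≤ ev (PMF.uniformOfFintype (ZMod B.p)) (fun c =>
            φ c * ev Lk fun s' => good c s'.tr) + (B.p : ℝ≥0∞)⁻¹ := by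
          calc Φ * Φ = ev (PMF.uniformOfFintype (ZMod B.p)) (fun c => φ c * Φ) :=
                (ev_mul_right _ _ _).symm
            _ ≤ ev (PMF.uniformOfFintype (ZMod B.p)) (fun c =>
                φ c * ev Lk (fun s' => good c s'.tr) + φ c * (B.p : ℝ≥0∞)⁻¹) :=
                ev_mono fun c => by rw [← mul_add]; exact mul_le_mul_right (hΦ c) _
            _ = ev (PMF.uniformOfFintype (ZMod B.p)) (fun c =>
                φ c * ev Lk fun s' => good c s'.tr) + Φ * (B.p : ℝ≥0∞)⁻¹ := by
                rw [ev_add, ev_mul_right]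
            _ ≤ _ := by
                gcongr
                exact mul_le_of_le_one_left zero_le hΦ1
        calc N + Φ * Φ ≤ N + (ev (PMF.uniformOfFintype (ZMod B.p)) (fun c =>
              φ c * ev Lk fun s' => good c s'.tr) + (B.p : ℝ≥0∞)⁻¹) := by gcongr
          _ = _ := by rw [ev_add, add_assoc]
      calc 2 * s * (N + Φ) ≤ N + Φ * Φ + s * s := two_mul_le_of_le_one hs
        _ ≤ _ := add_le_add_left (hN.trans (add_le_add_left hsim _)) _
        _ = _ := by rw [hE]; ring
    · rw [← ev_mul_left]
      refine (ev_mono_support fun a ha => ?_).trans ((ev_add _ _ fun _ => E).le.trans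
        (add_le_add_right (ev_const _ _).le _))
      obtain ⟨m', l', rfl, hl'⟩ := hcont a ha
      simp only [mainNext, Bool.false_eq_true, if_false, ev_pure]
      exact ih _ _ _ _ hl'

end Rewinding

/-! ### The distinguisher as a random experiment -/

section Distinguisher

variable {B : BilinearGroup}

/-- The device described by the output `w` of the adversary. -/
def deviceOf (B : BilinearGroup) (A : Adversary) (w : Data) : Device B :=
  fun C => A.decode.out (.pair C.rep w.snd)

/-- The device is run on a ciphertext with first component `C₁`, third component `C₃`, a matching
second component, and a fourth component that the key `d` decrypts to a random message. -/
def query (A : Adversary) (g : B.G) (ω : ZMod B.p) (w : Data) (d : UserKey B) (C₁ : B.G)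
    (C₃ : B.GT) : PMF Bool :=
  (PMF.uniformOfFintype (ZMod B.p)).bind fun z : ZMod B.p =>
    (deviceOf B A w
      { C₁ := C₁, C₂ := pw C₁ ω, C₃ := C₃,
        C₄ := pwT (B.e g g) z * (B.e C₁ d.d₁ / (B.e (pw C₁ ω) d.d₂ * pwT C₃ d.d₃)) }).map
      fun y => decide (y.toNat = B.encGT (pwT (B.e g g) z))

/-- The decision made from the device's success on a well-formed ciphertext, on one with
independent exponents, and on the challenge. -/
def decision (b₁ b₂ b₃ : Bool) : Bool := (b₁ && !b₂ && b₃) || (!b₁ && b₂ && !b₃)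

/-- The test whether the challenge `(C₁, C₃)` is of the form `(X ^ s, e(g, h) ^ s)`. The first two
queries tell on which kind of ciphertext the device is better; a single sample of each suffices,
since the expected difference of the decisions is a square. -/
def test (A : Adversary) (mpk : PublicKey B) (ω : ZMod B.p) (w : Data) (d : UserKey B)
    (C₁ : B.G) (C₃ : B.GT) : PMF Bool :=
  (PMF.uniformOfFintype (ZMod B.p)ˣ).bind fun s : (ZMod B.p)ˣ =>
  (query A mpk.g ω w d (pw mpk.X s) (pwT (B.e mpk.g mpk.h) s)).bind fun b₁ =>
  (PMF.uniformOfFintype (ZMod B.p)ˣ).bind fun s : (ZMod B.p)ˣ =>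
  (PMF.uniformOfFintype (ZMod B.p)ˣ).bind fun s' : (ZMod B.p)ˣ =>
  (query A mpk.g ω w d (pw mpk.X s) (pwT (B.e mpk.g mpk.h) s')).bind fun b₂ =>
  (query A mpk.g ω w d C₁ C₃).map fun b₃ => decision b₁ b₂ b₃

/-- The public key with `X = g ^ c` and `h = g ^ b` taken from the problem instance. -/
def simPK (g X h : B.G) (IDs γ τ ω : ZMod B.p) : PublicKey B where
  g := g
  X := X
  Y := pw X γ * pw h (-τ)
  Z := pw g (-IDs) * pw X ω
  h := h

open Classical in
/-- The end of the experiment. -/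
def finish (A : Adversary) (mpk : PublicKey B) (IDs ω : ZMod B.p) (C₁ : B.G) (C₃ : B.GT)
    (w : Data) : PMF Bool :=
  match readKey B w.fst with
  | none => PMF.pure false
  | some d => if d.Valid mpk IDs then test A mpk ω w d C₁ C₃ else PMF.pure false

/-- The decision of the distinguisher on the problem instance `(g, g^a, g^b, g^c, T)`. -/
def experiment (A : Adversary) (k : ℕ) (B : BilinearGroup) (g Ta Tb Tc : B.G) (T : B.GT) :
    PMF Bool :=
  (A.choose.out (B.pub k)).bind fun o =>
  (PMF.uniformOfFintype (ZMod B.p)).bind fun γ : ZMod B.p =>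
  (PMF.uniformOfFintype (ZMod B.p)).bind fun τ : ZMod B.p =>
  (PMF.uniformOfFintype (ZMod B.p)).bind fun ω : ZMod B.p =>
  (simRun A (simPK g Tc Tb (B.readZ o.fst) γ τ ω) (B.readZ o.fst) ω γ τ
    ⟨A.rounds.eval k, .mpk (simPK g Tc Tb (B.readZ o.fst) γ τ ω), o.snd, [], 0⟩).bind fun w =>
  finish A (simPK g Tc Tb (B.readZ o.fst) γ τ ω) (B.readZ o.fst) ω Ta T w

end Distinguisher

/-! ### The gap of the device -/

section Gap

variable {B : BilinearGroup}

open Classical in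
/-- One iteration of the tracing algorithm for given exponents. -/
def probeWith (mpk : PublicKey B) (ID : ZMod B.p) (d : UserKey B) (D : Device B)
    (s s' : ZMod B.p) : PMF Bool :=
  (PMF.uniformOfFintype B.GT).bind fun m =>
    (D { C₁ := pw mpk.X s, C₂ := pw (mpk.hashID ID) s, C₃ := pwT (B.e mpk.g mpk.h) s',
         C₄ := m * (B.e (pw mpk.X s) d.d₁
          / (B.e (pw (mpk.hashID ID) s) d.d₂ * pwT (pwT (B.e mpk.g mpk.h) s') d.d₃)) }).map
      fun y => decide (y.toNat = B.encGT m)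

/-- The success probability of the device for equal exponents. -/
def equalProb (mpk : PublicKey B) (ID : ZMod B.p) (d : UserKey B) (D : Device B) : ℝ≥0∞ :=
  ev (PMF.uniformOfFintype (ZMod B.p)ˣ) fun s => probeWith mpk ID d D s s true

/-- The success probability of the device for independent exponents. -/
def indepProb (mpk : PublicKey B) (ID : ZMod B.p) (d : UserKey B) (D : Device B) : ℝ≥0∞ :=
  ev (PMF.uniformOfFintype (ZMod B.p)ˣ) fun s =>
    ev (PMF.uniformOfFintype (ZMod B.p)ˣ) fun s' => probeWith mpk ID d D s s' true

/-- The squared difference of two probabilities. The subtraction takes place in the real numbers. -/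
def gapSq (u v : ℝ≥0∞) : ℝ≥0∞ := ENNReal.ofReal ((u.toReal - v.toReal) ^ 2)

open Classical in
/-- What the output `w` of the adversary contributes to the advantage of the distinguisher. -/
def score (A : Adversary) (mpk : PublicKey B) (ID : ZMod B.p) (w : Data) : ℝ≥0∞ :=
  match readKey B w.fst with
  | none => 0
  | some d => if d.Valid mpk ID then
      gapSq (equalProb mpk ID d (deviceOf B A w)) (indepProb mpk ID d (deviceOf B A w)) else 0

theorem pmf_bool (μ : PMF Bool) : μ true + μ false = 1 := by
  have := μ.tsum_coe
  rw [tsum_fintype] at this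
  simpa using this

theorem ev_bool (μ : PMF Bool) (f : Bool → ℝ≥0∞) :
    ev μ f = μ true * f true + μ false * f false := by
  rw [ev, tsum_fintype]
  simp

theorem bind_apply_ev {α β : Type*} (μ : PMF α) (ν : α → PMF β) (b : β) :
    (μ.bind ν) b = ev μ fun a => ν a b := by
  rw [PMF.bind_apply]; rfl

theorem ev_pmf_bool {α : Type*} (μ : PMF α) (ν : α → PMF Bool) :
    ev μ (fun a => ν a true) + ev μ (fun a => ν a false) = 1 := by
  rw [← ev_add]
  simp only [pmf_bool, ev_const]

theorem gapSq_le_one {u v : ℝ≥0∞} (hu : u ≤ 1) (hv : v ≤ 1) : gapSq u v ≤ 1 := by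
  have hu' : u.toReal ≤ 1 := ENNReal.toReal_mono ENNReal.one_ne_top hu
  have hv' : v.toReal ≤ 1 := ENNReal.toReal_mono ENNReal.one_ne_top hv
  have hu0 : 0 ≤ u.toReal := ENNReal.toReal_nonneg
  have hv0 : 0 ≤ v.toReal := ENNReal.toReal_nonneg
  rw [gapSq, ← ENNReal.ofReal_one]
  exact ENNReal.ofReal_le_ofReal (by nlinarith)

theorem equalProb_le_one (mpk : PublicKey B) (ID : ZMod B.p) (d : UserKey B) (D : Device B) :
    equalProb mpk ID d D ≤ 1 := ev_le_one fun _ => PMF.coe_le_one _ _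

theorem indepProb_le_one (mpk : PublicKey B) (ID : ZMod B.p) (d : UserKey B) (D : Device B) :
    indepProb mpk ID d D ≤ 1 := ev_le_one fun _ => ev_le_one fun _ => PMF.coe_le_one _ _

theorem score_le_one (A : Adversary) (mpk : PublicKey B) (ID : ZMod B.p) (w : Data) :
    score A mpk ID w ≤ 1 := by
  unfold score
  split
  · exact zero_le
  · split_ifs
    · exact gapSq_le_one (equalProb_le_one _ _ _ _) (indepProb_le_one _ _ _ _)
    · exact zero_le

theorem e_self_ne_one {g : B.G} (hg : g ≠ 1) : B.e g g ≠ 1 := B.e_ne_one g g hg hg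

theorem query_eq {A : Adversary} {mpk : PublicKey B} {IDs ω : ZMod B.p} (hg : mpk.g ≠ 1)
    (hZ : mpk.hashID IDs = pw mpk.X ω) (w : Data) (d : UserKey B) (s s' : ZMod B.p) :
    query A mpk.g ω w d (pw mpk.X s) (pwT (B.e mpk.g mpk.h) s')
      = probeWith mpk IDs d (deviceOf B A w) s s' := by
  have h2 : pw (pw mpk.X s) ω = pw (mpk.hashID IDs) s := by
    rw [hZ, ← pw_mul, ← pw_mul, mul_comm]
  rw [query, probeWith, ← map_uniform_equiv (pwTEquiv (e_self_ne_one hg)), PMF.bind_map, h2]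
  rfl

/-- The two challenge distributions are told apart with the squared gap of the device as
advantage. -/
theorem decision_gap {u u' v v' : ℝ≥0∞} (hu : u + u' = 1) (hv : v + v' = 1) :
    u * v' * u + u' * v * u' = u * v' * v + u' * v * v' + gapSq u v := by
  have hfin : ∀ {a b : ℝ≥0∞}, a + b = 1 → a ≠ ⊤ ∧ b ≠ ⊤ := by
    intro a b h
    constructor <;> rintro rfl <;> simp at h
  obtain ⟨h1, h2⟩ := hfin hu
  obtain ⟨h3, h4⟩ := hfin hv
  have hur : u'.toReal = 1 - u.toReal := by
    have := congrArg ENNReal.toReal hu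
    rw [ENNReal.toReal_add h1 h2, ENNReal.toReal_one] at this
    linarith
  have hvr : v'.toReal = 1 - v.toReal := by
    have := congrArg ENNReal.toReal hv
    rw [ENNReal.toReal_add h3 h4, ENNReal.toReal_one] at this
    linarith
  have hm : ∀ {a b c : ℝ≥0∞}, a ≠ ⊤ → b ≠ ⊤ → c ≠ ⊤ → a * b * c ≠ ⊤ := fun ha hb hc =>
    ENNReal.mul_ne_top (ENNReal.mul_ne_top ha hb) hc
  have hs : u * v' * v + u' * v * v' ≠ ⊤ :=
    ENNReal.add_ne_top.2 ⟨hm h1 h4 h3, hm h2 h3 h4⟩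
  unfold gapSq
  rw [← ENNReal.toReal_eq_toReal_iff' (ENNReal.add_ne_top.2 ⟨hm h1 h4 h1, hm h2 h3 h2⟩)
    (ENNReal.add_ne_top.2 ⟨hs, ENNReal.ofReal_ne_top⟩),
    ENNReal.toReal_add hs ENNReal.ofReal_ne_top,
    ENNReal.toReal_add (hm h1 h4 h1) (hm h2 h3 h2), ENNReal.toReal_add (hm h1 h4 h3) (hm h2 h3 h4),
    ENNReal.toReal_ofReal (sq_nonneg _)]
  simp only [ENNReal.toReal_mul, hur, hvr]
  ring

theorem test_true {A : Adversary} {mpk : PublicKey B} {IDs ω : ZMod B.p} (hg : mpk.g ≠ 1)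
    (hZ : mpk.hashID IDs = pw mpk.X ω) (w : Data) (d : UserKey B) :
    ∃ u' v', equalProb mpk IDs d (deviceOf B A w) + u' = 1 ∧
      indepProb mpk IDs d (deviceOf B A w) + v' = 1 ∧
      ∀ C₁ C₃, test A mpk ω w d C₁ C₃ true
        = equalProb mpk IDs d (deviceOf B A w) * v' * query A mpk.g ω w d C₁ C₃ true
          + u' * indepProb mpk IDs d (deviceOf B A w) * query A mpk.g ω w d C₁ C₃ false := by
  set D := deviceOf B A w
  set u := equalProb mpk IDs d D with hu
  set v := indepProb mpk IDs d D with hv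
  refine ⟨ev (PMF.uniformOfFintype (ZMod B.p)ˣ) fun s => probeWith mpk IDs d D s s false,
    ev (PMF.uniformOfFintype (ZMod B.p)ˣ) fun s =>
      ev (PMF.uniformOfFintype (ZMod B.p)ˣ) fun s' => probeWith mpk IDs d D s s' false,
    ev_pmf_bool _ _, ?_, fun C₁ C₃ => ?_⟩
  · rw [hv, indepProb, ← ev_add]
    simp only [ev_pmf_bool, ev_const]
  · have hq : ∀ (q : PMF Bool) (b₁ b₂ : Bool), (q.map fun b₃ => decision b₁ b₂ b₃) true
        = (if b₁ = true ∧ b₂ = false then q true else 0)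
          + if b₁ = false ∧ b₂ = true then q false else 0 := by
      intro q b₁ b₂
      rw [apply_eq_ev, ev_map, ev_bool]
      cases b₁ <;> cases b₂ <;> simp [decision]
    simp only [test, bind_apply_ev, hq, query_eq (IDs := IDs) hg hZ]
    simp only [ev_bool]
    simp only [Bool.true_eq_false, Bool.false_eq_true, and_false, and_true, and_self, if_true,
      if_false, add_zero, zero_add, mul_zero]
    rw [ev_add]
    simp only [ev_mul_right]
    rw [hu, hv, equalProb, indepProb]
    ring

/-- The test tells well-formed challenges from independent ones. -/
theorem ev_test {A : Adversary} {mpk : PublicKey B} {IDs ω : ZMod B.p} {b c : (ZMod B.p)ˣ}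
    (hg : mpk.g ≠ 1) (hX : mpk.X = pw mpk.g c) (hh : mpk.h = pw mpk.g b)
    (hZ : mpk.hashID IDs = pw mpk.X ω) (w : Data) (d : UserKey B) :
    (ev (PMF.uniformOfFintype (ZMod B.p)ˣ) fun a => test A mpk ω w d (pw mpk.g a)
        (pwT (B.e mpk.g mpk.g) ((a * b / c : (ZMod B.p)ˣ) : ZMod B.p)) true)
      = (ev (PMF.uniformOfFintype (ZMod B.p)ˣ) fun a =>
          ev (PMF.uniformOfFintype (ZMod B.p)ˣ) fun z =>
            test A mpk ω w d (pw mpk.g a) (pwT (B.e mpk.g mpk.g) z) true)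
        + gapSq (equalProb mpk IDs d (deviceOf B A w)) (indepProb mpk IDs d (deviceOf B A w)) := by
  obtain ⟨u', v', hu, hv, ht⟩ := test_true (A := A) hg hZ w d
  have hc : (c : ZMod B.p) ≠ 0 := c.ne_zero
  have hb : (b : ZMod B.p) ≠ 0 := b.ne_zero
  have hC₁ : ∀ a : (ZMod B.p)ˣ, pw mpk.g a = pw mpk.X ((a * c⁻¹ : (ZMod B.p)ˣ) : ZMod B.p) := by
    intro a
    rw [hX, ← pw_mul, Units.val_mul, Units.val_inv_eq_inv_val]
    congr 1
    field_simp
  have hreal : ∀ a : (ZMod B.p)ˣ, query A mpk.g ω w d (pw mpk.g a)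
      (pwT (B.e mpk.g mpk.g) ((a * b / c : (ZMod B.p)ˣ) : ZMod B.p))
      = probeWith mpk IDs d (deviceOf B A w) ((a * c⁻¹ : (ZMod B.p)ˣ) : ZMod B.p)
        ((a * c⁻¹ : (ZMod B.p)ˣ) : ZMod B.p) := by
    intro a
    rw [hC₁ a, ← query_eq hg hZ, hh, e_pw_right, ← pwT_mul, Units.val_mul,
      Units.val_inv_eq_inv_val, div_eq_mul_inv, Units.val_mul, Units.val_mul,
      Units.val_inv_eq_inv_val]
    congr 2
    ring
  have hrand : ∀ a z : (ZMod B.p)ˣ, query A mpk.g ω w d (pw mpk.g a)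
      (pwT (B.e mpk.g mpk.g) z)
      = probeWith mpk IDs d (deviceOf B A w) ((a * c⁻¹ : (ZMod B.p)ˣ) : ZMod B.p)
        ((z * b⁻¹ : (ZMod B.p)ˣ) : ZMod B.p) := by
    intro a z
    rw [hC₁ a, ← query_eq hg hZ, hh, e_pw_right, ← pwT_mul, Units.val_mul, Units.val_mul,
      Units.val_inv_eq_inv_val, Units.val_inv_eq_inv_val]
    congr 2
    field_simp
  set D := deviceOf B A w
  have hr : ∀ y, (ev (PMF.uniformOfFintype (ZMod B.p)ˣ) fun a =>
      query A mpk.g ω w d (pw mpk.g a)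
        (pwT (B.e mpk.g mpk.g) ((a * b / c : (ZMod B.p)ˣ) : ZMod B.p)) y)
      = ev (PMF.uniformOfFintype (ZMod B.p)ˣ) fun s => probeWith mpk IDs d D s s y := by
    intro y
    simp only [hreal]
    exact ev_uniform_equiv (Equiv.mulRight c⁻¹)
      (fun s : (ZMod B.p)ˣ => probeWith mpk IDs d D s s y)
  have hi : ∀ y, (ev (PMF.uniformOfFintype (ZMod B.p)ˣ) fun a =>
      ev (PMF.uniformOfFintype (ZMod B.p)ˣ) fun z =>
        query A mpk.g ω w d (pw mpk.g a) (pwT (B.e mpk.g mpk.g) z) y)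
      = ev (PMF.uniformOfFintype (ZMod B.p)ˣ) fun s =>
        ev (PMF.uniformOfFintype (ZMod B.p)ˣ) fun s' => probeWith mpk IDs d D s s' y := by
    intro y
    simp only [hrand]
    refine Eq.trans ?_ (ev_uniform_equiv (Equiv.mulRight c⁻¹) fun s : (ZMod B.p)ˣ =>
      ev (PMF.uniformOfFintype (ZMod B.p)ˣ) fun s' : (ZMod B.p)ˣ =>
        probeWith mpk IDs d D s s' y)
    congr 1
    funext a
    exact ev_uniform_equiv (Equiv.mulRight b⁻¹)
      (fun s : (ZMod B.p)ˣ => probeWith mpk IDs d D ((a * c⁻¹ : (ZMod B.p)ˣ) : ZMod B.p) s y)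
  have hu' : u' = ev (PMF.uniformOfFintype (ZMod B.p)ˣ) fun s => probeWith mpk IDs d D s s false := by
    have h := ev_pmf_bool (PMF.uniformOfFintype (ZMod B.p)ˣ) fun s => probeWith mpk IDs d D s s
    rw [← hu] at h
    exact ((ENNReal.add_right_inj (ne_top_of_le_ne_top ENNReal.one_ne_top
      (equalProb_le_one mpk IDs d D))).1 h).symm
  have hv' : v' = ev (PMF.uniformOfFintype (ZMod B.p)ˣ) fun s =>
      ev (PMF.uniformOfFintype (ZMod B.p)ˣ) fun s' => probeWith mpk IDs d D s s' false := by
    have h : indepProb mpk IDs d D + (ev (PMF.uniformOfFintype (ZMod B.p)ˣ) fun s =>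
        ev (PMF.uniformOfFintype (ZMod B.p)ˣ) fun s' => probeWith mpk IDs d D s s' false) = 1 := by
      rw [indepProb, ← ev_add]
      simp only [ev_pmf_bool, ev_const]
    rw [← hv] at h
    exact ((ENNReal.add_right_inj (ne_top_of_le_ne_top ENNReal.one_ne_top
      (indepProb_le_one mpk IDs d D))).1 h).symm
  simp only [ht]
  rw [ev_add, ev_mul_left, ev_mul_left, hr, hr, ← hu', ← equalProb]
  simp only [ev_add, ev_mul_left]
  rw [hi, hi, ← hv', ← indepProb]
  exact decision_gap hu hv

end Gap

/-! ### Comparison of the simulation with the game -/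

section Compare

/-- The expected squared gap of the device in the simulation. It is the advantage of the
distinguisher, see `mdbdhAdvantage_eq`. -/
def simScore (gen : GroupGen) (A : Adversary) (k : ℕ) : ℝ≥0∞ :=
  ev (gen.sample k) fun B =>
  ev (PMF.uniformOfFintype {g : B.G // g ≠ 1}) fun g =>
  ev (PMF.uniformOfFintype (ZMod B.p)ˣ) fun b =>
  ev (PMF.uniformOfFintype (ZMod B.p)ˣ) fun c =>
  ev (A.choose.out (B.pub k)) fun o =>
  ev (PMF.uniformOfFintype (ZMod B.p)) fun γ =>
  ev (PMF.uniformOfFintype (ZMod B.p)) fun τ =>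
  ev (PMF.uniformOfFintype (ZMod B.p)) fun ω =>
  ev (simRun A (simPK g.1 (pw g.1 c) (pw g.1 b) (B.readZ o.fst) γ τ ω) (B.readZ o.fst) ω γ τ
    ⟨A.rounds.eval k, .mpk (simPK g.1 (pw g.1 c) (pw g.1 b) (B.readZ o.fst) γ τ ω), o.snd, [], 0⟩)
    (score A (simPK g.1 (pw g.1 c) (pw g.1 b) (B.readZ o.fst) γ τ ω) (B.readZ o.fst))

/-- The expected squared gap of the device in the game. -/
def realScore (gen : GroupGen) (A : Adversary) (k : ℕ) : ℝ≥0∞ :=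
  ev (gen.sample k) fun B =>
  ev (A.choose.out (B.pub k)) fun o =>
  ev (setup B) fun keys =>
  ev (interact A keys.1 keys.2 (A.rounds.eval k) (.mpk keys.1) o.snd fun _ => .fresh)
    (score A keys.1 (B.readZ o.fst))

variable {B : BilinearGroup}

theorem simPK_hash (g X h : B.G) (IDs γ τ ω : ZMod B.p) :
    (simPK g X h IDs γ τ ω).hashID IDs = pw X ω := by
  rw [PublicKey.hashID, simPK, ← mul_assoc, ← pw_add, add_neg_cancel, pw_zero, one_mul]

theorem ev_finish {A : Adversary} {mpk : PublicKey B} {IDs ω : ZMod B.p} {b c : (ZMod B.p)ˣ}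
    (hg : mpk.g ≠ 1) (hX : mpk.X = pw mpk.g c) (hh : mpk.h = pw mpk.g b)
    (hZ : mpk.hashID IDs = pw mpk.X ω) (w : Data) :
    (ev (PMF.uniformOfFintype (ZMod B.p)ˣ) fun a => finish A mpk IDs ω (pw mpk.g a)
        (pwT (B.e mpk.g mpk.g) ((a * b / c : (ZMod B.p)ˣ) : ZMod B.p)) w true)
      = (ev (PMF.uniformOfFintype (ZMod B.p)ˣ) fun a =>
          ev (PMF.uniformOfFintype (ZMod B.p)ˣ) fun z =>
            finish A mpk IDs ω (pw mpk.g a) (pwT (B.e mpk.g mpk.g) z) w true)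
        + score A mpk IDs w := by
  unfold finish score
  cases hk : readKey B w.fst with
  | none => simp [ev_const]
  | some d =>
    by_cases hd : d.Valid mpk IDs
    · simp only [hd, if_true]
      exact ev_test hg hX hh hZ w d
    · simp [hd, ev_const]

/-- An identity between expectations over challenges is preserved by averaging over the random
choices that precede the challenge in the experiment. -/
theorem ev_swap_add {α β δ : Type*} {μ : PMF α} {ν : PMF β} (π : PMF δ)
    {F : α → δ → ℝ≥0∞} {G : α → β → δ → ℝ≥0∞} {H : δ → ℝ≥0∞}
    (h : ∀ d, ev μ (fun a => F a d) = ev μ (fun a => ev ν fun b => G a b d) + H d) :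
    ev μ (fun a => ev π (F a)) = ev μ (fun a => ev ν fun b => ev π (G a b)) + ev π H := by
  rw [ev_comm]
  simp only [h, ev_add]
  congr 1
  rw [ev_comm]
  congr 1
  funext a
  rw [ev_comm]

theorem ev_experiment (A : Adversary) (k : ℕ) {g : B.G} (hg : g ≠ 1) (b c : (ZMod B.p)ˣ) :
    (ev (PMF.uniformOfFintype (ZMod B.p)ˣ) fun a =>
        experiment A k B g (pw g a) (pw g b) (pw g c)
          (pwT (B.e g g) ((a * b / c : (ZMod B.p)ˣ) : ZMod B.p)) true)
      = (ev (PMF.uniformOfFintype (ZMod B.p)ˣ) fun a =>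
          ev (PMF.uniformOfFintype (ZMod B.p)ˣ) fun z =>
            experiment A k B g (pw g a) (pw g b) (pw g c) (pwT (B.e g g) z) true)
        + ev (A.choose.out (B.pub k)) fun o =>
          ev (PMF.uniformOfFintype (ZMod B.p)) fun γ =>
          ev (PMF.uniformOfFintype (ZMod B.p)) fun τ =>
          ev (PMF.uniformOfFintype (ZMod B.p)) fun ω =>
          ev (simRun A (simPK g (pw g c) (pw g b) (B.readZ o.fst) γ τ ω) (B.readZ o.fst) ω γ τ
            ⟨A.rounds.eval k, .mpk (simPK g (pw g c) (pw g b) (B.readZ o.fst) γ τ ω),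
              o.snd, [], 0⟩)
            (score A (simPK g (pw g c) (pw g b) (B.readZ o.fst) γ τ ω) (B.readZ o.fst)) := by
  simp only [experiment, bind_apply_ev]
  refine ev_swap_add _ fun o => ev_swap_add _ fun γ => ev_swap_add _ fun τ =>
    ev_swap_add _ fun ω => ev_swap_add _ fun w => ?_
  exact ev_finish (mpk := simPK g (pw g c) (pw g b) (B.readZ o.fst) γ τ ω) hg rfl rfl
    (simPK_hash _ _ _ _ _ _ _) w

theorem map_bool_apply (μ : PMF Bool) :
    (μ.map fun b => Data.nat (if b then 1 else 0)) (.nat 1) = μ true := by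
  rw [apply_eq_ev, ev_map, ev_bool]
  simp

/-- A program that carries out the experiment has advantage `simScore`. -/
theorem mdbdhAdvantage_eq {gen : GroupGen} {A : Adversary} {D : Prog} {k : ℕ}
    (hD : ∀ B ∈ (gen.sample k).support, ∀ (g Ta Tb Tc : B.G) (T : B.GT), g ≠ 1 →
      D.out (mdbdhInput k B g Ta Tb Tc T)
        = (experiment A k B g Ta Tb Tc T).map fun b => .nat (if b then 1 else 0)) :
    mdbdhAdvantage gen D k = (simScore gen A k).toReal := by
  have key : mdbdhReal gen D k (.nat 1) = mdbdhRandom gen D k (.nat 1) + simScore gen A k := by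
    simp only [mdbdhReal, mdbdhRandom, pmf_bind_eq, bind_apply_ev, simScore]
    rw [← ev_add]
    refine ev_congr_support fun B hB => ?_
    rw [← ev_add]
    congr 1
    funext g
    simp only [hD B hB _ _ _ _ _ g.2, map_bool_apply]
    rw [ev_comm]
    conv_rhs => rw [ev_comm, ← ev_add]
    congr 1
    funext b
    rw [ev_comm]
    conv_rhs => rw [ev_comm, ← ev_add]
    congr 1
    funext c
    exact ev_experiment A k g.2 b c
  have h1 : mdbdhRandom gen D k (.nat 1) ≠ ⊤ := PMF.apply_ne_top _ _
  have h2 : simScore gen A k ≠ ⊤ := by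
    refine ne_top_of_le_ne_top (PMF.apply_ne_top (mdbdhReal gen D k) (.nat 1)) ?_
    rw [key]; exact le_add_self
  rw [mdbdhAdvantage, key, ENNReal.toReal_add h1 h2, add_sub_cancel_left,
    abs_of_nonneg ENNReal.toReal_nonneg]

/-- Omitting the residue `0` changes an expectation by at most `1 / p`. -/
theorem ev_zmod_le (F : ZMod B.p → ℝ≥0∞) (hF : ∀ a, F a ≤ 1) :
    ev (PMF.uniformOfFintype (ZMod B.p)) F
      ≤ ev (PMF.uniformOfFintype (ZMod B.p)ˣ) (fun a => F a) + (B.p : ℝ≥0∞)⁻¹ := by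
  classical
  rw [ev_uniform, ev_uniform, ZMod.card_units, ZMod.card]
  have hsum : ∑ a, F a ≤ ∑ a : (ZMod B.p)ˣ, F a + 1 := by
    have h := Finset.sum_map (Finset.univ : Finset (ZMod B.p)ˣ)
      ⟨fun a : (ZMod B.p)ˣ => (a : ZMod B.p), Units.val_injective⟩ F
    simp only [Function.Embedding.coeFn_mk] at h
    rw [← h, ← Finset.sum_erase_add _ _ (Finset.mem_univ (0 : ZMod B.p))]
    refine add_le_add (Finset.sum_le_sum_of_subset fun a ha => ?_) (hF 0)
    rw [Finset.mem_map]
    exact ⟨Units.mk0 a (Finset.ne_of_mem_erase ha), Finset.mem_univ _, rfl⟩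
  calc (B.p : ℝ≥0∞)⁻¹ * ∑ a, F a
      ≤ (B.p : ℝ≥0∞)⁻¹ * (∑ a : (ZMod B.p)ˣ, F a + 1) := by gcongr
    _ = (B.p : ℝ≥0∞)⁻¹ * ∑ a : (ZMod B.p)ˣ, F a + (B.p : ℝ≥0∞)⁻¹ := by rw [mul_add, mul_one]
    _ ≤ _ := by
      gcongr
      omega

/-- Averaging `realVal_le_simVal` over the public key: the simulated public key is uniform, up to
`h ≠ 1`, and independent of `τ`. -/
theorem real_le_sim_setup {f : PublicKey B → Data → ℝ≥0∞} (hf : ∀ mpk d, f mpk d ≤ 1)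
    (A : Adversary) (n : ℕ) (σ : Data) (IDs : ZMod B.p) {s : ℝ≥0∞} (hs : 2 * s ≤ 1) :
    2 * s * ev (setup B) (fun keys =>
        ev (interact A keys.1 keys.2 n (.mpk keys.1) σ fun _ => .fresh) (f keys.1))
      ≤ (ev (PMF.uniformOfFintype {g : B.G // g ≠ 1}) fun g =>
          ev (PMF.uniformOfFintype (ZMod B.p)ˣ) fun b =>
          ev (PMF.uniformOfFintype (ZMod B.p)ˣ) fun c =>
          ev (PMF.uniformOfFintype (ZMod B.p)) fun γ =>
          ev (PMF.uniformOfFintype (ZMod B.p)) fun τ =>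
          ev (PMF.uniformOfFintype (ZMod B.p)) fun ω =>
          ev (simRun A (simPK g.1 (pw g.1 c) (pw g.1 b) IDs γ τ ω) IDs ω γ τ
            ⟨n, .mpk (simPK g.1 (pw g.1 c) (pw g.1 b) IDs γ τ ω), σ, [], 0⟩)
            (f (simPK g.1 (pw g.1 c) (pw g.1 b) IDs γ τ ω)))
        + (s * s + 3 * (B.p : ℝ≥0∞)⁻¹) := by
  set E : ℝ≥0∞ := s * s + 2 * (B.p : ℝ≥0∞)⁻¹ with hE
  have hE3 : s * s + 3 * (B.p : ℝ≥0∞)⁻¹ = E + (B.p : ℝ≥0∞)⁻¹ := by rw [hE]; ring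
  simp only [setup, pmf_bind_eq, pmf_pure_eq, ev_bind, ev_pure]
  rw [← ev_mul_left]
  refine (ev_mono fun g => ?_).trans ((ev_add _ _ fun _ => s * s + 3 * (B.p : ℝ≥0∞)⁻¹).le.trans
    (add_le_add_right (ev_const _ _).le _))
  obtain ⟨g, hg⟩ := g
  simp only
  -- the real expectation as a function of the public key
  set V : PublicKey B → (ZMod B.p)ˣ → ℝ≥0∞ := fun mpk x =>
    ev (interact A mpk x n (.mpk mpk) σ fun _ => .fresh) (f mpk) with hV
  have hV1 : ∀ mpk x, V mpk x ≤ 1 := fun mpk x => ev_le_one fun d => hf _ _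
  -- the parameters of the simulation are a bijective image of the public key and `τ`
  have hb : ∀ b c : (ZMod B.p)ˣ,
      2 * s * ev (PMF.uniformOfFintype B.G) (fun Y => ev (PMF.uniformOfFintype B.G) fun Z =>
        V { g := g, X := pw g c, Y := Y, Z := Z, h := pw g b } c)
      ≤ (ev (PMF.uniformOfFintype (ZMod B.p)) fun γ =>
          ev (PMF.uniformOfFintype (ZMod B.p)) fun τ =>
          ev (PMF.uniformOfFintype (ZMod B.p)) fun ω =>
          ev (simRun A (simPK g (pw g c) (pw g b) IDs γ τ ω) IDs ω γ τ
            ⟨n, .mpk (simPK g (pw g c) (pw g b) IDs γ τ ω), σ, [], 0⟩)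
            (f (simPK g (pw g c) (pw g b) IDs γ τ ω))) + E := by
    intro b c
    have hX : pw g (c : ZMod B.p) ≠ 1 := pw_ne_one hg c.ne_zero
    set X := pw g (c : ZMod B.p)
    set h := pw g (b : ZMod B.p)
    have hZ : ∀ F : B.G → ℝ≥0∞, ev (PMF.uniformOfFintype B.G) F
        = ev (PMF.uniformOfFintype (ZMod B.p)) fun ω => F (pw g (-IDs) * pw X ω) := by
      intro F
      exact (ev_uniform_equiv ((pwEquiv hX).trans (Equiv.mulLeft (pw g (-IDs)))) F).symm
    -- the discrete logarithm of `Y * h ^ τ` to the base `X`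
    let γ' : B.G → ZMod B.p → ZMod B.p := fun Y τ => (pwEquiv hX).symm (Y * pw h τ)
    have hγ' : ∀ Y τ, Y * pw h τ = pw X (γ' Y τ) := fun Y τ =>
      ((pwEquiv hX).apply_symm_apply _).symm
    have hY : ∀ F : ZMod B.p → ZMod B.p → ℝ≥0∞,
        (ev (PMF.uniformOfFintype (ZMod B.p)) fun γ =>
          ev (PMF.uniformOfFintype (ZMod B.p)) fun τ => F γ τ)
        = ev (PMF.uniformOfFintype B.G) fun Y =>
          ev (PMF.uniformOfFintype (ZMod B.p)) fun τ => F (γ' Y τ) τ := by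
      intro F
      rw [ev_comm]
      conv_rhs => rw [ev_comm]
      congr 1
      funext τ
      exact (ev_uniform_equiv ((Equiv.mulRight (pw h τ)).trans (pwEquiv hX).symm)
        fun γ => F γ τ).symm
    rw [hY, ← ev_mul_left]
    refine (ev_mono fun Y => ?_).trans ((ev_add _ _ fun _ => E).le.trans
      (add_le_add_right (ev_const _ _).le _))
    rw [hZ, ← ev_mul_left]
    conv_rhs => rw [ev_comm]
    refine (ev_mono fun ω => ?_).trans ((ev_add _ _ fun _ => E).le.trans
      (add_le_add_right (ev_const _ _).le _))
    have hpk : ∀ τ, simPK g X h IDs (γ' Y τ) τ ω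
        = { g := g, X := X, Y := Y, Z := pw g (-IDs) * pw X ω, h := h } := by
      intro τ
      rw [simPK, ← hγ', mul_assoc, ← pw_add, add_neg_cancel, pw_zero, mul_one]
    simp only [hpk]
    refine realVal_le_simVal (mpk := { g := g, X := X, Y := Y, Z := pw g (-IDs) * pw X ω, h := h })
      hg rfl ?_ (hf _) (hγ' Y) hs n _ σ [] 0 rfl
    rw [PublicKey.hashID, ← mul_assoc, ← pw_add, add_neg_cancel, pw_zero, one_mul]
  have hswap : (ev (PMF.uniformOfFintype B.G) fun h => ev (PMF.uniformOfFintype B.G) fun Y =>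
      ev (PMF.uniformOfFintype B.G) fun Z => ev (PMF.uniformOfFintype (ZMod B.p)ˣ) fun x =>
        V { g := g, X := pw g x, Y := Y, Z := Z, h := h } x)
      ≤ (ev (PMF.uniformOfFintype (ZMod B.p)ˣ) fun b =>
        ev (PMF.uniformOfFintype (ZMod B.p)ˣ) fun x => ev (PMF.uniformOfFintype B.G) fun Y =>
        ev (PMF.uniformOfFintype B.G) fun Z =>
          V { g := g, X := pw g x, Y := Y, Z := Z, h := pw g b } x) + (B.p : ℝ≥0∞)⁻¹ := by
    rw [← ev_uniform_equiv (pwEquiv hg)]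
    refine (ev_zmod_le _ fun b => ev_le_one fun Y => ev_le_one fun Z => ev_le_one fun x =>
      hV1 _ _).trans (add_le_add_left (le_of_eq ?_) _)
    congr 1
    funext b
    conv_rhs => rw [ev_comm]
    congr 1
    funext Y
    conv_rhs => rw [ev_comm]
    rfl
  refine (mul_le_mul_right hswap _).trans ?_
  rw [mul_add, hE3, ← add_assoc]
  refine add_le_add ?_ (mul_le_of_le_one_left zero_le hs)
  rw [← ev_mul_left]
  refine (ev_mono fun b => ?_).trans ((ev_add _ _ fun _ => E).le.trans
    (add_le_add_right (ev_const _ _).le _))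
  rw [← ev_mul_left]
  exact (ev_mono fun c => hb b c).trans ((ev_add _ _ fun _ => E).le.trans
    (add_le_add_right (ev_const _ _).le _))

/-- Rewinding costs a square: the choice `s = realScore / 2` bounds the square of `realScore` by a
multiple of `simScore`. -/
theorem realScore_le (gen : GroupGen) (A : Adversary) (k : ℕ) {s : ℝ≥0∞} (hs : 2 * s ≤ 1) :
    2 * s * realScore gen A k ≤ simScore gen A k + (s * s + 3 * ((2 : ℝ≥0∞) ^ k)⁻¹) := by
  rw [realScore, simScore, ← ev_mul_left]
  refine (ev_mono_support fun B hB => ?_).trans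
    ((ev_add _ _ fun _ => s * s + 3 * ((2 : ℝ≥0∞) ^ k)⁻¹).le.trans
    (add_le_add_right (ev_const _ _).le _))
  have hp : (B.p : ℝ≥0∞)⁻¹ ≤ ((2 : ℝ≥0∞) ^ k)⁻¹ := by
    rw [ENNReal.inv_le_inv]
    exact_mod_cast (gen.order_gt k B hB).le
  have hcomm : ∀ F : {g : B.G // g ≠ 1} → (ZMod B.p)ˣ → (ZMod B.p)ˣ → Data → ℝ≥0∞,
      (ev (PMF.uniformOfFintype {g : B.G // g ≠ 1}) fun g =>
        ev (PMF.uniformOfFintype (ZMod B.p)ˣ) fun b =>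
        ev (PMF.uniformOfFintype (ZMod B.p)ˣ) fun c =>
        ev (A.choose.out (B.pub k)) fun o => F g b c o)
      = ev (A.choose.out (B.pub k)) fun o =>
        ev (PMF.uniformOfFintype {g : B.G // g ≠ 1}) fun g =>
        ev (PMF.uniformOfFintype (ZMod B.p)ˣ) fun b =>
        ev (PMF.uniformOfFintype (ZMod B.p)ˣ) fun c => F g b c o := by
    intro F
    conv_rhs => rw [ev_comm]
    congr 1
    funext g
    conv_rhs => rw [ev_comm]
    congr 1
    funext b
    rw [ev_comm]
  rw [hcomm, ← ev_mul_left]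
  refine (ev_mono fun o => ?_).trans
    ((ev_add _ _ fun _ => s * s + 3 * ((2 : ℝ≥0∞) ^ k)⁻¹).le.trans
    (add_le_add_right (ev_const _ _).le _))
  refine (real_le_sim_setup (fun mpk d => score_le_one A mpk (B.readZ o.fst) d) A
    (A.rounds.eval k) o.snd (B.readZ o.fst) hs).trans ?_
  gcongr

end Compare

/-! ### The tracing algorithm -/

section Tracing

variable {B : BilinearGroup}

theorem opens_true {mpk : PublicKey B} {ID : ZMod B.p} {d : UserKey B} (hd : d.Valid mpk ID)
    (D : Device B) : opens mpk ID D true = equalProb mpk ID d D := by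
  have hC₄ : ∀ s : ZMod B.p, B.e (pw mpk.X s) d.d₁
      / (B.e (pw (mpk.hashID ID) s) d.d₂ * pwT (pwT (B.e mpk.g mpk.h) s) d.d₃)
      = pwT (B.e mpk.g mpk.Y) s := by
    intro s
    have h := hd
    rw [UserKey.Valid, e_symm d.d₁, e_symm mpk.Y, e_symm mpk.h] at h
    rw [e_pw_left, e_pw_left, h, mul_pwT, mul_pwT, ← pwT_mul, ← pwT_mul, mul_comm d.d₃ s,
      div_eq_iff_eq_mul, mul_assoc]
    congr 1
    rw [mul_comm]
  have hopens : opens mpk ID D = (PMF.uniformOfFintype B.GT).bind fun m =>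
      (PMF.uniformOfFintype (ZMod B.p)ˣ).bind fun s : (ZMod B.p)ˣ =>
        (D (encryptWith mpk ID m s)).map fun y => decide (y.toNat = B.encGT m) := by
    simp only [opens, encrypt, pmf_bind_eq, pmf_pure_eq, PMF.bind_bind, PMF.pure_bind]
    rfl
  rw [hopens, bind_apply_ev]
  simp only [bind_apply_ev, equalProb, probeWith, hC₄]
  rw [ev_comm]
  rfl

theorem probe_true (mpk : PublicKey B) (ID : ZMod B.p) (d : UserKey B) (D : Device B) :
    probe mpk ID d D true
      = ev (PMF.uniformOfFintype {s : (ZMod B.p)ˣ × (ZMod B.p)ˣ // s.1 ≠ s.2}) fun s =>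
          probeWith mpk ID d D s.1.1 s.1.2 true := by
  simp only [probe, pmf_bind_eq, pmf_pure_eq, bind_apply_ev, probeWith]
  rfl

/-- Independent exponents are rarely equal. -/
theorem ev_indep_le {α : Type*} [Fintype α] [Nonempty α] [Fintype {s : α × α // s.1 ≠ s.2}]
    [Nonempty {s : α × α // s.1 ≠ s.2}] (q : α → α → ℝ≥0∞) (hq : ∀ a b, q a b ≤ 1) :
    (ev (PMF.uniformOfFintype α) fun a => ev (PMF.uniformOfFintype α) fun b => q a b)
      ≤ ev (PMF.uniformOfFintype {s : α × α // s.1 ≠ s.2}) (fun s => q s.1.1 s.1.2)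
        + (Fintype.card α : ℝ≥0∞)⁻¹ := by
  classical
  rw [ev_uniform_prod, ev_uniform, ev_uniform]
  have hcard : Fintype.card {s : α × α // s.1 ≠ s.2} ≤ Fintype.card (α × α) :=
    Fintype.card_subtype_le _
  have hsplit : ∑ s : α × α, q s.1 s.2
      = ∑ s : {s : α × α // s.1 ≠ s.2}, q s.1.1 s.1.2 + ∑ a, q a a := by
    have h1 : ∑ s : {s : α × α // s.1 ≠ s.2}, q s.1.1 s.1.2
        = ∑ s ∈ Finset.univ.filter (fun s : α × α => s.1 ≠ s.2), q s.1 s.2 :=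
      (Finset.sum_subtype _ (fun s => by simp) fun s : α × α => q s.1 s.2).symm
    have h2 : ∑ a, q a a = ∑ s ∈ Finset.univ.filter (fun s : α × α => ¬ s.1 ≠ s.2), q s.1 s.2 := by
      refine Finset.sum_bij (fun a _ => (a, a)) (by simp) (fun a _ b _ h => (Prod.ext_iff.1 h).1)
        (fun s hs => ⟨s.1, Finset.mem_univ _, ?_⟩) fun _ _ => rfl
      have : s.1 = s.2 := by simpa using hs
      exact Prod.ext rfl this
    rw [h1, h2, Finset.sum_filter_add_sum_filter_not]
  have hn0 : (Fintype.card α : ℝ≥0∞) ≠ 0 := by simp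
  have hn1 : (Fintype.card α : ℝ≥0∞) ≠ ⊤ := ENNReal.natCast_ne_top _
  rw [hsplit, mul_add]
  refine add_le_add (mul_le_mul_left (ENNReal.inv_le_inv.2 (by exact_mod_cast hcard)) _) ?_
  calc (Fintype.card (α × α) : ℝ≥0∞)⁻¹ * ∑ a, q a a
      ≤ (Fintype.card (α × α) : ℝ≥0∞)⁻¹ * ∑ _a : α, 1 := by gcongr; exact hq _ _
    _ = (Fintype.card α : ℝ≥0∞)⁻¹ := by
      rw [Fintype.card_prod, Nat.cast_mul, ENNReal.mul_inv (.inl hn0) (.inl hn1)]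
      simp only [Finset.sum_const, Finset.card_univ, nsmul_eq_mul, mul_one]
      rw [mul_assoc, ENNReal.inv_mul_cancel hn0 hn1, mul_one]

theorem indepProb_le (mpk : PublicKey B) (ID : ZMod B.p) (d : UserKey B) (D : Device B) {k : ℕ}
    (hk : 2 ^ k < B.p) :
    indepProb mpk ID d D ≤ probe mpk ID d D true + ((2 : ℝ≥0∞) ^ k)⁻¹ := by
  rw [probe_true, indepProb]
  refine (ev_indep_le (fun s s' : (ZMod B.p)ˣ => probeWith mpk ID d D s s' true)
    fun _ _ => PMF.coe_le_one _ _).trans ?_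
  gcongr
  rw [ZMod.card_units]
  have : 2 ^ k ≤ B.p - 1 := by omega
  exact_mod_cast this

/-- The counter stays `0` if all iterations fail. -/
theorem counter_zero (mpk : PublicKey B) (ID : ZMod B.p) (d : UserKey B) (D : Device B)
    (L : ℕ) : counter mpk ID d D L 0 = (probe mpk ID d D false) ^ L := by
  induction L with
  | zero => simp [counter, pmf_pure_eq]
  | succ L ih =>
    simp only [counter, pmf_bind_eq, pmf_pure_eq, bind_apply_ev, ev_bool, pow_succ, ← ih]
    rw [apply_eq_ev (counter mpk ID d D L) 0, ← ev_mul_right]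
    congr 1
    funext n
    by_cases hn : n = 0
    · simp [hn]
    · have : 0 ≠ n := fun h => hn h.symm
      simp [hn, this]

theorem trace_pkg (k : ℕ) (ε : ℝ) (mpk : PublicKey B) (ID : ZMod B.p) (d : UserKey B)
    (D : Device B) : ((trace k ε mpk ID d D).bind fun v => PMF.pure (decide (v = .pkg))) true
      = (probe mpk ID d D false) ^ ⌈16 * (k : ℝ) / ε⌉₊ := by
  rw [← counter_zero, trace]
  simp only [pmf_bind_eq, pmf_pure_eq, PMF.bind_bind, PMF.pure_bind, bind_apply_ev]
  rw [apply_eq_ev]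
  congr 1
  funext n
  by_cases hn : n = 0 <;> simp [hn]

/-- A device that is useful with a small gap succeeds often in the tracing algorithm, so that it
escapes with small probability only. -/
theorem pow_le_gap {u v δ ε Q : ℝ} {k : ℕ} (hu : u ≤ 1) (hδ : 0 ≤ δ) (hδ1 : δ ≤ 1)
    (hQ : 1 ≤ Q * ε) (hQ0 : 0 < Q) (hεu : ε ≤ u) (hv : v ≤ δ + ((2 : ℝ) ^ k)⁻¹)
    (hk : 4 * Q ≤ 2 ^ k) :
    (1 - δ) ^ ⌈16 * (k : ℝ) / ε⌉₊ ≤ 4 * Q ^ 2 * (u - v) ^ 2 + ((2 : ℝ) ^ k)⁻¹ := by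
  have hε : 0 < ε := by
    by_contra h
    have : Q * ε ≤ 0 := mul_nonpos_of_nonneg_of_nonpos hQ0.le (not_lt.1 h)
    linarith
  have h2k : (0 : ℝ) < ((2 : ℝ) ^ k)⁻¹ := by positivity
  rcases le_or_gt v (u - ε / 2) with h | h
  · have h1 : (1 - δ) ^ ⌈16 * (k : ℝ) / ε⌉₊ ≤ 1 := pow_le_one₀ (by linarith) (by linarith)
    have h2 : Q * ε ≤ 2 * (Q * (u - v)) := by nlinarith
    have h3 : 1 ≤ (2 * (Q * (u - v))) ^ 2 := by nlinarith
    have h4 : (2 * (Q * (u - v))) ^ 2 = 4 * Q ^ 2 * (u - v) ^ 2 := by ring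
    linarith
  · have hsmall : ((2 : ℝ) ^ k)⁻¹ ≤ ε / 4 := by
      have h1 : ((2 : ℝ) ^ k)⁻¹ ≤ (4 * Q)⁻¹ := inv_anti₀ (by positivity) hk
      have h2 : (4 * Q)⁻¹ ≤ ε / 4 := by
        rw [inv_le_iff_one_le_mul₀ (by positivity)]
        linarith
      linarith
    have hδε : ε / 4 ≤ δ := by linarith
    have h1 : 1 - δ ≤ Real.exp (-(ε / 4)) :=
      (by linarith : 1 - δ ≤ 1 - ε / 4).trans (Real.one_sub_le_exp_neg _)
    have h2 : (1 - δ) ^ ⌈16 * (k : ℝ) / ε⌉₊ ≤ Real.exp (-(4 * k)) := by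
      refine (pow_le_pow_left₀ (by linarith) h1 _).trans ?_
      rw [← Real.exp_nat_mul, Real.exp_le_exp]
      have h3 := Nat.le_ceil (16 * (k : ℝ) / ε)
      have h4 : 4 * (k : ℝ) = (16 * k / ε) * (ε / 4) := by field_simp; ring
      have h5 : (16 * k / ε) * (ε / 4) ≤ (⌈16 * (k : ℝ) / ε⌉₊ : ℝ) * (ε / 4) := by gcongr
      linarith
    have h3 : Real.exp (-(4 * (k : ℝ))) ≤ ((2 : ℝ) ^ k)⁻¹ := by
      rw [Real.exp_neg]
      refine inv_anti₀ (by positivity) ?_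
      rw [mul_comm, Real.exp_nat_mul]
      refine pow_le_pow_left₀ (by norm_num) ?_ _
      have := Real.add_one_le_exp (4 : ℝ)
      linarith
    have h4 : 0 ≤ 4 * Q ^ 2 * (u - v) ^ 2 := by positivity
    linarith

/-- The last part of the game, for a given output of the adversary: the tracing algorithm accuses
the PKG of a useful device only if the gap of the device is large. -/
theorem judge_le (A : Adversary) (k : ℕ) {ε : ℝ} {Q : ℕ} (hQ : 1 ≤ (Q : ℝ) * ε)
    (hk : 4 * Q ≤ 2 ^ k) (hp : 2 ^ k < B.p) (mpk : PublicKey B) (ID : ZMod B.p) (w : Data) :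
    judge A k ε mpk ID w true
      ≤ (4 * (Q : ℝ≥0∞) ^ 2) * score A mpk ID w + ((2 : ℝ≥0∞) ^ k)⁻¹ := by
  unfold judge score
  cases hkey : readKey B w.fst with
  | none => simp [pmf_pure_eq]
  | some d =>
    simp only
    split_ifs with h1 h2 h2
    · obtain ⟨hd, hu⟩ := h1
      change ε ≤ ((opens mpk ID (deviceOf B A w)) true).toReal at hu
      change ((trace k ε mpk ID d (deviceOf B A w)).bind
        fun v => PMF.pure (decide (v = .pkg))) true ≤ _
      set D := deviceOf B A w
      rw [opens_true hd] at hu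
      rw [trace_pkg]
      set u := equalProb mpk ID d D
      set v := indepProb mpk ID d D
      have hu1 : u ≤ 1 := equalProb_le_one _ _ _ _
      have hv1 : v ≤ 1 := indepProb_le_one _ _ _ _
      set δ := probe mpk ID d D true with hδ
      have hδ1 : δ ≤ 1 := PMF.coe_le_one _ _
      have hδt : δ ≠ ⊤ := ne_top_of_le_ne_top ENNReal.one_ne_top hδ1
      have h2t : ((2 : ℝ≥0∞) ^ k)⁻¹ ≠ ⊤ := ENNReal.inv_ne_top.2 (by positivity)
      have h2r : (((2 : ℝ≥0∞) ^ k)⁻¹).toReal = ((2 : ℝ) ^ k)⁻¹ := by simp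
      have hfalse : probe mpk ID d D false = ENNReal.ofReal (1 - δ.toReal) := by
        have hs : δ + probe mpk ID d D false = 1 := pmf_bool _
        have ht : probe mpk ID d D false ≠ ⊤ := PMF.apply_ne_top _ _
        have := congrArg ENNReal.toReal hs
        rw [ENNReal.toReal_add hδt ht, ENNReal.toReal_one] at this
        rw [← this, add_sub_cancel_left, ENNReal.ofReal_toReal ht]
      have hδr : δ.toReal ≤ 1 := ENNReal.toReal_mono ENNReal.one_ne_top hδ1
      have hv : v.toReal ≤ δ.toReal + ((2 : ℝ) ^ k)⁻¹ := by
        rw [← h2r, ← ENNReal.toReal_add hδt h2t]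
        exact ENNReal.toReal_mono (ENNReal.add_ne_top.2 ⟨hδt, h2t⟩) (indepProb_le mpk ID d D hp)
      have hQ0 : (0 : ℝ) < Q := by
        rcases Nat.eq_zero_or_pos Q with h | h
        · rw [h] at hQ; norm_num at hQ
        · exact_mod_cast h
      have := pow_le_gap (ENNReal.toReal_mono ENNReal.one_ne_top hu1) ENNReal.toReal_nonneg hδr hQ
        hQ0 hu hv (by exact_mod_cast hk)
      rw [hfalse, ← ENNReal.ofReal_pow (by linarith)]
      refine (ENNReal.ofReal_le_ofReal this).trans (le_of_eq ?_)
      rw [ENNReal.ofReal_add (by positivity) (by positivity), ENNReal.ofReal_mul (by positivity),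
        ← h2r, ENNReal.ofReal_toReal h2t, gapSq]
      congr 2
      rw [ENNReal.ofReal_mul (by norm_num), ENNReal.ofReal_pow (by positivity),
        ENNReal.ofReal_natCast]
      norm_num
    · exact absurd h1.1 h2
    · simp [pmf_pure_eq]
    · simp [pmf_pure_eq]

theorem ev_le_mul_add {α : Type*} (μ : PMF α) {F G : α → ℝ≥0∞} {a b : ℝ≥0∞}
    (h : ∀ x ∈ μ.support, F x ≤ a * G x + b) : ev μ F ≤ a * ev μ G + b := by
  rw [← ev_mul_left]
  exact (ev_mono_support h).trans ((ev_add _ _ fun _ => b).le.trans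
    (add_le_add_right (ev_const _ _).le _))

/-- The winning probability is bounded in terms of the expected squared gap. -/
theorem computeNewKey_le (gen : GroupGen) (A : Adversary) (k : ℕ) {ε : ℝ} {Q : ℕ}
    (hQ : 1 ≤ (Q : ℝ) * ε) (hk : 4 * Q ≤ 2 ^ k) :
    computeNewKey gen A ε k true
      ≤ (4 * (Q : ℝ≥0∞) ^ 2) * realScore gen A k + ((2 : ℝ≥0∞) ^ k)⁻¹ := by
  simp only [computeNewKey, realScore, pmf_bind_eq, bind_apply_ev]
  exact ev_le_mul_add _ fun B hB => ev_le_mul_add _ fun o _ => ev_le_mul_add _ fun keys _ =>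
    ev_le_mul_add _ fun w _ => judge_le A k hQ hk (gen.order_gt k B hB) _ _ w

end Tracing

/-! ### Representations of the states of the simulation -/

section Representation

variable {B : BilinearGroup}

/-- A fresh session is represented by the number that `Data.fst` and `Data.snd` return on
numbers, so that a lookup that runs out of the list yields it. -/
def Session.rep : Session B → Data
  | .fresh => .nat 0
  | .waiting R V c => .pair (repG R) (.pair (repG V) (repZ c))
  | .done => .nat 1

/-- A list is a nested pair, ending in `0`. -/
def Sessions.rep : Sessions B → Data
  | [] => .nat 0
  | (ID, s) :: l => .pair (.pair (repZ ID) s.rep) (Sessions.rep l)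

/-- The representation of a transcript. -/
def Transcript.rep (u : Transcript B) : Data :=
  .pair (repZ u.1) (.pair (repZ u.2.1) (repZ u.2.2))

/-- The first component distinguishes a claim (`2`) from an ordinary answer, for which it is the
flag. The commitment in a claim is left out: it is not used in the answer. -/
def Reply.rep : Reply B → Data
  | .cont o m l => .pair (.nat (if o then 1 else 0)) (.pair m.rep (Sessions.rep l))
  | .claim _ c z₁ z₂ l => .pair (.nat 2) (.pair (Transcript.rep (c, z₁, z₂)) (Sessions.rep l))

/-- The representation of a state of the simulation. -/
def SimState.rep (s : SimState B) : Data :=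
  .pair (.nat s.n) (.pair s.msg.rep (.pair s.adv (.pair (Sessions.rep s.sess)
    (Transcript.rep s.tr))))

/-- Drops the first session unless it belongs to `ID`. On the empty list the test is applied to a
meaningless number, which does no harm since both cases leave it empty. -/
def Sessions.skip (ID : ZMod B.p) (l : Sessions B) : Sessions B :=
  if (Sessions.rep l).fst.fst.toNat = ID.val then l else l.tail

theorem Sessions.rep_tail (l : Sessions B) : Sessions.rep l.tail = (Sessions.rep l).snd := by
  cases l <;> rfl

theorem Sessions.rep_skip (ID : ZMod B.p) (l : Sessions B) (n : ℕ) (hn : l.length ≤ n) :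
    (Sessions.rep ((Sessions.skip ID)^[n] l)).fst.snd = (l.get ID).rep := by
  have hnil : ∀ n, (Sessions.skip ID)^[n] ([] : Sessions B) = [] := by
    intro n
    exact Function.iterate_fixed (by simp [Sessions.skip]) n
  induction n generalizing l with
  | zero =>
    obtain rfl : l = [] := List.length_eq_zero_iff.1 (Nat.le_zero.1 hn)
    rfl
  | succ n ih =>
    cases l with
    | nil => rw [hnil]; rfl
    | cons a l =>
      obtain ⟨J, s⟩ := a
      by_cases h : J = ID
      · have hfix : Sessions.skip ID ((J, s) :: l) = (J, s) :: l := by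
          simp [Sessions.skip, Sessions.rep, Data.fst, repZ, Data.toNat, h]
        rw [Function.iterate_fixed hfix]
        simp [Sessions.rep, Data.fst, Data.snd, Sessions.get, h]
      · have hskip : Sessions.skip ID ((J, s) :: l) = l := by
          simp [Sessions.skip, Sessions.rep, Data.fst, repZ, Data.toNat,
            (ZMod.val_injective B.p).eq_iff, h]
        rw [Function.iterate_succ_apply, hskip, ih l (by simpa using hn)]
        simp [Sessions.get, h]

end Representation

/-! ### Sampling rules for values that are represented by data -/

section Rules

variable {ι : Type u} {κ : ι → ℕ} {x : ι → Data}

/-- Sampling a value, then continuing in any environment in which the value and the original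
input are available. -/
theorem PolySample.bind_rep {α : ι → Type} {M : ∀ i, PMF (α i)} {rep : ∀ i, α i → Data}
    {ν : ∀ i, α i → PMF Data} (h : PolySample κ x fun i => (M i).map (rep i))
    (h' : ∀ (J : Type u) (φ : J → ι) (a : ∀ j, α (φ j)) (x' : J → Data),
      (∀ j, a j ∈ (M (φ j)).support) →
      PolyComp (fun j => κ (φ j)) x' (fun j => rep (φ j) (a j)) →
      PolyComp (fun j => κ (φ j)) x' (fun j => x (φ j)) →
      PolySample (fun j => κ (φ j)) x' fun j => ν (φ j) (a j)) :
    PolySample κ x fun i => (M i).bind (ν i) :=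
  h.bind fun hl => h' _ Sigma.fst (fun j => j.2.1) _ (fun j => j.2.2) (PolyComp.refl hl).fst
    (PolyComp.refl hl).snd

theorem PolySample.map_rep {α : ι → Type} {M : ∀ i, PMF (α i)} {rep : ∀ i, α i → Data}
    {g : ∀ i, α i → Data} (h : PolySample κ x fun i => (M i).map (rep i))
    (h' : ∀ (J : Type u) (φ : J → ι) (a : ∀ j, α (φ j)) (x' : J → Data),
      (∀ j, a j ∈ (M (φ j)).support) →
      PolyComp (fun j => κ (φ j)) x' (fun j => rep (φ j) (a j)) →
      PolyComp (fun j => κ (φ j)) x' (fun j => x (φ j)) →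
      PolyComp (fun j => κ (φ j)) x' fun j => g (φ j) (a j)) :
    PolySample κ x fun i => (M i).map (g i) :=
  h.map_data fun hl => h' _ Sigma.fst (fun j => j.2.1) _ (fun j => j.2.2) (PolyComp.refl hl).fst
    (PolyComp.refl hl).snd

theorem PolySample.bind_data {M : ι → PMF Data} {ν : ι → Data → PMF Data} (h : PolySample κ x M)
    (h' : ∀ (J : Type u) (φ : J → ι) (a : J → Data) (x' : J → Data),
      (∀ j, a j ∈ (M (φ j)).support) → PolyComp (fun j => κ (φ j)) x' a →
      PolyComp (fun j => κ (φ j)) x' (fun j => x (φ j)) →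
      PolySample (fun j => κ (φ j)) x' fun j => ν (φ j) (a j)) :
    PolySample κ x fun i => (M i).bind (ν i) :=
  PolySample.bind_rep (rep := fun _ a => a) (h.congr fun _ => (PMF.map_id _).symm)
    fun J φ a x' ha h1 h2 => h' J φ a x' ha h1 h2

/-- Case distinction by a computable test, in terms of environments. -/
theorem PolySample.split {μ : ι → PMF Data} {c : ι → Prop} [∀ i, Decidable (c i)]
    (hc : PolyComp κ x fun i => .nat (if c i then 1 else 0))
    (h1 : ∀ (J : Type u) (φ : J → ι), (∀ j, c (φ j)) →
      PolySample (fun j => κ (φ j)) (fun j => x (φ j)) fun j => μ (φ j))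
    (h2 : ∀ (J : Type u) (φ : J → ι), (∀ j, ¬ c (φ j)) →
      PolySample (fun j => κ (φ j)) (fun j => x (φ j)) fun j => μ (φ j)) :
    PolySample κ x μ :=
  .cases hc (h1 _ Subtype.val fun j => j.2) (h2 _ Subtype.val fun j => j.2)

theorem PolyComp.split {y : ι → Data} {c : ι → Prop} [∀ i, Decidable (c i)]
    (hc : PolyComp κ x fun i => .nat (if c i then 1 else 0))
    (h1 : ∀ (J : Type u) (φ : J → ι), (∀ j, c (φ j)) →
      PolyComp (fun j => κ (φ j)) (fun j => x (φ j)) fun j => y (φ j))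
    (h2 : ∀ (J : Type u) (φ : J → ι), (∀ j, ¬ c (φ j)) →
      PolyComp (fun j => κ (φ j)) (fun j => x (φ j)) fun j => y (φ j)) :
    PolyComp κ x y :=
  PolySample.split hc h1 h2

variable {gen : GroupGen} {B : ι → BilinearGroup}

/-- Case distinction whether a number represents a group element. -/
theorem HasPub.cases_readG (H : HasPub gen κ x B) {y : ι → Data} (hy : PolyComp κ x y)
    {μ : ι → PMF Data}
    (h1 : ∀ (J : Type u) (φ : J → ι) (u : ∀ j, (B (φ j)).G),
      (∀ j, (B (φ j)).readG (y (φ j)) = some (u j)) →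
      PolyComp (fun j => κ (φ j)) (fun j => x (φ j)) (fun j => repG (u j)) →
      PolySample (fun j => κ (φ j)) (fun j => x (φ j)) fun j => μ (φ j))
    (h2 : ∀ (J : Type u) (φ : J → ι), (∀ j, (B (φ j)).readG (y (φ j)) = none) →
      PolySample (fun j => κ (φ j)) (fun j => x (φ j)) fun j => μ (φ j)) :
    PolySample κ x μ := by
  classical
  refine .split (c := fun i => (y i).toNat ∈ Set.range (B i).encG) (H.memG hy.toNat)
    (fun J φ hc => ?_) fun J φ hc => ?_
  · choose u hu using hc
    refine h1 J φ u (fun j => ?_) ((hy.comap φ).toNat.congr fun j => by rw [repG, hu])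
    rw [readG, ← hu]
    exact Function.partialInv_left (B (φ j)).encG_injective (u j)
  · refine h2 J φ fun j => ?_
    exact dif_neg (hc j)

theorem HasPub.cases_session (_ : HasPub gen κ x B) {s : ∀ i, Session (B i)}
    (hs : PolyComp κ x fun i => (s i).rep) {μ : ι → PMF Data}
    (h1 : ∀ (J : Type u) (φ : J → ι), (∀ j, s (φ j) = .fresh) →
      PolySample (fun j => κ (φ j)) (fun j => x (φ j)) fun j => μ (φ j))
    (h2 : ∀ (J : Type u) (φ : J → ι), (∀ j, s (φ j) = .done) →
      PolySample (fun j => κ (φ j)) (fun j => x (φ j)) fun j => μ (φ j))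
    (h3 : ∀ (J : Type u) (φ : J → ι) (R V : ∀ j, (B (φ j)).G) (c : ∀ j, ZMod (B (φ j)).p),
      (∀ j, s (φ j) = .waiting (R j) (V j) (c j)) →
      PolyComp (fun j => κ (φ j)) (fun j => x (φ j)) (fun j => repG (R j)) →
      PolyComp (fun j => κ (φ j)) (fun j => x (φ j)) (fun j => repG (V j)) →
      PolyComp (fun j => κ (φ j)) (fun j => x (φ j)) (fun j => repZ (c j)) →
      PolySample (fun j => κ (φ j)) (fun j => x (φ j)) fun j => μ (φ j)) :
    PolySample κ x μ := by
  classical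
  refine .split (c := fun i => ∃ R V c, s i = .waiting R V c)
    (hs.isPair fun i => ?_) (fun J φ hc => ?_) fun J φ hc => ?_
  · constructor
    · rintro ⟨R, V, c, h⟩
      exact ⟨_, _, by rw [h]; rfl⟩
    · rintro ⟨a, b, h⟩
      cases hi : s i with
      | fresh => rw [hi] at h; cases h
      | done => rw [hi] at h; cases h
      | waiting R V c => exact ⟨R, V, c, rfl⟩
  · choose R V c hc using hc
    have hs' := hs.comap φ
    exact h3 J φ R V c hc (hs'.fst.congr fun j => by rw [hc]; rfl)
      (hs'.snd.fst.congr fun j => by rw [hc]; rfl) (hs'.snd.snd.congr fun j => by rw [hc]; rfl)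
  · refine .split (c := fun j => s (φ j) = .fresh)
      (((hs.comap φ).toNat.eq (.const (hs.comap φ).1 0)).congr fun j => ?_)
      (fun K ψ h => h1 K (fun k => φ (ψ k)) h) fun K ψ h => h2 K (fun k => φ (ψ k)) fun k => ?_
    · cases hi : s (φ j) with
      | fresh => simp [Session.rep, Data.toNat]
      | done => simp [Session.rep, Data.toNat]
      | waiting R V c => exact absurd ⟨R, V, c, hi⟩ (hc j)
    · cases hi : s (φ (ψ k)) with
      | fresh => exact absurd hi (h k)
      | done => rfl
      | waiting R V c => exact absurd ⟨R, V, c, hi⟩ (hc (ψ k))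

/-- The sessions are looked up by a linear search. -/
theorem HasPub.get (H : HasPub gen κ x B) {l : ∀ i, Sessions (B i)} {ID : ∀ i, ZMod (B i).p}
    (P : Polynomial ℕ) (hlen : ∀ i, (l i).length ≤ P.eval (κ i))
    (hl : PolyComp κ x fun i => (l i).rep) (hID : PolyComp κ x fun i => repZ (ID i)) :
    PolyComp κ x fun i => ((l i).get (ID i)).rep := by
  have key : PolyComp κ x fun i => Sessions.rep ((Sessions.skip (ID i))^[P.eval (κ i)] (l i)) := by
    refine PolyComp.loop (enc := fun i l => Sessions.rep l) (step := fun i => Sessions.skip (ID i))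
      (fun i a => (Sessions.rep a).leaf ≤ (Sessions.rep (l i)).leaf) (PolyB.eval P .self)
      (.eval P H.k) hl (fun i => le_rfl) ?_ ?_ ?_
    · intro i a ha
      refine le_trans ?_ ha
      unfold Sessions.skip
      split_ifs
      · exact le_rfl
      · rw [Sessions.rep_tail]
        exact Data.leaf_snd _
    · exact (hl.leaf.comap fun j : Σ i, {a : Sessions (B i) //
        (Sessions.rep a).leaf ≤ (Sessions.rep (l i)).leaf} => j.1).mono fun j => j.2.2
    · intro hl'
      have h0 := PolyComp.refl hl'
      refine .split (c := fun j => (Sessions.rep j.2.1).fst.fst.toNat = (ID j.1).val)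
        (h0.fst.fst.fst.toNat.eq (h0.snd.trans (hID.comap _)).toNat)
        (fun J φ hc => (h0.fst.comap φ).congr fun j => ?_)
        fun J φ hc => (h0.fst.snd.comap φ).congr fun j => ?_
      · simp only [Sessions.skip, hc, if_true]; rfl
      · simp only [Sessions.skip, hc, if_false, Sessions.rep_tail]; rfl
  exact key.fst.snd.congr fun i => Sessions.rep_skip _ _ _ (hlen i)

end Rules

/-! ### A program for the simulated authority -/

/-- The group elements of the problem instance that enter the public key of the simulation, and
the random exponents of the simulation. -/
structure Params : Type 1 where
  B : BilinearGroup
  g : B.G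
  X : B.G
  h : B.G
  IDs : ZMod B.p
  γ : ZMod B.p
  τ : ZMod B.p
  ω : ZMod B.p

/-- The public key of the simulation. -/
abbrev Params.mpk (P : Params) : PublicKey P.B := simPK P.g P.X P.h P.IDs P.γ P.τ P.ω

/-- The input `x` gives access to the parameters of the simulation. -/
structure HasParams {ι : Type u} (gen : GroupGen) (κ : ι → ℕ) (x : ι → Data)
    (P : ι → Params) : Prop extends HasPub gen κ x (fun i => (P i).B) where
  g : PolyComp κ x fun i => repG (P i).g
  X : PolyComp κ x fun i => repG (P i).X
  h : PolyComp κ x fun i => repG (P i).h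
  IDs : PolyComp κ x fun i => repZ (P i).IDs
  γ : PolyComp κ x fun i => repZ (P i).γ
  τ : PolyComp κ x fun i => repZ (P i).τ
  ω : PolyComp κ x fun i => repZ (P i).ω

namespace HasParams

variable {ι : Type u} {gen : GroupGen} {κ : ι → ℕ} {x : ι → Data} {P : ι → Params}

theorem lift (E : HasParams gen κ x P) {ι' : Type u} (φ : ι' → ι) {x' : ι' → Data}
    (h : PolyComp (fun j => κ (φ j)) x' fun j => x (φ j)) :
    HasParams gen (fun j => κ (φ j)) x' fun j => P (φ j) :=
  { E.toHasPub.lift φ h with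
    g := h.trans (E.g.comap φ)
    X := h.trans (E.X.comap φ)
    h := h.trans (E.h.comap φ)
    IDs := h.trans (E.IDs.comap φ)
    γ := h.trans (E.γ.comap φ)
    τ := h.trans (E.τ.comap φ)
    ω := h.trans (E.ω.comap φ) }

theorem comap (E : HasParams gen κ x P) {ι' : Type u} (φ : ι' → ι) :
    HasParams gen (fun j => κ (φ j)) (fun j => x (φ j)) fun j => P (φ j) :=
  E.lift φ (.refl (E.g.1.comap φ))

theorem Y (E : HasParams gen κ x P) : PolyComp κ x fun i => repG (P i).mpk.Y :=
  E.mulG (E.pw E.X E.γ) (E.pw E.h (E.negZ E.τ))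

theorem Z (E : HasParams gen κ x P) : PolyComp κ x fun i => repG (P i).mpk.Z :=
  E.mulG (E.pw E.g (E.negZ E.IDs)) (E.pw E.X E.ω)

theorem hashID (E : HasParams gen κ x P) {ID : ∀ i, ZMod (P i).B.p}
    (hID : PolyComp κ x fun i => repZ (ID i)) :
    PolyComp κ x fun i => repG ((P i).mpk.hashID (ID i)) :=
  E.mulG (E.pw E.g hID) E.Z

theorem mpk (E : HasParams gen κ x P) : PolyComp κ x fun i => (Msg.mpk (P i).mpk).rep :=
  .pair (.const E.g.1 0) (E.g.pair (E.X.pair (E.Y.pair (E.Z.pair E.h))))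

theorem simKey (E : HasParams gen κ x P) {ID r t : ∀ i, ZMod (P i).B.p} {R : ∀ i, (P i).B.G}
    (hID : PolyComp κ x fun i => repZ (ID i)) (hR : PolyComp κ x fun i => repG (R i))
    (hr : PolyComp κ x fun i => repZ (r i)) (ht : PolyComp κ x fun i => repZ (t i)) :
    PolyComp κ x fun i => (Msg.key (simKey (P i).mpk (P i).IDs (P i).ω (ID i) (R i) (r i)
      (t i))).rep := by
  classical
  have hW : PolyComp κ x fun i => repG ((P i).mpk.Y * R i * BilinearGroup.pw (P i).mpk.h (t i)) :=
    E.mulG (E.mulG E.Y hR) (E.pw E.h ht)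
  have hΔ : PolyComp κ x fun i => repZ ((ID i - (P i).IDs)⁻¹) := E.invZ (E.subZ hID E.IDs)
  have hr' : PolyComp κ x fun i => repZ (if BilinearGroup.pw (P i).mpk.X (r i)
      = BilinearGroup.pw ((P i).mpk.Y * R i * BilinearGroup.pw (P i).mpk.h (t i))
        (ID i - (P i).IDs)⁻¹ then 0 else r i) := by
    refine .split (E.eqG (E.pw E.X hr) (E.pw hW hΔ)) (fun J φ hc => ?_) fun J φ hc => ?_
    · exact ((E.comap φ).constZ 0).congr fun j => by
        rw [Nat.cast_zero]; exact congrArg repZ (if_pos (hc j)).symm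
    · exact (hr.comap φ).congr fun j => congrArg repZ (if_neg (hc j)).symm
  refine (PolyComp.pair (.const E.g.1 2) (.pair (E.mulG (E.pw (E.hashID hID) hr')
    (E.pw hW (E.negZ (E.mulZ E.ω hΔ)))) (.pair (E.mulG (E.pw E.X hr') (E.pw hW (E.negZ hΔ)))
      ht))).congr fun i => ?_
  simp only [Msg.rep, AIBE.simKey]
  congr!

theorem simIssue (E : HasParams gen κ x P) {ID : ∀ i, ZMod (P i).B.p} {R : ∀ i, (P i).B.G}
    (hID : PolyComp κ x fun i => repZ (ID i)) (hR : PolyComp κ x fun i => repG (R i)) :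
    PolySample κ x fun i => (simIssue (P i).mpk (P i).IDs (P i).ω (ID i) (R i)).map
      fun d => (Msg.key d).rep := by
  simp only [AIBE.simIssue, PMF.map_bind]
  refine .bind_rep E.uniformUnits fun J φ r x' _ hr hx => ?_
  simp only [PMF.map_comp]
  refine .map_rep (E.lift φ hx).uniformUnits fun K ψ t x'' _ ht hx' => ?_
  exact (E.lift (fun k => φ (ψ k)) (hx'.trans (hx.comap ψ))).simKey
    (hx'.trans (hx.comap ψ) |>.trans (hID.comap _)) (hx'.trans (hx.comap ψ) |>.trans (hR.comap _))
    (hx'.trans (hr.comap ψ)) ht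

theorem starIssue (E : HasParams gen κ x P) {a b : ∀ i, Transcript (P i).B}
    (ha : PolyComp κ x fun i => (a i).rep) (hb : PolyComp κ x fun i => (b i).rep) :
    PolySample κ x fun i => (starIssue (P i).mpk (P i).ω (P i).γ (P i).τ (a i) (b i)).map
      fun d => (Msg.key d).rep := by
  simp only [AIBE.starIssue, PMF.map_comp]
  refine .map_rep E.uniformUnits fun J φ r x' _ hr hx => ?_
  have E' := E.lift φ hx
  have ha' := hx.trans (ha.comap φ)
  have hb' := hx.trans (hb.comap φ)
  have h1 : PolyComp _ x' fun j => repZ (((a (φ j)).1 - (b (φ j)).1)⁻¹) :=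
    E'.invZ (E'.subZ ha'.fst hb'.fst)
  have h2 : PolyComp _ x' fun j => repZ ((a (φ j)).2.1 - (b (φ j)).2.1) :=
    E'.subZ ha'.snd.fst hb'.snd.fst
  have h3 : PolyComp _ x' fun j => repZ ((a (φ j)).2.2 - (b (φ j)).2.2) :=
    E'.subZ ha'.snd.snd hb'.snd.snd
  exact .pair (.const hx.1 2) (.pair (E'.mulG (E'.pw E'.g (E'.addZ E'.γ (E'.mulZ h3 h1)))
    (E'.pw (E'.pw E'.X E'.ω) hr)) (.pair (E'.pw E'.X hr) (E'.subZ E'.τ (E'.mulZ h2 h1))))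

theorem reject (E : HasParams gen κ x P) {l : ∀ i, Sessions (P i).B}
    (hl : PolyComp κ x fun i => (l i).rep) :
    PolyComp κ x fun i => (Reply.cont false .reject (l i)).rep :=
  .pair (.const E.g.1 0) (.pair (.pair (.const E.g.1 3) (.const E.g.1 0)) hl)

variable {Q : Polynomial ℕ}

theorem answerOpen (E : HasParams gen κ x P) {ID : ∀ i, ZMod (P i).B.p}
    {l : ∀ i, Sessions (P i).B} {y y' : ι → Data} (hlen : ∀ i, (l i).length ≤ Q.eval (κ i))
    (hl : PolyComp κ x fun i => (l i).rep) (hID : PolyComp κ x fun i => repZ (ID i))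
    (hy : PolyComp κ x y) (hy' : PolyComp κ x y') :
    PolySample κ x fun i => (answerOpen (P i).IDs (ID i) ((P i).B.readG (y i))
      ((P i).B.readG (y' i)) (l i)).map Reply.rep := by
  classical
  have hrej : ∀ (J : Type u) (φ : J → ι), (∀ j, AIBE.answerOpen (P (φ j)).IDs (ID (φ j))
      ((P (φ j)).B.readG (y (φ j))) ((P (φ j)).B.readG (y' (φ j))) (l (φ j))
      = PMF.pure (.cont false .reject (l (φ j)))) →
      PolySample (fun j => κ (φ j)) (fun j => x (φ j)) fun j =>
        (AIBE.answerOpen (P (φ j)).IDs (ID (φ j)) ((P (φ j)).B.readG (y (φ j)))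
          ((P (φ j)).B.readG (y' (φ j))) (l (φ j))).map Reply.rep := fun J φ h =>
    PolySample.congr ((E.comap φ).reject (hl.comap φ)) fun j => by rw [h, PMF.pure_map]
  refine E.cases_readG hy (fun J φ R hR hR' => ?_) fun J φ hR => hrej J φ fun j => by
    rw [hR]; rfl
  refine (E.comap φ).cases_readG (hy'.comap φ) (fun J₁ φ₁ V hV hV' => ?_) fun J₁ φ₁ hV =>
    hrej J₁ (fun j => φ (φ₁ j)) fun j => by rw [hV, hR]; rfl
  have hs := (E.comap fun j => φ (φ₁ j)).get Q (fun j => hlen _) (hl.comap fun j => φ (φ₁ j))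
    (hID.comap fun j => φ (φ₁ j))
  refine (E.comap fun j => φ (φ₁ j)).cases_session hs (fun K ψ h => ?_)
    (fun K ψ h => hrej K (fun k => φ (φ₁ (ψ k))) fun k => by
      rw [hR, hV]; simp only [AIBE.answerOpen, h])
    fun K ψ R' V' c h _ _ _ => hrej K (fun k => φ (φ₁ (ψ k))) fun k => by
      rw [hR, hV]; simp only [AIBE.answerOpen, h]
  have E' := E.comap fun k => φ (φ₁ (ψ k))
  refine PolySample.congr (PolySample.map_rep
    (g := fun k (c : ZMod (P (φ (φ₁ (ψ k)))).B.p) => (Reply.rep (.cont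
      (decide (ID (φ (φ₁ (ψ k))) = (P (φ (φ₁ (ψ k)))).IDs)) (.challenge c)
      ((ID (φ (φ₁ (ψ k))), .waiting (R (φ₁ (ψ k))) (V (ψ k)) c) :: l (φ (φ₁ (ψ k)))))))
    E'.uniformZ fun I θ c x' _ hc hx => ?_) fun k => ?_
  · have hID' := hx.trans (hID.comap fun k => φ (φ₁ (ψ (θ k))))
    refine .pair ?_ (.pair (.pair (.const hx.1 1) hc) (.pair (.pair hID' (.pair
      (hx.trans (hR'.comap fun k => φ₁ (ψ (θ k)))) (.pair (hx.trans (hV'.comap fun k => ψ (θ k)))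
        hc))) (hx.trans (hl.comap fun k => φ (φ₁ (ψ (θ k)))))))
    exact ((E'.lift θ hx).eqZ hID' (E'.lift θ hx).IDs).congr fun k => by simp
  · rw [hR, hV]
    simp only [AIBE.answerOpen, h, PMF.map_comp]
    congr!

theorem answerClose (E : HasParams gen κ x P) {ID z₁ z₂ : ∀ i, ZMod (P i).B.p}
    {l : ∀ i, Sessions (P i).B} (hlen : ∀ i, (l i).length ≤ Q.eval (κ i))
    (hl : PolyComp κ x fun i => (l i).rep) (hID : PolyComp κ x fun i => repZ (ID i))
    (hz₁ : PolyComp κ x fun i => repZ (z₁ i)) (hz₂ : PolyComp κ x fun i => repZ (z₂ i)) :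
    PolySample κ x fun i => (answerClose (P i).mpk (P i).IDs (P i).ω (ID i) (z₁ i) (z₂ i)
      (l i)).map Reply.rep := by
  classical
  have hrej : ∀ (J : Type u) (φ : J → ι), (∀ j, AIBE.answerClose (P (φ j)).mpk (P (φ j)).IDs
      (P (φ j)).ω (ID (φ j)) (z₁ (φ j)) (z₂ (φ j)) (l (φ j))
      = PMF.pure (.cont false .reject (l (φ j)))) →
      PolySample (fun j => κ (φ j)) (fun j => x (φ j)) fun j =>
        (AIBE.answerClose (P (φ j)).mpk (P (φ j)).IDs (P (φ j)).ω (ID (φ j)) (z₁ (φ j))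
          (z₂ (φ j)) (l (φ j))).map Reply.rep := fun J φ h =>
    PolySample.congr ((E.comap φ).reject (hl.comap φ)) fun j => by rw [h, PMF.pure_map]
  refine E.cases_session (E.get Q hlen hl hID)
    (fun J φ h => hrej J φ fun j => by simp only [AIBE.answerClose, h])
    (fun J φ h => hrej J φ fun j => by simp only [AIBE.answerClose, h])
    fun J φ R V c h hR hV hc => ?_
  have E' := E.comap φ
  have hdone : PolyComp (fun j => κ (φ j)) (fun j => x (φ j)) fun j =>
      Sessions.rep ((ID (φ j), Session.done) :: l (φ j)) :=
    .pair (.pair (hID.comap φ) (.const hc.1 1)) (hl.comap φ)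
  refine .split (c := fun j => Accepts (P (φ j)).mpk (R j) (V j) (c j) (z₁ (φ j)) (z₂ (φ j)))
    (E'.eqG (E'.mulG (E'.pw E'.h (hz₁.comap φ)) (E'.pw E'.X (hz₂.comap φ)))
      (E'.mulG hV (E'.pw hR hc))) (fun J₁ φ₁ hacc => ?_) fun J₁ φ₁ hacc => ?_
  · refine .split (c := fun j => ID (φ (φ₁ j)) = (P (φ (φ₁ j))).IDs)
      ((E'.comap φ₁).eqZ (hID.comap fun j => φ (φ₁ j)) (E'.comap φ₁).IDs)
      (fun J₂ φ₂ hs => ?_) fun J₂ φ₂ hs => ?_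
    · refine PolySample.congr (PolyComp.pair (.const (hc.1.comap fun j => φ₁ (φ₂ j)) 2)
        (.pair (.pair (hc.comap fun j => φ₁ (φ₂ j)) (.pair (hz₁.comap fun j => φ (φ₁ (φ₂ j)))
          (hz₂.comap fun j => φ (φ₁ (φ₂ j))))) (hdone.comap fun j => φ₁ (φ₂ j)))) fun j => ?_
      simp only [AIBE.answerClose, h, hacc, if_true]
      rw [if_pos (hs j), PMF.pure_map]
      rfl
    · have E₂ := E.comap fun j => φ (φ₁ (φ₂ j))
      refine PolySample.congr (PolySample.map_rep
        (g := fun j d => (Reply.rep (.cont false (.key d)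
          ((ID (φ (φ₁ (φ₂ j))), .done) :: l (φ (φ₁ (φ₂ j)))))))
        (E₂.simIssue (hID.comap _) (hR.comap fun j => φ₁ (φ₂ j))) fun K ψ d x' _ hd hx =>
          .pair (.const hx.1 0) (.pair hd (hx.trans (hdone.comap fun k => φ₁ (φ₂ (ψ k))))))
        fun j => ?_
      simp only [AIBE.answerClose, h, hacc, hs, if_true, if_false, PMF.map_comp]
      rfl
  · refine PolySample.congr ((E'.comap φ₁).reject (hdone.comap φ₁)) fun j => ?_
    simp only [AIBE.answerClose, h, hacc, if_false, PMF.pure_map]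

theorem answer (E : HasParams gen κ x P) {q : ι → Data} {l : ∀ i, Sessions (P i).B}
    (hlen : ∀ i, (l i).length ≤ Q.eval (κ i)) (hl : PolyComp κ x fun i => (l i).rep)
    (hq : PolyComp κ x q) :
    PolySample κ x fun i => (answer (P i).mpk (P i).IDs (P i).ω (q i) (l i)).map Reply.rep := by
  refine .split (hq.fst.toNat.eq (.const hq.1 0)) (fun J φ h0 => ?_) fun J φ h0 => ?_
  · have hq' := hq.comap φ
    exact ((E.comap φ).answerOpen (fun j => hlen _) (hl.comap φ) ((E.comap φ).readZ hq'.snd.fst)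
      hq'.snd.snd.fst hq'.snd.snd.snd).congr fun j => by rw [AIBE.answer, if_pos (h0 j)]
  · refine .split ((hq.comap φ).fst.toNat.eq (.const (hq.1.comap φ) 1)) (fun J₁ φ₁ h1 => ?_)
      fun J₁ φ₁ h1 => ?_
    · have hq' := hq.comap fun j => φ (φ₁ j)
      have E' := E.comap fun j => φ (φ₁ j)
      exact (E'.answerClose (fun j => hlen _) (hl.comap fun j => φ (φ₁ j)) (E'.readZ hq'.snd.fst)
        (E'.readZ hq'.snd.snd.fst) (E'.readZ hq'.snd.snd.snd)).congr fun j => by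
          rw [AIBE.answer, if_neg (h0 _), if_pos (h1 j)]
    · exact PolySample.congr ((E.comap fun j => φ (φ₁ j)).reject (hl.comap _)) fun j => by
        rw [AIBE.answer, if_neg (h0 _), if_neg (h1 j), PMF.pure_map]

end HasParams

/-! ### A program for the simulated interaction -/

section Lengths

variable {ι : Type u} {gen : GroupGen} {κ : ι → ℕ} {x : ι → Data} {B : ι → BilinearGroup}

theorem HasPub.leaf_sessions (H : HasPub gen κ x B) :
    PolyLeaf (fun j : Σ i, Sessions (B i) => κ j.1) fun j => Sessions.rep j.2 := by
  obtain ⟨P, hP⟩ := H.leafG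
  obtain ⟨Q, hQ⟩ := H.leafZ
  refine ⟨P + Q + 1, fun ⟨i, l⟩ => ?_⟩
  simp only [Polynomial.eval_add, Polynomial.eval_one]
  induction l with
  | nil => simp [Sessions.rep, Data.leaf]
  | cons a l ih =>
    obtain ⟨ID, s⟩ := a
    have hID := hQ ⟨i, ID⟩
    simp only at hID ih
    have hs : s.rep.leaf ≤ P.eval (κ i) + Q.eval (κ i) + 1 := by
      cases s with
      | fresh => simp [Session.rep, Data.leaf]
      | done => simp [Session.rep, Data.leaf]
      | waiting R V c =>
        have h1 := hP ⟨i, R⟩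
        have h2 := hP ⟨i, V⟩
        have h3 := hQ ⟨i, c⟩
        simp only [Session.rep, Data.leaf] at *
        omega
    simp only [Sessions.rep, Data.leaf] at *
    omega

theorem HasPub.leaf_msg (H : HasPub gen κ x B) :
    PolyLeaf (fun j : Σ i, Msg (B i) => κ j.1) fun j => j.2.rep := by
  obtain ⟨P, hP⟩ := H.leafG
  obtain ⟨Q, hQ⟩ := H.leafZ
  refine ⟨P + Q + 2, fun ⟨i, m⟩ => ?_⟩
  simp only [Polynomial.eval_add, Polynomial.eval_ofNat]
  have h0 : (0 : ℕ).size = 0 := rfl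
  have h1 : (1 : ℕ).size = 1 := rfl
  have h2 : (2 : ℕ).size = 2 := rfl
  have h3 : (3 : ℕ).size = 2 := rfl
  have hG := fun u => hP ⟨i, u⟩
  have hZ := fun u => hQ ⟨i, u⟩
  simp only at hG hZ
  cases m with
  | mpk pk =>
    have := hG pk.g; have := hG pk.X; have := hG pk.Y; have := hG pk.Z; have := hG pk.h
    simp only [Msg.rep, Data.leaf] at *
    omega
  | challenge c =>
    have := hZ c
    simp only [Msg.rep, Data.leaf] at *
    omega
  | key d =>
    have := hG d.d₁; have := hG d.d₂; have := hZ d.d₃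
    simp only [Msg.rep, Data.leaf] at *
    omega
  | reject =>
    simp only [Msg.rep, Data.leaf]
    omega

theorem HasPub.leaf_transcript (H : HasPub gen κ x B) :
    PolyLeaf (fun j : Σ i, Transcript (B i) => κ j.1) fun j => Transcript.rep j.2 :=
  PolyLeaf.pair (H.leafZ.comap fun j : Σ i, Transcript (B i) => ⟨j.1, j.2.1⟩)
    (PolyLeaf.pair (H.leafZ.comap fun j : Σ i, Transcript (B i) => ⟨j.1, j.2.2.1⟩)
      (H.leafZ.comap fun j : Σ i, Transcript (B i) => ⟨j.1, j.2.2.2⟩))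

variable {A : Adversary}

/-- The numbers in the messages and states of the adversary have polynomial length. -/
theorem HasPub.leaf_reaches (H : HasPub gen κ x B) (hA : A.IsPPT gen) :
    ∃ P : Polynomial ℕ, ∀ i n o, n ≤ A.rounds.eval (κ i) + 1 → A.Reaches (κ i) (B i) n o →
      o.leaf ≤ P.eval (κ i) := by
  obtain ⟨P, hP⟩ := H.pub.leaf
  obtain ⟨Q, hQ⟩ := H.leaf_msg
  obtain ⟨T, hT⟩ := hA
  refine ⟨P + Q + T, fun i n o hn ho => ?_⟩
  simp only [Polynomial.eval_add]
  have hTi := hT (κ i) (B i) (H.mem i)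
  induction ho with
  | choose h =>
    have := Prog.leaf_out hTi.1 h
    have h2 := hP i
    simp only at h2
    omega
  | @act n o o' m hr h ih =>
    have h1 := Prog.leaf_out (hTi.2.1 n (by omega) o hr m) h
    have h2 := hQ ⟨i, m⟩
    have h3 := ih (by omega)
    have h4 := Data.leaf_snd o
    simp only [Data.leaf] at h1 h2
    omega

end Lengths

section Invariant

variable {B : BilinearGroup}

/-- The sessions after an answer. -/
def Reply.sess : Reply B → Sessions B
  | .cont _ _ l => l
  | .claim _ _ _ _ l => l

theorem length_answer {mpk : PublicKey B} {IDs ω : ZMod B.p} {q : Data} {l : Sessions B} :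
    ∀ a ∈ (answer mpk IDs ω q l).support, a.sess.length ≤ l.length + 1 := by
  intro a ha
  unfold answer at ha
  split_ifs at ha
  · unfold answerOpen at ha
    split at ha
    · rw [PMF.support_map] at ha
      obtain ⟨c, -, rfl⟩ := ha
      simp [Reply.sess]
    · rw [PMF.mem_support_pure_iff] at ha
      simp [ha, Reply.sess]
  · unfold answerClose at ha
    split at ha
    · split_ifs at ha
      · rw [PMF.mem_support_pure_iff] at ha
        simp [ha, Reply.sess]
      · rw [PMF.support_map] at ha
        obtain ⟨c, -, rfl⟩ := ha
        simp [Reply.sess]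
      · rw [PMF.mem_support_pure_iff] at ha
        simp [ha, Reply.sess]
    · rw [PMF.mem_support_pure_iff] at ha
      simp [ha, Reply.sess]
  · rw [PMF.mem_support_pure_iff] at ha
    simp [ha, Reply.sess]

/-- The state of the adversary is one that it reaches after `N - s.n` activations, and the list of
sessions has at most one entry per activation. -/
def SimState.Reachable (A : Adversary) (k N : ℕ) (s : SimState B) : Prop :=
  ∃ t o, A.Reaches k B t o ∧ t + s.n = N ∧ o.snd = s.adv ∧ s.sess.length ≤ t

variable {A : Adversary} {k N : ℕ} {mpk : PublicKey B} {IDs ω γ τ : ZMod B.p} {s : SimState B}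

theorem SimState.Reachable.next (h : s.Reachable A k N) (hs : s.n ≠ 0) {o : Data}
    (ho : o ∈ (A.act.out (.pair s.msg.rep s.adv)).support) {l : Sessions B}
    (hl : l.length ≤ s.sess.length + 1) (m : Msg B) (u : Transcript B) :
    SimState.Reachable A k N ⟨s.n - 1, m, o.snd, l, u⟩ := by
  obtain ⟨t, o', hr, hn, hadv, hlen⟩ := h
  rw [← hadv] at ho
  exact ⟨t + 1, o, .act _ hr ho, by simp only; omega, rfl, by simp only; omega⟩

theorem SimState.Reachable.lookNext (h : s.Reachable A k N) (hs : s.n ≠ 0) {o : Data}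
    (ho : o ∈ (A.act.out (.pair s.msg.rep s.adv)).support) {a : Reply B}
    (ha : a ∈ (answer mpk IDs ω o.fst s.sess).support) :
    ∃ M ≤ N, (AIBE.lookNext s o.snd a).Reachable A k M := by
  have hlen := length_answer a ha
  cases a with
  | cont _ m l => exact ⟨N, le_rfl, h.next hs ho hlen m s.tr⟩
  | claim R c z₁ z₂ l =>
    obtain ⟨t, o', hr, hn, hadv, hlen'⟩ := h
    rw [← hadv] at ho
    simp only [Reply.sess] at hlen
    exact ⟨t + 1, by omega, t + 1, o, .act _ hr ho, by simp [AIBE.lookNext], rfl,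
      by simp only [AIBE.lookNext]; omega⟩

theorem lookStep_reachable (h : ∃ M ≤ N, s.Reachable A k M) :
    ∀ s' ∈ (lookStep A mpk IDs ω s).support, ∃ M ≤ N, s'.Reachable A k M := by
  intro s' hs'
  unfold lookStep at hs'
  split_ifs at hs' with hn
  · rw [PMF.mem_support_pure_iff] at hs'
    exact hs' ▸ h
  · rw [PMF.mem_support_bind_iff] at hs'
    obtain ⟨o, ho, hs'⟩ := hs'
    rw [PMF.support_map] at hs'
    obtain ⟨a, ha, rfl⟩ := hs'
    obtain ⟨M, hM, h⟩ := h
    obtain ⟨M', hM', h'⟩ := h.lookNext hn ho ha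
    exact ⟨M', hM'.trans hM, h'⟩

theorem mainStep_reachable (h : s.Reachable A k N) :
    ∀ s' ∈ (mainStep A mpk IDs ω γ τ s).support, s'.Reachable A k N ∧ s'.n = s.n - 1 := by
  intro s' hs'
  unfold mainStep at hs'
  split_ifs at hs' with hn
  · rw [PMF.mem_support_pure_iff] at hs'
    exact ⟨hs' ▸ h, by rw [hs', hn]⟩
  · rw [PMF.mem_support_bind_iff] at hs'
    obtain ⟨o, ho, hs'⟩ := hs'
    rw [PMF.mem_support_bind_iff] at hs'
    obtain ⟨a, ha, hs'⟩ := hs'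
    have hlen := length_answer a ha
    cases a with
    | cont b m l =>
      simp only [mainNext] at hs'
      split_ifs at hs'
      · rw [PMF.mem_support_bind_iff] at hs'
        obtain ⟨a', -, hs'⟩ := hs'
        rw [PMF.support_map] at hs'
        obtain ⟨s'', -, rfl⟩ := hs'
        exact ⟨h.next hn ho hlen m _, rfl⟩
      · rw [PMF.mem_support_pure_iff] at hs'
        subst hs'
        exact ⟨h.next hn ho hlen m _, rfl⟩
    | claim R c z₁ z₂ l =>
      simp only [mainNext] at hs'
      rw [PMF.support_map] at hs'
      obtain ⟨d, -, rfl⟩ := hs'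
      exact ⟨h.next hn ho hlen _ _, rfl⟩

theorem iterP_mainStep_reachable (n : ℕ) (h : s.Reachable A k N) :
    ∀ s' ∈ (iterP (mainStep A mpk IDs ω γ τ) n s).support,
      s'.Reachable A k N ∧ s'.n = s.n - n := by
  induction n generalizing s with
  | zero =>
    intro s' hs'
    rw [iterP, PMF.mem_support_pure_iff] at hs'
    exact ⟨hs' ▸ h, by rw [hs', Nat.sub_zero]⟩
  | succ n ih =>
    intro s' hs'
    rw [iterP, PMF.mem_support_bind_iff] at hs'
    obtain ⟨s₁, h₁, hs'⟩ := hs'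
    obtain ⟨hr, hn⟩ := mainStep_reachable h s₁ h₁
    obtain ⟨hr', hn'⟩ := ih hr s' hs'
    exact ⟨hr', by omega⟩

/-- The output of a simulated run is an output of the adversary after all its activations, to which
the bound on the running time of the device applies. -/
theorem simRun_reaches (h : s.Reachable A k N) :
    ∀ w ∈ (simRun A mpk IDs ω γ τ s).support, ∃ o, A.Reaches k B (N + 1) o ∧ w = o.fst := by
  intro w hw
  rw [simRun, PMF.mem_support_bind_iff] at hw
  obtain ⟨s', hs', hw⟩ := hw
  rw [PMF.support_map] at hw
  obtain ⟨o, ho, rfl⟩ := hw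
  obtain ⟨⟨t, o', hr, hn, hadv, -⟩, h0⟩ := iterP_mainStep_reachable _ h s' hs'
  rw [← hadv] at ho
  obtain rfl : t = N := by omega
  exact ⟨o, .act _ hr ho, rfl⟩

end Invariant

namespace HasParams

variable {ι : Type u} {gen : GroupGen} {κ : ι → ℕ} {x : ι → Data} {P : ι → Params}
  {A : Adversary}

theorem act (E : HasParams gen κ x P) (hA : A.IsPPT gen) {s : ∀ i, SimState (P i).B}
    (hs : PolyComp κ x fun i => (s i).rep)
    (hr : ∀ i, ∃ M ≤ A.rounds.eval (κ i), (s i).Reachable A (κ i) M) :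
    PolySample κ x fun i => A.act.out (.pair (s i).msg.rep (s i).adv) := by
  obtain ⟨T, hT⟩ := hA
  have h : PolyComp κ x fun i => .pair (s i).msg.rep (s i).adv := hs.snd.fst.pair hs.snd.snd.fst
  refine h.trans_sample ⟨h.leaf, A.act, fun i => rfl, _, .eval T .self, fun i => ?_⟩
  obtain ⟨M, hM, t, o, ho, hn, hadv, -⟩ := hr i
  simp only
  rw [← hadv]
  exact (hT (κ i) _ (E.mem i)).2.1 t (by omega) o ho _

theorem lookNext (_ : HasParams gen κ x P) {s : ∀ i, SimState (P i).B} {o : ι → Data}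
    {a : ∀ i, Reply (P i).B} (hs : PolyComp κ x fun i => (s i).rep) (ho : PolyComp κ x o)
    (ha : PolyComp κ x fun i => (a i).rep) :
    PolyComp κ x fun i => (lookNext (s i) (o i) (a i)).rep := by
  refine .split (c := fun i => (a i).rep.fst.toNat = 2) (ha.fst.toNat.eq (.const ha.1 2))
    (fun J φ h => ?_) fun J φ h => ?_
  · have h0 := (hs.1.comap φ)
    refine PolyComp.congr (.pair (.const h0 0) (.pair (.pair (.const h0 3) (.const h0 0))
      (.pair (ho.comap φ) (.pair (ha.comap φ).snd.snd (ha.comap φ).snd.fst)))) fun j => ?_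
    have hj := h j
    cases haj : a (φ j) with
    | cont b m l => rw [haj] at hj; cases b <;> simp [Reply.rep, Data.fst, Data.toNat] at hj
    | claim R c z₁ z₂ l => rfl
  · have hn : PolyComp κ x fun i => .nat (s i).n := hs.fst
    refine PolyComp.congr (.pair ((hn.comap φ).sub (.const (hs.1.comap φ) 1))
      (.pair (ha.comap φ).snd.fst (.pair (ho.comap φ) (.pair (ha.comap φ).snd.snd
        (hs.comap φ).snd.snd.snd.snd)))) fun j => ?_
    have hj := h j
    cases haj : a (φ j) with
    | cont b m l => rfl
    | claim R c z₁ z₂ l => rw [haj] at hj; exact absurd rfl hj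

theorem leaf_state (E : HasParams gen κ x P) (hA : A.IsPPT gen) :
    PolyLeaf (fun j : Σ i, {s : SimState (P i).B //
      ∃ M ≤ A.rounds.eval (κ i), s.Reachable A (κ i) M} => κ j.1) fun j => j.2.1.rep := by
  obtain ⟨Q, hQ⟩ := E.leaf_reaches hA
  refine PolyLeaf.pair ?_ (.pair (E.leaf_msg.comap fun j : Σ i, {s : SimState (P i).B //
      ∃ M ≤ A.rounds.eval (κ i), s.Reachable A (κ i) M} => ⟨j.1, j.2.1.msg⟩)
    (.pair ⟨Q, fun j => ?_⟩ (.pair (E.leaf_sessions.comap fun j : Σ i, {s : SimState (P i).B //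
      ∃ M ≤ A.rounds.eval (κ i), s.Reachable A (κ i) M} => ⟨j.1, j.2.1.sess⟩)
      (E.leaf_transcript.comap fun j : Σ i, {s : SimState (P i).B //
      ∃ M ≤ A.rounds.eval (κ i), s.Reachable A (κ i) M} => ⟨j.1, j.2.1.tr⟩))))
  · refine ⟨A.rounds, fun ⟨i, s, M, hM, t, o, _, hn, _⟩ => ?_⟩
    refine (Nat.size_le.2 (lt_of_le_of_lt ?_ Nat.lt_two_pow_self)).trans hM
    simp only
    omega
  · obtain ⟨i, s, M, hM, t, o, hr, hn, hadv, -⟩ := j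
    simp only
    rw [← hadv]
    exact (Data.leaf_snd o).trans (hQ i t o (by omega) hr)

theorem lookStep (E : HasParams gen κ x P) (hA : A.IsPPT gen) {s : ∀ i, SimState (P i).B}
    (hs : PolyComp κ x fun i => (s i).rep)
    (hr : ∀ i, ∃ M ≤ A.rounds.eval (κ i), (s i).Reachable A (κ i) M) :
    PolySample κ x fun i =>
      (lookStep A (P i).mpk (P i).IDs (P i).ω (s i)).map SimState.rep := by
  have hn : PolyComp κ x fun i => .nat (s i).n := hs.fst
  refine .split (hn.eq (.const hs.1 0)) (fun J φ h => ?_) fun J φ h => ?_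
  · refine PolySample.congr (hs.comap φ) fun j => ?_
    rw [AIBE.lookStep, if_pos (h j), PMF.pure_map]
  · refine PolySample.congr (PolySample.bind_data ((E.comap φ).act hA (hs.comap φ) fun j => hr _)
      (ν := fun j o => ((AIBE.answer (P (φ j)).mpk (P (φ j)).IDs (P (φ j)).ω o.fst
        (s (φ j)).sess).map (AIBE.lookNext (s (φ j)) o.snd)).map SimState.rep)
      fun K ψ o x' _ ho hx => ?_) fun j => ?_
    · have E' := E.lift (fun k => φ (ψ k)) hx
      have hs' := hx.trans (hs.comap fun k => φ (ψ k))
      simp only [PMF.map_comp]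
      refine .map_rep (E'.answer (Q := A.rounds) (fun k => ?_) hs'.snd.snd.snd.fst ho.fst)
        fun I θ a x'' _ ha hx' => ?_
      · obtain ⟨M, hM, t, o, -, hn, -, hlen⟩ := hr (φ (ψ k))
        omega
      · exact (E'.lift θ hx').lookNext (hx'.trans (hs'.comap θ)) (hx'.trans (ho.comap θ)).snd ha
    · rw [AIBE.lookStep, if_neg (h j), PMF.map_bind]

theorem look (E : HasParams gen κ x P) (hA : A.IsPPT gen) {s : ∀ i, SimState (P i).B}
    (hs : PolyComp κ x fun i => (s i).rep)
    (hr : ∀ i, ∃ M ≤ A.rounds.eval (κ i), (s i).Reachable A (κ i) M) :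
    PolySample κ x fun i => (look A (P i).mpk (P i).IDs (P i).ω (s i)).map SimState.rep := by
  refine PolySample.loop (enc := fun i => SimState.rep)
    (fun i s => ∃ M ≤ A.rounds.eval (κ i), s.Reachable A (κ i) M)
    ⟨A.rounds, fun i => ?_⟩ hs.fst hs hr (fun i a ha => lookStep_reachable ha)
    (E.leaf_state hA) fun hl => ?_
  · obtain ⟨M, hM, t, o, -, hn, -⟩ := hr i
    simp only
    omega
  · exact (E.lift Sigma.fst (PolyComp.refl hl).snd).lookStep hA (PolyComp.refl hl).fst
      fun j => j.2.2

theorem mainNext (E : HasParams gen κ x P) (hA : A.IsPPT gen) {s : ∀ i, SimState (P i).B}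
    {o : ι → Data} {a : ∀ i, Reply (P i).B} (hs : PolyComp κ x fun i => (s i).rep)
    (hr : ∀ i, (s i).Reachable A (κ i) (A.rounds.eval (κ i))) (hn0 : ∀ i, (s i).n ≠ 0)
    (ho : PolyComp κ x o) (ho' : ∀ i, o i ∈ (A.act.out (.pair (s i).msg.rep (s i).adv)).support)
    (ha : PolyComp κ x fun i => (a i).rep) :
    PolySample κ x fun i => (mainNext A (P i).mpk (P i).IDs (P i).ω (P i).γ (P i).τ (s i) (o i)
      (a i)).map SimState.rep := by
  have hn : PolyComp κ x fun i => .nat ((s i).n - 1) :=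
    PolyComp.sub (m := fun i => (s i).n) hs.fst (.const hs.1 1)
  refine .split (c := fun i => (a i).rep.fst.toNat = 2) (ha.fst.toNat.eq (.const ha.1 2))
    (fun J φ h => ?_) fun J φ h => ?_
  · have hclaim : ∀ j, ∃ R c z₁ z₂ l, a (φ j) = .claim R c z₁ z₂ l := by
      intro j
      have hj := h j
      cases haj : a (φ j) with
      | cont b m l => rw [haj] at hj; cases b <;> simp [Reply.rep, Data.fst, Data.toNat] at hj
      | claim R c z₁ z₂ l => exact ⟨_, _, _, _, _, rfl⟩
    choose R c z₁ z₂ l hal using hclaim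
    have ha' := ha.comap φ
    simp only [hal, AIBE.mainNext, PMF.map_comp] at ha' ⊢
    refine .map_rep ((E.comap φ).starIssue (a := fun j => (c j, z₁ j, z₂ j)) ha'.snd.fst
      (hs.comap φ).snd.snd.snd.snd) fun K ψ d x' _ hd hx => ?_
    exact .pair (hx.trans (hn.comap fun k => φ (ψ k))) (.pair hd (.pair
      (hx.trans (ho.comap fun k => φ (ψ k))).snd (.pair (hx.trans (ha'.snd.snd.comap ψ))
        (hx.trans (hs.comap fun k => φ (ψ k))).snd.snd.snd.snd)))
  · have hcont : ∀ j, ∃ b m l, a (φ j) = .cont b m l := by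
      intro j
      have hj := h j
      cases haj : a (φ j) with
      | cont b m l => exact ⟨_, _, _, rfl⟩
      | claim R c z₁ z₂ l => rw [haj] at hj; exact absurd rfl hj
    choose b m l hal using hcont
    have ha' := ha.comap φ
    simp only [hal, AIBE.mainNext] at ha' ⊢
    refine .split (c := fun j => b j = true) ha'.fst (fun J₁ φ₁ hb => ?_) fun J₁ φ₁ hb => ?_
    · simp only [hb, if_true, PMF.map_bind]
      have E₁ := E.comap fun j => φ (φ₁ j)
      have hs₁ := hs.comap fun j => φ (φ₁ j)
      refine .bind_rep (E₁.answer (Q := A.rounds) (fun k => ?_) hs₁.snd.snd.snd.fst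
        (ho.comap fun j => φ (φ₁ j)).fst) fun K ψ a' x' ha'' haK hx => ?_
      · obtain ⟨t, o, -, hn, -, hlen⟩ := hr (φ (φ₁ k))
        omega
      · have EK := E₁.lift ψ hx
        simp only [PMF.map_comp]
        refine .map_rep (EK.look hA (EK.lookNext (hx.trans (hs₁.comap ψ))
          (hx.trans (ho.comap fun k => φ (φ₁ (ψ k)))).snd haK) fun k =>
            (hr _).lookNext (hn0 _) (ho' _) (ha'' k)) fun I θ s' x'' _ hs' hx' => ?_
        have hxI := hx'.trans (hx.comap θ)
        exact .pair (hxI.trans (hn.comap fun k => φ (φ₁ (ψ (θ k))))) (.pair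
          (hxI.trans (ha'.snd.fst.comap fun k => φ₁ (ψ (θ k)))) (.pair
          (hxI.trans (ho.comap fun k => φ (φ₁ (ψ (θ k))))).snd (.pair
          (hxI.trans (ha'.snd.snd.comap fun k => φ₁ (ψ (θ k)))) hs'.snd.snd.snd.snd)))
    · simp only [hb, Bool.false_eq_true, if_false, PMF.pure_map]
      exact PolyComp.pair (hn.comap fun j => φ (φ₁ j)) (.pair (ha'.snd.fst.comap φ₁) (.pair
        (ho.comap fun j => φ (φ₁ j)).snd (.pair (ha'.snd.snd.comap φ₁)
          (hs.comap fun j => φ (φ₁ j)).snd.snd.snd.snd)))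

theorem mainStep (E : HasParams gen κ x P) (hA : A.IsPPT gen) {s : ∀ i, SimState (P i).B}
    (hs : PolyComp κ x fun i => (s i).rep)
    (hr : ∀ i, (s i).Reachable A (κ i) (A.rounds.eval (κ i))) :
    PolySample κ x fun i => (mainStep A (P i).mpk (P i).IDs (P i).ω (P i).γ (P i).τ
      (s i)).map SimState.rep := by
  have hn : PolyComp κ x fun i => .nat (s i).n := hs.fst
  refine .split (hn.eq (.const hs.1 0)) (fun J φ h => ?_) fun J φ h => ?_
  · refine PolySample.congr (hs.comap φ) fun j => ?_
    rw [AIBE.mainStep, if_pos (h j), PMF.pure_map]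
  · refine PolySample.congr (PolySample.bind_data ((E.comap φ).act hA (hs.comap φ)
      fun j => ⟨_, le_rfl, hr _⟩)
      (ν := fun j o => (AIBE.answer (P (φ j)).mpk (P (φ j)).IDs (P (φ j)).ω o.fst
        (s (φ j)).sess).bind fun a => (AIBE.mainNext A (P (φ j)).mpk (P (φ j)).IDs (P (φ j)).ω
          (P (φ j)).γ (P (φ j)).τ (s (φ j)) o a).map SimState.rep)
      fun K ψ o x' hoK ho hx => ?_) fun j => ?_
    · have E' := E.lift (fun k => φ (ψ k)) hx
      have hs' := hx.trans (hs.comap fun k => φ (ψ k))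
      refine .bind_rep (E'.answer (Q := A.rounds) (fun k => ?_) hs'.snd.snd.snd.fst ho.fst)
        fun I θ a x'' _ ha hx' => ?_
      · obtain ⟨t, o, -, hn, -, hlen⟩ := hr (φ (ψ k))
        omega
      · exact (E'.lift θ hx').mainNext hA (hx'.trans (hs'.comap θ)) (fun i => hr _)
          (fun i => h _) (hx'.trans (ho.comap θ)) (fun i => hoK _) ha
    · rw [AIBE.mainStep, if_neg (h j), PMF.map_bind]
      simp only [PMF.map_bind]

theorem simRun (E : HasParams gen κ x P) (hA : A.IsPPT gen) {s : ∀ i, SimState (P i).B}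
    (hs : PolyComp κ x fun i => (s i).rep)
    (hr : ∀ i, (s i).Reachable A (κ i) (A.rounds.eval (κ i))) :
    PolySample κ x fun i => simRun A (P i).mpk (P i).IDs (P i).ω (P i).γ (P i).τ (s i) := by
  have hiter : PolySample κ x fun i => (iterP (AIBE.mainStep A (P i).mpk (P i).IDs (P i).ω
      (P i).γ (P i).τ) (s i).n (s i)).map SimState.rep := by
    refine PolySample.loop (enc := fun i => SimState.rep)
      (fun i s => s.Reachable A (κ i) (A.rounds.eval (κ i)))
      ⟨A.rounds, fun i => ?_⟩ hs.fst hs hr (fun i a ha b hb => (mainStep_reachable ha b hb).1)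
      ((E.leaf_state hA).comap fun j : Σ i, {s : SimState (P i).B //
        s.Reachable A (κ i) (A.rounds.eval (κ i))} => ⟨j.1, j.2.1, _, le_rfl, j.2.2⟩) fun hl => ?_
    · obtain ⟨t, o, -, hn, -⟩ := hr i
      simp only
      omega
    · exact (E.lift Sigma.fst (PolyComp.refl hl).snd).mainStep hA (PolyComp.refl hl).fst
        fun j => j.2.2
  refine .bind_rep hiter fun J φ s' x' hs' hs'' hx => ?_
  refine .map_rep (rep := fun _ o => o) (PolySample.congr ((E.lift φ hx).act hA hs'' fun j =>
    ⟨_, le_rfl, (iterP_mainStep_reachable _ (hr _) _ (hs' j)).1⟩) fun j => (PMF.map_id _).symm)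
    fun K ψ o x'' _ ho _ => ho.fst

end HasParams

/-! ### A program for the distinguisher -/

/-- Decisions are represented by `0` and `1`. -/
def boolRep (b : Bool) : Data := .nat (if b then 1 else 0)

namespace HasParams

variable {ι : Type u} {gen : GroupGen} {κ : ι → ℕ} {x : ι → Data} {P : ι → Params}
  {A : Adversary}

theorem device (_ : HasParams gen κ x P) (hA : A.IsPPT gen)
    (hmem : ∀ i, (P i).B ∈ (gen.sample (κ i)).support) {C : ∀ i, Ciphertext (P i).B} {w : ι → Data}
    (hC : PolyComp κ x fun i => (C i).rep) (hw : PolyComp κ x w)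
    (hr : ∀ i, ∃ o, A.Reaches (κ i) (P i).B (A.rounds.eval (κ i) + 1) o ∧ w i = o.fst) :
    PolySample κ x fun i => deviceOf (P i).B A (w i) (C i) := by
  obtain ⟨T, hT⟩ := hA
  have h := hC.pair hw.snd
  refine h.trans_sample ⟨h.leaf, A.decode, fun i => rfl, _, .eval T .self, fun i => ?_⟩
  obtain ⟨o, ho, hwo⟩ := hr i
  simp only [hwo]
  exact (hT (κ i) _ (hmem i)).2.2 o ho _

theorem query (E : HasParams gen κ x P) (hA : A.IsPPT gen) {w : ι → Data}
    {d : ∀ i, UserKey (P i).B} {C₁ : ∀ i, (P i).B.G} {C₃ : ∀ i, (P i).B.GT}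
    (hw : PolyComp κ x w)
    (hr : ∀ i, ∃ o, A.Reaches (κ i) (P i).B (A.rounds.eval (κ i) + 1) o ∧ w i = o.fst)
    (hd₁ : PolyComp κ x fun i => repG (d i).d₁) (hd₂ : PolyComp κ x fun i => repG (d i).d₂)
    (hd₃ : PolyComp κ x fun i => repZ (d i).d₃) (hC₁ : PolyComp κ x fun i => repG (C₁ i))
    (hC₃ : PolyComp κ x fun i => repGT (C₃ i)) :
    PolySample κ x fun i =>
      (query A (P i).mpk.g (P i).ω (w i) (d i) (C₁ i) (C₃ i)).map boolRep := by
  simp only [AIBE.query, PMF.map_bind, PMF.map_comp]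
  refine .bind_rep E.uniformZ fun J φ z x' _ hz hx => ?_
  have E' := E.lift φ hx
  have hC₁' := hx.trans (hC₁.comap φ)
  have hC₃' := hx.trans (hC₃.comap φ)
  have hm := E'.pwT (E'.pairing E'.g E'.g) hz
  have hC₂' := E'.pw hC₁' E'.ω
  have hC₄ := E'.mulGT hm (E'.divGT (E'.pairing hC₁' (hx.trans (hd₁.comap φ)))
    (E'.mulGT (E'.pairing hC₂' (hx.trans (hd₂.comap φ))) (E'.pwT hC₃' (hx.trans (hd₃.comap φ)))))
  refine .map_rep (rep := fun _ y => y) (PolySample.congr (E'.device hA E'.mem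
    (C := fun j => ⟨_, _, _, _⟩) (hC₁'.pair (hC₂'.pair (hC₃'.pair hC₄)))
    (hx.trans (hw.comap φ)) fun j => hr _) fun j => (PMF.map_id _).symm)
    fun K ψ y x'' _ hy hx' => ?_
  refine (hy.toNat.eq (hx'.trans (hm.comap ψ)).toNat).congr fun k => ?_
  simp only [Function.comp, boolRep, decide_eq_true_eq]
  rfl

theorem test (E : HasParams gen κ x P) (hA : A.IsPPT gen) {w : ι → Data}
    {d : ∀ i, UserKey (P i).B} {C₁ : ∀ i, (P i).B.G} {C₃ : ∀ i, (P i).B.GT}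
    (hw : PolyComp κ x w)
    (hr : ∀ i, ∃ o, A.Reaches (κ i) (P i).B (A.rounds.eval (κ i) + 1) o ∧ w i = o.fst)
    (hd₁ : PolyComp κ x fun i => repG (d i).d₁) (hd₂ : PolyComp κ x fun i => repG (d i).d₂)
    (hd₃ : PolyComp κ x fun i => repZ (d i).d₃) (hC₁ : PolyComp κ x fun i => repG (C₁ i))
    (hC₃ : PolyComp κ x fun i => repGT (C₃ i)) :
    PolySample κ x fun i =>
      (test A (P i).mpk (P i).ω (w i) (d i) (C₁ i) (C₃ i)).map boolRep := by
  simp only [AIBE.test, PMF.map_bind, PMF.map_comp]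
  have hquery : ∀ (J : Type u) (φ : J → ι) (x' : J → Data)
      (D₁ : ∀ j, (P (φ j)).B.G) (D₃ : ∀ j, (P (φ j)).B.GT),
      PolyComp (fun j => κ (φ j)) x' (fun j => x (φ j)) →
      PolyComp (fun j => κ (φ j)) x' (fun j => repG (D₁ j)) →
      PolyComp (fun j => κ (φ j)) x' (fun j => repGT (D₃ j)) →
      PolySample (fun j => κ (φ j)) x' fun j => (AIBE.query A (P (φ j)).mpk.g (P (φ j)).ω
        (w (φ j)) (d (φ j)) (D₁ j) (D₃ j)).map boolRep := fun J φ x' D₁ D₃ hx h₁ h₃ =>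
    (E.lift φ hx).query hA (hx.trans (hw.comap φ)) (fun j => hr _) (hx.trans (hd₁.comap φ))
      (hx.trans (hd₂.comap φ)) (hx.trans (hd₃.comap φ)) h₁ h₃
  refine .bind_rep E.uniformUnits fun J₁ φ₁ s x₁ _ hs hx₁ => ?_
  have E₁ := E.lift φ₁ hx₁
  refine .bind_rep (hquery _ φ₁ _ _ _ hx₁ (E₁.pw E₁.X hs)
    (E₁.pwT (E₁.pairing E₁.g E₁.h) hs)) fun J₂ φ₂ b₁ x₂ _ hb₁ hx₂ => ?_
  refine .bind_rep (E₁.lift φ₂ hx₂).uniformUnits fun J₃ φ₃ s₁ x₃ _ hs₁ hx₃ => ?_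
  have h₃ := hx₃.trans (hx₂.comap φ₃)
  refine .bind_rep (E₁.lift (fun j => φ₂ (φ₃ j)) h₃).uniformUnits fun J₄ φ₄ s₂ x₄ _ hs₂ hx₄ => ?_
  have h₄ := hx₄.trans (h₃.comap φ₄)
  have h₄' := h₄.trans (hx₁.comap fun j => φ₂ (φ₃ (φ₄ j)))
  have E₄ := E₁.lift (fun j => φ₂ (φ₃ (φ₄ j))) h₄
  refine .bind_rep (hquery _ (fun j => φ₁ (φ₂ (φ₃ (φ₄ j)))) _ _ _ h₄'
    (E₄.pw E₄.X (hx₄.trans (hs₁.comap φ₄))) (E₄.pwT (E₄.pairing E₄.g E₄.h) hs₂))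
    fun J₅ φ₅ b₂ x₅ _ hb₂ hx₅ => ?_
  have h₅ := hx₅.trans (h₄'.comap φ₅)
  refine .map_rep (hquery _ (fun j => φ₁ (φ₂ (φ₃ (φ₄ (φ₅ j))))) _ _ _ h₅
    (h₅.trans (hC₁.comap _)) (h₅.trans (hC₃.comap _))) fun J₆ φ₆ b₃ x₆ _ hb₃ hx₆ => ?_
  have hb₂' := hx₆.trans (hb₂.comap φ₆)
  have hb₁' := hx₆.trans ((hx₅.trans ((hx₄.trans ((hx₃.trans (hb₁.comap φ₃)).comap φ₄)).comap
    φ₅)).comap φ₆)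
  have hone := PolyComp.const hx₆.1 1
  refine (((hb₁'.toNat.mul (hone.sub hb₂'.toNat)).mul hb₃.toNat).add
    (((hone.sub hb₁'.toNat).mul hb₂'.toNat).mul (hone.sub hb₃.toNat))).congr fun j => ?_
  simp only [Function.comp]
  generalize b₁ _ = c₁
  generalize b₂ _ = c₂
  generalize b₃ _ = c₃
  cases c₁ <;> cases c₂ <;> cases c₃ <;> rfl

theorem finish (E : HasParams gen κ x P) (hA : A.IsPPT gen) {w : ι → Data}
    {C₁ : ∀ i, (P i).B.G} {C₃ : ∀ i, (P i).B.GT} (hw : PolyComp κ x w)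
    (hr : ∀ i, ∃ o, A.Reaches (κ i) (P i).B (A.rounds.eval (κ i) + 1) o ∧ w i = o.fst)
    (hC₁ : PolyComp κ x fun i => repG (C₁ i)) (hC₃ : PolyComp κ x fun i => repGT (C₃ i)) :
    PolySample κ x fun i => (finish A (P i).mpk (P i).IDs (P i).ω (C₁ i) (C₃ i)
      (w i)).map boolRep := by
  classical
  have hfalse : ∀ (J : Type u) (φ : J → ι), (∀ j, AIBE.finish A (P (φ j)).mpk (P (φ j)).IDs
      (P (φ j)).ω (C₁ (φ j)) (C₃ (φ j)) (w (φ j)) = PMF.pure false) →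
      PolySample (fun j => κ (φ j)) (fun j => x (φ j)) fun j => (AIBE.finish A (P (φ j)).mpk
        (P (φ j)).IDs (P (φ j)).ω (C₁ (φ j)) (C₃ (φ j)) (w (φ j))).map boolRep := fun J φ h =>
    PolySample.congr (PolyComp.const (hw.1.comap φ) 0) fun j => by rw [h, PMF.pure_map]; rfl
  refine E.cases_readG hw.fst.fst (fun J φ d₁ h₁ hd₁ => ?_) fun J φ h => hfalse J φ fun j => by
    have : readKey (P (φ j)).B (w (φ j)).fst = none := by rw [readKey, h]
    simp only [AIBE.finish, this]
  refine (E.comap φ).cases_readG (hw.comap φ).fst.snd.fst (fun J₁ φ₁ d₂ h₂ hd₂ => ?_)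
    fun J₁ φ₁ h => hfalse J₁ (fun j => φ (φ₁ j)) fun j => by
      have : readKey (P (φ (φ₁ j))).B (w (φ (φ₁ j))).fst = none := by rw [readKey, h₁, h]
      simp only [AIBE.finish, this]
  have E' := E.comap fun j => φ (φ₁ j)
  have hw' := hw.comap fun j => φ (φ₁ j)
  have hd₁' := hd₁.comap φ₁
  set d : ∀ j, UserKey (P (φ (φ₁ j))).B := fun j =>
    ⟨d₁ (φ₁ j), d₂ j, (P (φ (φ₁ j))).B.readZ (w (φ (φ₁ j))).fst.snd.snd⟩
  have hd₃ : PolyComp _ _ fun j => repZ (d j).d₃ := E'.readZ hw'.fst.snd.snd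
  have hkey : ∀ j, readKey (P (φ (φ₁ j))).B (w (φ (φ₁ j))).fst = some (d j) := fun j => by
    rw [readKey, h₁, h₂]
  refine .split (c := fun j => (d j).Valid (P (φ (φ₁ j))).mpk (P (φ (φ₁ j))).IDs)
    (E'.eqGT (E'.pairing hd₁' E'.X) (E'.mulGT (E'.mulGT (E'.pairing E'.Y E'.g)
      (E'.pwT (E'.pairing E'.h E'.g) hd₃)) (E'.pairing (E'.hashID E'.IDs) hd₂)))
    (fun K ψ h => ?_) fun K ψ h => hfalse K (fun k => φ (φ₁ (ψ k))) fun k => ?_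
  · refine ((E'.comap ψ).test hA (d := fun k => d (ψ k)) (hw'.comap ψ) (fun k => hr _)
      (hd₁'.comap ψ) (hd₂.comap ψ) (hd₃.comap ψ) (hC₁.comap fun k => φ (φ₁ (ψ k)))
      (hC₃.comap fun k => φ (φ₁ (ψ k)))).congr fun k => ?_
    simp only [AIBE.finish, hkey]
    rw [if_pos (h k)]
  · simp only [AIBE.finish, hkey]
    rw [if_neg (h k)]

end HasParams

/-- Short representations of the group elements force the order to be short. -/
theorem order_size_le {B : BilinearGroup} {n : ℕ} (h : ∀ u : B.G, (B.encG u).size ≤ n) :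
    B.p.size ≤ n + 1 := by
  have hcard : Fintype.card B.G ≤ Fintype.card (Fin (2 ^ n)) :=
    Fintype.card_le_of_injective (fun u => ⟨B.encG u, Nat.size_le.1 (h u)⟩) fun u v huv =>
      B.encG_injective (Fin.mk.inj huv)
  rw [B.card_G, Fintype.card_fin] at hcard
  exact Nat.size_le.2 (hcard.trans_lt (Nat.pow_lt_pow_right one_lt_two n.lt_succ_self))

/-- An input of the distinguisher. -/
structure ProblemInstance (gen : GroupGen) : Type 1 where
  k : ℕ
  B : BilinearGroup
  mem : B ∈ (gen.sample k).support
  g : B.G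
  Ta : B.G
  Tb : B.G
  Tc : B.G
  T : B.GT

theorem polySample_experiment {gen : GroupGen} (hgen : gen.Efficient) {A : Adversary}
    (hA : A.IsPPT gen) :
    PolySample (fun i : ProblemInstance gen => i.k)
      (fun i => mdbdhInput i.k i.B i.g i.Ta i.Tb i.Tc i.T)
      fun i => (experiment A i.k i.B i.g i.Ta i.Tb i.Tc i.T).map boolRep := by
  have hleaf : PolyLeaf (fun i : ProblemInstance gen => i.k)
      fun i => mdbdhInput i.k i.B i.g i.Ta i.Tb i.Tc i.T := by
    obtain ⟨_, _, _, _, P, hP⟩ := hgen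
    refine ⟨P + .X + 1, fun ⟨k, B, hB, g, Ta, Tb, Tc, T⟩ => ?_⟩
    obtain ⟨hdesc, hG, hGT, -⟩ := hP k B hB
    have hp := order_size_le hG
    have hk : k.size ≤ k := Nat.size_le.2 Nat.lt_two_pow_self
    have := (Data.leaf_le_size B.desc).trans hdesc
    have := hG g; have := hG Ta; have := hG Tb; have := hG Tc; have := hGT T
    simp only [mdbdhInput, pub, repG, repGT, Data.leaf, Polynomial.eval_add, Polynomial.eval_X,
      Polynomial.eval_one]
    omega
  have hin := PolyComp.refl hleaf
  have H : HasPub gen (fun i : ProblemInstance gen => i.k)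
      (fun i => mdbdhInput i.k i.B i.g i.Ta i.Tb i.Tc i.T) fun i => i.B :=
    ⟨hgen, fun i => i.mem, hin.fst⟩
  have hg : PolyComp _ _ fun i : ProblemInstance gen => repG i.g := hin.snd.fst
  have hTa : PolyComp _ _ fun i : ProblemInstance gen => repG i.Ta := hin.snd.snd.fst
  have hTb : PolyComp _ _ fun i : ProblemInstance gen => repG i.Tb := hin.snd.snd.snd.fst
  have hTc : PolyComp _ _ fun i : ProblemInstance gen => repG i.Tc := hin.snd.snd.snd.snd.fst
  have hT : PolyComp _ _ fun i : ProblemInstance gen => repGT i.T := hin.snd.snd.snd.snd.snd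
  have hchoose : PolySample (fun i : ProblemInstance gen => i.k)
      (fun i => mdbdhInput i.k i.B i.g i.Ta i.Tb i.Tc i.T) fun i => A.choose.out (i.B.pub i.k) := by
    obtain ⟨T, hT⟩ := hA
    exact H.pub.trans_sample ⟨H.pub.leaf, A.choose, fun i => rfl, _, .eval T .self,
      fun i => (hT _ _ i.mem).1⟩
  simp only [experiment, PMF.map_bind]
  refine .bind_data hchoose fun J₁ φ₁ o x₁ ho' ho hx₁ => ?_
  have H₁ := H.lift φ₁ hx₁
  refine .bind_rep H₁.uniformZ fun J₂ φ₂ γ x₂ _ hγ hx₂ => ?_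
  refine .bind_rep (H₁.lift φ₂ hx₂).uniformZ fun J₃ φ₃ τ x₃ _ hτ hx₃ => ?_
  have h₃ := hx₃.trans (hx₂.comap φ₃)
  refine .bind_rep (H₁.lift (fun j => φ₂ (φ₃ j)) h₃).uniformZ fun J₄ φ₄ ω x₄ _ hω hx₄ => ?_
  have h₄ := hx₄.trans (h₃.comap φ₄)
  have h₄' := h₄.trans (hx₁.comap fun j => φ₂ (φ₃ (φ₄ j)))
  have ho₄ := h₄.trans (ho.comap fun j => φ₂ (φ₃ (φ₄ j)))
  have H₄ := H₁.lift (fun j => φ₂ (φ₃ (φ₄ j))) h₄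
  set ψ : J₄ → ProblemInstance gen := fun j => φ₁ (φ₂ (φ₃ (φ₄ j)))
  have E : HasParams gen (fun j => (ψ j).k) x₄ fun j =>
      ⟨(ψ j).B, (ψ j).g, (ψ j).Tc, (ψ j).Tb, (ψ j).B.readZ (o (φ₂ (φ₃ (φ₄ j)))).fst,
        γ (φ₃ (φ₄ j)), τ (φ₄ j), ω j⟩ :=
    { H₄ with
      g := h₄'.trans (hg.comap ψ)
      X := h₄'.trans (hTc.comap ψ)
      h := h₄'.trans (hTb.comap ψ)
      IDs := H₄.readZ ho₄.fst
      γ := hx₄.trans ((hx₃.trans (hγ.comap φ₃)).comap φ₄)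
      τ := hx₄.trans (hτ.comap φ₄)
      ω := hω }
  have hstart : ∀ j, SimState.Reachable A (ψ j).k (A.rounds.eval (ψ j).k)
      (⟨A.rounds.eval (ψ j).k, .mpk (simPK (ψ j).g (ψ j).Tc (ψ j).Tb
        ((ψ j).B.readZ (o (φ₂ (φ₃ (φ₄ j)))).fst) (γ (φ₃ (φ₄ j))) (τ (φ₄ j)) (ω j)),
        (o (φ₂ (φ₃ (φ₄ j)))).snd, [], 0⟩ : SimState (ψ j).B) := fun j =>
    ⟨0, _, .choose (ho' _), Nat.zero_add _, rfl, le_rfl⟩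
  refine .bind_data (E.simRun hA (s := fun j => ⟨_, .mpk _, _, [], 0⟩) ?_ fun j => ?_)
    fun J₅ φ₅ w x₅ hw' hw hx₅ => ?_
  · have h0 : PolyComp (fun j => (ψ j).k) x₄ fun j => repZ (0 : ZMod (ψ j).B.p) :=
      (H₄.constZ 0).congr fun j => by rw [Nat.cast_zero]
    exact .pair (.eval A.rounds H₄.k) (.pair E.mpk (.pair ho₄.snd (.pair (.const h0.1 0)
      (.pair h0 (.pair h0 h0)))))
  · exact hstart j
  · have h₅ := hx₅.trans (h₄'.comap φ₅)
    exact (E.lift φ₅ hx₅).finish hA hw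
      (fun j => simRun_reaches (hstart (φ₅ j)) _ (hw' j))
      (h₅.trans (hTa.comap fun j => ψ (φ₅ j))) (h₅.trans (hT.comap fun j => ψ (φ₅ j)))

/-- The experiment is run by a polynomial time distinguisher. -/
theorem exists_distinguisher {gen : GroupGen} (hgen : gen.Efficient) {A : Adversary}
    (hA : A.IsPPT gen) : ∃ D : Prog, IsPPTDistinguisher gen D ∧
      ∀ k, ∀ B ∈ (gen.sample k).support, ∀ (g Ta Tb Tc : B.G) (T : B.GT),
        D.out (mdbdhInput k B g Ta Tb Tc T) = (experiment A k B g Ta Tb Tc T).map boolRep := by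
  obtain ⟨-, D, hD, S, ⟨P, hP⟩, hS⟩ := polySample_experiment hgen hA
  exact ⟨D, ⟨P, fun k B hB g Ta Tb Tc T _ => (hS ⟨k, B, hB, g, Ta, Tb, Tc, T⟩).mono (hP _)⟩,
    fun k B hB g Ta Tb Tc T => hD ⟨k, B, hB, g, Ta, Tb, Tc, T⟩⟩

/-! ### Negligible functions -/

theorem negligible_two_pow : Negligible fun k => ((2 : ℝ) ^ k)⁻¹ := by
  intro n
  have := tendsto_pow_const_div_const_pow_of_one_lt n (one_lt_two (α := ℝ))
  simpa only [div_eq_mul_inv] using this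

theorem Negligible.mono {f g : ℕ → ℝ} (hf : Negligible f) (h0 : ∀ k, 0 ≤ g k)
    (h : ∀ᶠ k in atTop, g k ≤ f k) : Negligible g := by
  refine Asymptotics.SuperpolynomialDecay.trans_eventually_abs_le hf ?_
  filter_upwards [h] with k hk
  simp only [Function.comp]
  rw [abs_of_nonneg (h0 k)]
  exact hk.trans (le_abs_self _)

theorem Negligible.of_sq {f : ℕ → ℝ} (hf : Negligible fun k => f k ^ 2) : Negligible f := by
  refine (Asymptotics.superpolynomialDecay_iff_abs_tendsto_zero _ _ _).2 fun n => ?_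
  have h := (hf (2 * n)).sqrt
  rw [Real.sqrt_zero] at h
  refine h.congr fun k => ?_
  rw [← Real.sqrt_sq_eq_abs]
  congr 1
  ring

theorem Negligible.eval_mul {f : ℕ → ℝ} (hf : Negligible f) (P : Polynomial ℕ) :
    Negligible fun k => ((P.eval k : ℕ) : ℝ) * f k := by
  refine Asymptotics.SuperpolynomialDecay.congr
    (Asymptotics.SuperpolynomialDecay.polynomial_mul hf (P.map (Nat.castRingHom ℝ))) fun k => ?_
  congr 1
  rw [Polynomial.eval_map, Polynomial.eval₂_at_natCast]
  rfl

/-- Exponentials dominate polynomials. -/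
theorem eventually_eval_le (P : Polynomial ℕ) : ∀ᶠ k in atTop, P.eval k ≤ 2 ^ k := by
  have h := negligible_two_pow.eval_mul P 0
  simp only [pow_zero, one_mul] at h
  filter_upwards [h.eventually (ge_mem_nhds zero_lt_one)] with k hk
  rw [← div_eq_mul_inv, div_le_one (by positivity)] at hk
  exact_mod_cast hk

/-! ### The advantage of the adversary -/

theorem realScore_le_one (gen : GroupGen) (A : Adversary) (k : ℕ) : realScore gen A k ≤ 1 :=
  ev_le_one fun _ => ev_le_one fun _ => ev_le_one fun _ => ev_le_one fun _ => score_le_one _ _ _ _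

theorem simScore_le_one (gen : GroupGen) (A : Adversary) (k : ℕ) : simScore gen A k ≤ 1 :=
  ev_le_one fun _ => ev_le_one fun _ => ev_le_one fun _ => ev_le_one fun _ => ev_le_one fun _ =>
    ev_le_one fun _ => ev_le_one fun _ => ev_le_one fun _ => ev_le_one fun _ => score_le_one _ _ _ _

/-- Rewinding costs a square: the expected squared gap in the game is bounded by about the
square root of the advantage of the distinguisher. -/
theorem sq_realScore_le (gen : GroupGen) (A : Adversary) (k : ℕ) :
    (realScore gen A k).toReal ^ 2
      ≤ 2 * (simScore gen A k).toReal + 4 * ((2 : ℝ) ^ k)⁻¹ := by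
  have hR := realScore_le_one gen A k
  have hRt := ne_top_of_le_ne_top ENNReal.one_ne_top hR
  have hSt := ne_top_of_le_ne_top ENNReal.one_ne_top (simScore_le_one gen A k)
  have h2t : ((2 : ℝ≥0∞) ^ k)⁻¹ ≠ ⊤ := ENNReal.inv_ne_top.2 (by positivity)
  -- The choice `s = R / 2` is admissible since `R ≤ 1`, and leaves `R ^ 2 - R ^ 2 / 4`.
  set R := realScore gen A k
  have hs : 2 * (R / 2) = R := ENNReal.mul_div_cancel (by norm_num) (by norm_num)
  have h := realScore_le gen A k (s := R / 2) (by rw [hs]; exact hR)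
  rw [hs] at h
  have hst : R / 2 ≠ ⊤ := ENNReal.div_ne_top hRt (by norm_num)
  have h3t : 3 * ((2 : ℝ≥0∞) ^ k)⁻¹ ≠ ⊤ := ENNReal.mul_ne_top (by norm_num) h2t
  have hsst := ENNReal.mul_ne_top hst hst
  have h' := ENNReal.toReal_mono
    (ENNReal.add_ne_top.2 ⟨hSt, ENNReal.add_ne_top.2 ⟨hsst, h3t⟩⟩) h
  rw [ENNReal.toReal_add hSt (ENNReal.add_ne_top.2 ⟨hsst, h3t⟩), ENNReal.toReal_add hsst h3t] at h'
  simp only [ENNReal.toReal_mul, ENNReal.toReal_div, ENNReal.toReal_inv, ENNReal.toReal_pow,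
    ENNReal.toReal_ofNat] at h'
  have hS0 : 0 ≤ (simScore gen A k).toReal := ENNReal.toReal_nonneg
  have h20 : (0 : ℝ) ≤ ((2 : ℝ) ^ k)⁻¹ := by positivity
  nlinarith

theorem negligible_realScore {gen : GroupGen} (hgen : gen.Efficient) (hmDBDH : MDBDH gen)
    {A : Adversary} (hA : A.IsPPT gen) : Negligible fun k => (realScore gen A k).toReal := by
  obtain ⟨D, hD, hout⟩ := exists_distinguisher hgen hA
  have hadv := hmDBDH D hD
  have heq : mdbdhAdvantage gen D = fun k => (simScore gen A k).toReal := funext fun k =>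
    mdbdhAdvantage_eq fun B hB g Ta Tb Tc T _ => hout k B hB g Ta Tb Tc T
  rw [heq] at hadv
  refine Negligible.of_sq (Negligible.mono (Asymptotics.SuperpolynomialDecay.add
    (Asymptotics.SuperpolynomialDecay.const_mul hadv 2)
    (Asymptotics.SuperpolynomialDecay.const_mul negligible_two_pow 4)) (fun k => sq_nonneg _)
    (.of_forall fun k => sq_realScore_le gen A k))

end AIBE

end

theorem mainTheorem4 (gen : AIBE.GroupGen) (hgen : gen.Efficient) (hmDBDH : AIBE.MDBDH gen)
    (ε : ℕ → ℝ) (hε : AIBE.Noticeable ε)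
    (A : AIBE.Adversary) (hA : A.IsPPT gen) :
    AIBE.Negligible (AIBE.advantage gen A ε) := by
  obtain ⟨P, hP⟩ := hε
  have hR := AIBE.negligible_realScore hgen hmDBDH hA
  refine AIBE.Negligible.mono (Asymptotics.SuperpolynomialDecay.add
    (hR.eval_mul (4 * P ^ 2)) AIBE.negligible_two_pow) (fun k => ENNReal.toReal_nonneg) ?_
  filter_upwards [hP, AIBE.eventually_eval_le (4 * P)] with k hk hk'
  have h := AIBE.computeNewKey_le gen A k hk (by simpa using hk')
  have hRt := ne_top_of_le_ne_top ENNReal.one_ne_top (AIBE.realScore_le_one gen A k)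
  have h1 : 4 * ((P.eval k : ℕ) : ENNReal) ^ 2 * AIBE.realScore gen A k ≠ ⊤ :=
    ENNReal.mul_ne_top (ENNReal.mul_ne_top (by norm_num)
      (ENNReal.pow_ne_top (ENNReal.natCast_ne_top _))) hRt
  have h2 : ((2 : ENNReal) ^ k)⁻¹ ≠ ⊤ := ENNReal.inv_ne_top.2 (by positivity)
  have h' := ENNReal.toReal_mono (ENNReal.add_ne_top.2 ⟨h1, h2⟩) h
  rw [ENNReal.toReal_add h1 h2] at h'
  simpa [AIBE.advantage] using h'
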